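/- **Setting.** Let $k=\mathbb R$ or $\mathbb C$, $n\ge 2$, and let $M$ be a triangulated $n$-manifold without boundary; more generally, $M$ may be any simplicial complex that is a homology $n$-manifold, i.e. the link of every $p$-simplex has the reduced integral homology of $S^{n-p-1}$. A *discrete DG connection* on $M$ is a family of numbers $b_{T:i}\in k^*$, one for every $n$-simplex $T$ and vertex $i\in T$. *Abelian gauge transformations* are $b_{T:i}\mapsto f_T\,b_{T:i}\,g_i^{-1}$ with $f_T,g_i\in k^*$. For distinct vertices $i,j$ of $T$ put $\mu^T_{ij}=-b_{T:i}/b_{T:j}$, and $\mu_{ii}^T=1$; thus $\mu_{ij}^T\mu_{ji}^T=1$ and $\mu_{ij}^T\mu_{jl}^T\mu_{li}^T=-1$ for distinct $i,j,l$. For $i,j\in T\cap T'$ put $\rho_{ij}^{TT'}=\mu_{ij}^T\mu_{ji}^{T'}$. For a closed framed path $\gamma$, i.e. a closed sequence of edges $[i_q,i_{q+1}]$ together with $n$-simplices $T_q\supset[i_q,i_{q+1}]$, put $\mu(\gamma)=\prod_q(-\mu^{T_q}_{i_qi_{q+1}})$. Call $T,T'$ neighbours if $T\cap T'$ is an $(n-1)$-simplex.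 Let $\gamma_k,a_s$ be closed framed paths representing a basis of $H_1(M,\mathbb Z)$, i.e. $H_1(M,\mathbb Z)=\bigoplus_k\mathbb Z[\gamma_k]\oplus\bigoplus_s(\mathbb Z/m_s)[a_s]$ with $m_s\ge2$. A *framed 2-chain* is a formal sum of oriented 2-simplices $\Delta_q$, each with an $n$-simplex $T_q\supset\Delta_q$, together with a matching of some of the oriented edges of the $\partial\Delta_q$ in pairs of the same edge with opposite orientations; the unmatched edges, with the framings $T_q$, form its framed boundary. Its *framed product* is $\prod\rho_{ij}^{T_qT_{q'}}$ over the matched pairs, where $[ij]$ is oriented as in $\partial\Delta_{q'}$. It is a framed 2-cycle if nothing is unmatched. **Theorem 1.** 1. *(Invariants.)* All $\rho_{ij}^{TT'}$ and all $\mu(\gamma)$ are invariant under abelian gauge transformations. Any two $n$-simplices $T,T'$ containing an edge $ij$ are joined by a path of successive neighbours $T=T_0,\dots,T_N=T'$ all containing $ij$, and $\rho_{ij}^{TT'}=\prod_p\rho_{ij}^{T_pT_{p+1}}$ along every such path. The $\rho_{ij}^{TT'}$ of neighbours $T,T'$ together with the $\mu(\gamma_k)$ and $\mu(a_s)$ form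 a complete set of invariants: two connections for which they agree differ by an abelian gauge transformation. 2. *(Relations.)* Every connection satisfies - (A) $\rho_{ij}^{TT'}\rho_{jl}^{TT'}\rho_{li}^{TT'}=1$ for every 2-simplex $[ijl]\subset T\cap T'$; - (B) $\prod_p\rho_{ij}^{T_pT_{p+1}}=1$ for every closed path of successive neighbours that all contain the edge $ij$; - for every framed integral 2-cycle the framed product equals $1$; - for every framed 2-chain whose framed boundary is a closed framed path $a$ taken $r$ times, the framed product equals $\mu(a)^{r}$. 3. *(Completeness of the relations; realization.)* Let $z_q$ be framed 2-cycles whose classes generate $H_2(M,\mathbb Z)$, and for every $s$ let $u_s$ be a framed 2-chain whose framed boundary is $a_s$ taken $m_s$ times (so $\partial u_s=m_sa_s$). Let numbers $\rho_{ij}^{TT'},x_k,y_s\in k^*$ be given, for edges $ij\subset T\cap T'$ of neighbours $T,T'$; for other pairs let $\rho_{ij}^{TT'}$ be the product along a fixed path of successive neighbours from $T$ to $T'$ that contain $ij$. There is a connection with these $\rho_{ij}^{TT'}$ (for neighbours) and with $\mu(\gamma_k)=x_k$, $\mu(a_s)=y_s$ if and only if: $\rho_{ij}^{TT'}=\rho_{ji}^{T'T}=(\rho_{ij}^{T'T})^{-1}$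 for neighbours; (A) holds for neighbours; (B) holds for the boundaries of the dual 2-cells (the cyclically ordered stars of the $(n-2)$-simplices containing $ij$); the framed product of every $z_q$ is $1$; and the framed product of every $u_s$ is $y_s^{m_s}$. This connection is unique up to abelian gauge transformations. 4. *(Surfaces.)* If $n=2$ and $M$ is compact, connected and oriented, then data as in 3 with $\rho_{ij}^{TT'}=\rho_{ji}^{T'T}=(\rho_{ij}^{T'T})^{-1}$ are realized by a connection if and only if $\prod_{[ij]}\rho_{ij}^{TT'}=1$, the product being over all edges, with $T\cap T'=[ij]$, $\partial T=[ij]+\cdots$, $\partial T'=[ji]+\cdots$. 5. *(The case $n=3$.)* If $n=3$, $M$ is compact, connected and oriented, and the classes of the $z_q$ form a basis of $H_2(M,\mathbb Z)$, there is exactly one dependence among the relations. For a 2-simplex $\Delta=[ijl]=T\cap T'$ with $\partial T=[ijl]+\cdots$, $\partial T'=[jil]+\cdots$ let $A_\Delta=\rho_{ij}^{TT'}\rho_{jl}^{TT'}\rho_{li}^{TT'}$. For an edge $e=[ij]$ let $B_e=\prod_p\rho_{ij}^{T_pT_{p+1}}$ around its star, passed in the direction for which $T_p\cap T_{p+1}=[ijl]$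 implies $\partial T_p=[ijl]+\cdots$. Let $Z_q$ be the framed product of $z_q$ and let $U_s$ be that of $u_s$ divided by $y_s^{m_s}$. For integers $\alpha_\Delta,\beta_e,\zeta_q,\upsilon_s$ the identity $$\prod_\Delta A_\Delta^{\alpha_\Delta}\prod_eB_e^{\beta_e}\prod_qZ_q^{\zeta_q}\prod_sU_s^{\upsilon_s}=1$$ holds for all values of the quantities with $\rho_{ij}^{TT'}=\rho_{ji}^{T'T}=(\rho_{ij}^{T'T})^{-1}$ if and only if there is an integer $c$ with all $\alpha_\Delta=c$, all $\beta_e=-c$, and all $\zeta_q=\upsilon_s=0$. (So the only dependence is $\prod_\Delta A_\Delta=\prod_eB_e$, both sides being the product of all $\rho_{ij}^{TT'}$ over the edges $ij$ of the 2-simplices.) -/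

import Mathlib

noncomputable section

namespace DiscreteDG

/-! ### Simplicial homology

Chains are integral combinations of finite vertex sets; a linear order on the vertices is used only
to fix the sign conventions. Chain groups are indexed by the number of vertices `c` of the
simplices, i.e. by dimension plus one. -/

section Homology

variable {V : Type*} [LinearOrder V]

/-- The simplicial boundary operator: the face of `s` opposite to `v` appears with the sign
`(-1) ^ p`, where `p` is the position of `v` in the increasing enumeration of `s`. -/
def bdry : (Finset V →₀ ℤ) →ₗ[ℤ] (Finset V →₀ ℤ) :=
  Finsupp.linearCombination ℤ fun s : Finset V =>
    ∑ v ∈ s, Finsupp.single (s.erase v) ((-1 : ℤ) ^ (s.filter (· < v)).card)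

/-- Integral chains of the `(c - 1)`-dimensional simplices of a family `L`. -/
def chains (L : Set (Finset V)) (c : ℕ) : Submodule ℤ (Finset V →₀ ℤ) :=
  Finsupp.supported ℤ ℤ {s | s ∈ L ∧ s.card = c}

def cycles (L : Set (Finset V)) (c : ℕ) : Submodule ℤ (Finset V →₀ ℤ) :=
  chains L c ⊓ LinearMap.ker bdry

def boundaries (L : Set (Finset V)) (c : ℕ) : Submodule ℤ (Finset V →₀ ℤ) :=
  (chains L (c + 1)).map bdry

/-- The homology of `L` in dimension `c - 1`. If `∅ ∈ L`, this is the reduced homology. -/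
abbrev Homology (L : Set (Finset V)) (c : ℕ) : Type _ :=
  cycles L c ⧸ (boundaries L c).comap (cycles L c).subtype

/-- The link of a simplex, with the empty simplex included. -/
def link (K : AbstractSimplicialComplex V) (s : Finset V) : Set (Finset V) :=
  {t | Disjoint s t ∧ s ∪ t ∈ K.faces}

/-- `K` is an `n`-dimensional homology manifold (without boundary): the link of every
`p`-simplex has the reduced integral homology of the sphere of dimension `n - p - 1`. With `s`
the simplex and simplices counted by vertices, the only nonzero group is that of the index `c`
with `c + s.card = n + 1`. Every triangulation of a topological `n`-manifold has this property. -/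
def IsHomologyManifold (K : AbstractSimplicialComplex V) (n : ℕ) : Prop :=
  ∀ s ∈ K.faces, ∀ c : ℕ,
    (c + s.card = n + 1 → Nonempty (Homology (link K s) c ≃ₗ[ℤ] ℤ)) ∧
    (c + s.card ≠ n + 1 → Subsingleton (Homology (link K s) c))

/-- Any two vertices are joined by a path of edges. -/
def IsConnected (K : AbstractSimplicialComplex V) : Prop :=
  ∀ v w : V, Relation.ReflTransGen (fun x y => ({x, y} : Finset V) ∈ K.faces) v w

/-- The sign of a list of distinct vertices relative to its increasing rearrangement. -/
def listSign : List V → ℤ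
  | [] => 1
  | a :: l => (l.map fun b => if a < b then (1 : ℤ) else -1).prod * listSign l

/-- The oriented simplex with the given list of (distinct) vertices, as a chain. -/
def orientedSimplex (l : List V) : Finset V →₀ ℤ :=
  Finsupp.single l.toFinset (listSign l)

end Homology

section Framed

variable {V : Type*} [LinearOrder V]

/-- The `n`-simplices. -/
abbrev Facet (K : AbstractSimplicialComplex V) (n : ℕ) : Type _ :=
  {T : Finset V // T ∈ K.faces ∧ T.card = n + 1}

/-- Closest neighbours: two `n`-simplices whose intersection is an `(n - 1)`-simplex. -/
def Adj {K : AbstractSimplicialComplex V} {n : ℕ} (T T' : Facet K n) : Prop :=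
  (T.1 ∩ T'.1).card = n

/-- An oriented edge `⟨src, tgt⟩` framed by an `n`-simplex `T` that contains it. -/
structure FramedEdge (K : AbstractSimplicialComplex V) (n : ℕ) where
  src : V
  tgt : V
  T : Facet K n
  ne : src ≠ tgt
  src_mem : src ∈ T.1
  tgt_mem : tgt ∈ T.1

/-- A closed framed combinatorial path. -/
structure FramedLoop (K : AbstractSimplicialComplex V) (n : ℕ) where
  len : ℕ
  edge : Fin len → FramedEdge K n
  closed : ∀ q : Fin len, (edge q).tgt = (edge (finRotate len q)).src

/-- The underlying 1-cycle of a closed framed path. -/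
def FramedLoop.chain {K : AbstractSimplicialComplex V} {n : ℕ} (γ : FramedLoop K n) :
    Finset V →₀ ℤ :=
  ∑ q, orientedSimplex [(γ.edge q).src, (γ.edge q).tgt]

/-- An oriented 2-simplex `[a, b, c]` framed by an `n`-simplex `T` that contains it. -/
structure FramedTriangle (K : AbstractSimplicialComplex V) (n : ℕ) where
  a : V
  b : V
  c : V
  T : Facet K n
  ne_ab : a ≠ b
  ne_bc : b ≠ c
  ne_ca : c ≠ a
  a_mem : a ∈ T.1
  b_mem : b ∈ T.1
  c_mem : c ∈ T.1

/-- The three oriented boundary edges of a framed triangle, with the induced framing. -/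
def FramedTriangle.edge {K : AbstractSimplicialComplex V} {n : ℕ} (t : FramedTriangle K n) :
    Fin 3 → FramedEdge K n :=
  ![⟨t.a, t.b, t.T, t.ne_ab, t.a_mem, t.b_mem⟩,
    ⟨t.b, t.c, t.T, t.ne_bc, t.b_mem, t.c_mem⟩,
    ⟨t.c, t.a, t.T, t.ne_ca, t.c_mem, t.a_mem⟩]

/-- A framed integral 2-chain, presented as a formal sum of framed oriented triangles (repetitions
and cancelling terms are allowed) in which the boundary edges of the triangles are
* either matched in pairs consisting of the same edge with opposite orientations,
* or left over; the left over framed edges are the prescribed family `bd`, the framed boundary. -/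
structure FramedChain (K : AbstractSimplicialComplex V) (n : ℕ) {ι : Type*}
    (bd : ι → FramedEdge K n) where
  size : ℕ
  tri : Fin size → FramedTriangle K n
  pairs : ℕ
  glue : (Fin pairs ⊕ Fin pairs) ⊕ ι ≃ Fin size × Fin 3
  opposite : ∀ q : Fin pairs,
    ((tri (glue (.inl (.inr q))).1).edge (glue (.inl (.inr q))).2).src =
        ((tri (glue (.inl (.inl q))).1).edge (glue (.inl (.inl q))).2).tgt ∧
      ((tri (glue (.inl (.inr q))).1).edge (glue (.inl (.inr q))).2).tgt =
        ((tri (glue (.inl (.inl q))).1).edge (glue (.inl (.inl q))).2).src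
  boundary : ∀ x : ι, (tri (glue (.inr x)).1).edge (glue (.inr x)).2 = bd x

/-- A framed integral 2-cycle: nothing is left over. -/
abbrev FramedCycle (K : AbstractSimplicialComplex V) (n : ℕ) : Type _ :=
  FramedChain K n (fun x : Empty => (x.elim : FramedEdge K n))

/-- The framed boundary `m · a`: the closed framed path `a` repeated `m` times. -/
def FramedLoop.times {K : AbstractSimplicialComplex V} {n : ℕ} (a : FramedLoop K n) (m : ℕ) :
    Fin m × Fin a.len → FramedEdge K n :=
  fun x => a.edge x.2

section Chain

variable {K : AbstractSimplicialComplex V} {n : ℕ} {ι : Type*} {bd : ι → FramedEdge K n}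

/-- The underlying integral 2-chain. -/
def FramedChain.chain (w : FramedChain K n bd) : Finset V →₀ ℤ :=
  ∑ q, orientedSimplex [(w.tri q).a, (w.tri q).b, (w.tri q).c]

/-- The first framed edge of a matched pair, a boundary edge of the triangle `Δ_k`. -/
def FramedChain.fst (w : FramedChain K n bd) (q : Fin w.pairs) : FramedEdge K n :=
  (w.tri (w.glue (.inl (.inl q))).1).edge (w.glue (.inl (.inl q))).2

/-- The second framed edge of a matched pair, a boundary edge of the triangle `Δ_k'`. -/
def FramedChain.snd (w : FramedChain K n bd) (q : Fin w.pairs) : FramedEdge K n :=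
  (w.tri (w.glue (.inl (.inr q))).1).edge (w.glue (.inl (.inr q))).2

/-- The framed product `∏ ρ_ij^{T_k T_k'}` over the matched pairs; `[ij]` has the orientation
which it has in the boundary of `Δ_k'`. -/
def FramedChain.prod {M : Type*} [CommMonoid M] (w : FramedChain K n bd)
    (ρ : V → V → Facet K n → Facet K n → M) : M :=
  ∏ q, ρ (w.snd q).src (w.snd q).tgt (w.fst q).T (w.snd q).T

end Chain

variable {K : AbstractSimplicialComplex V} {n : ℕ}

/-- The closed framed paths `γ, a` represent a basis of `H_1(K, ℤ)`: it is the direct sum of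
infinite cyclic groups generated by the classes of the `γ k` and of cyclic groups of orders
`m s ≥ 2` generated by the classes of the `a s`. -/
structure IsH1Basis {κ τ : Type*} (γ : κ → FramedLoop K n) (a : τ → FramedLoop K n)
    (m : τ → ℕ) : Prop where
  two_le : ∀ s, 2 ≤ m s
  span : ∀ c ∈ cycles K.faces 2, ∃ (x : κ →₀ ℤ) (y : τ →₀ ℤ),
    c - (Finsupp.linearCombination ℤ (fun k => (γ k).chain) x +
      Finsupp.linearCombination ℤ (fun s => (a s).chain) y) ∈ boundaries K.faces 2
  indep : ∀ (x : κ →₀ ℤ) (y : τ →₀ ℤ),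
    (Finsupp.linearCombination ℤ (fun k => (γ k).chain) x +
      Finsupp.linearCombination ℤ (fun s => (a s).chain) y) ∈ boundaries K.faces 2 ↔
    x = 0 ∧ ∀ s, (m s : ℤ) ∣ y s

/-- The classes of the framed 2-cycles `z` generate `H_2(K, ℤ)`. -/
def GeneratesH2 {ι : Type*} (z : ι → FramedCycle K n) : Prop :=
  ∀ c ∈ cycles K.faces 3, ∃ x : ι →₀ ℤ,
    c - Finsupp.linearCombination ℤ (fun q => (z q).chain) x ∈ boundaries K.faces 3

/-- The classes of the framed 2-cycles `z` are linearly independent in `H_2(K, ℤ)`. -/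
def IndependentInH2 {ι : Type*} (z : ι → FramedCycle K n) : Prop :=
  ∀ x : ι →₀ ℤ,
    Finsupp.linearCombination ℤ (fun q => (z q).chain) x ∈ boundaries K.faces 3 → x = 0

/-! ### Connections and their invariants -/

section Connection

variable {k : Type*} [Field k]

/-- A discrete DG connection: nonzero coefficients `b T i` for every `n`-simplex `T` and every
vertex `i` of `T`. (The values at vertices outside `T` are never used.) -/
abbrev Connection (K : AbstractSimplicialComplex V) (n : ℕ) (k : Type*) [Field k] : Type _ :=
  Facet K n → V → kˣ

/-- Abelian gauge transformations `Q ↦ f_T Q g_P⁻¹`. -/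
def GaugeEquiv (b b' : Connection K n k) : Prop :=
  ∃ (f : Facet K n → kˣ) (g : V → kˣ), ∀ T : Facet K n, ∀ i ∈ T.1,
    b' T i = f T * b T i * (g i)⁻¹

/-- The coefficients `μ_ij^T`, with the sign for which `μ_ij μ_ji = 1` and
`μ_ij μ_jl μ_li = -1` for distinct vertices. -/
def mu (b : Connection K n k) (T : Facet K n) (i j : V) : kˣ :=
  if i = j then 1 else -(b T i / b T j)

/-- The gauge-invariant coefficients `ρ_ij^{TT'} = μ_ij^T μ_ji^{T'}`. -/
def rho (b : Connection K n k) (i j : V) (T T' : Facet K n) : kˣ :=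
  mu b T i j * mu b T' j i

/-- The abelian framed holonomy `∏ (-μ_{i i'}^T)` along a closed framed path. -/
def holonomy (b : Connection K n k) (γ : FramedLoop K n) : kˣ :=
  ∏ q, -(mu b (γ.edge q).T (γ.edge q).src (γ.edge q).tgt)

end Connection

/-! ### Abstract data and the relations -/

/-- The product `r T₀ T₁ * r T₁ T₂ * ⋯` along a path of `n`-simplices. -/
def pathProd {F M : Type*} [Monoid M] (r : F → F → M) : List F → M
  | T :: T' :: l => r T T' * pathProd r (T' :: l)
  | _ => 1

/-- `l` is a path of `n`-simplices from `T` to `T'` in the star of the simplex `s`: all of them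
contain `s`, and consecutive ones are closest neighbours. -/
def IsStarPath (s : Finset V) (T T' : Facet K n) (l : List (Facet K n)) : Prop :=
  l.head? = some T ∧ l.getLast? = some T' ∧ l.IsChain Adj ∧ ∀ S ∈ l, s ⊆ S.1

/-- A choice, for every edge `ij` and any two `n`-simplices containing it, of a path that joins them
in the star of `ij`. -/
def IsPathSystem (P : V → V → Facet K n → Facet K n → List (Facet K n)) : Prop :=
  ∀ (i j : V) (T T' : Facet K n), i ≠ j → {i, j} ⊆ T.1 → {i, j} ⊆ T'.1 →
    IsStarPath {i, j} T T' (P i j T T')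

/-- The whole set of quantities `ρ_ij^{TT'}` recovered from those of closest neighbours `T, T'` by
taking products along paths. -/
def extend {M : Type*} [Monoid M] (P : V → V → Facet K n → Facet K n → List (Facet K n))
    (ρ : V → V → Facet K n → Facet K n → M) : V → V → Facet K n → Facet K n → M :=
  fun i j T T' => pathProd (ρ i j) (P i j T T')

/-- The cyclically ordered boundary of the dual 2-cell of an `(n - 2)`-simplex `s`: all the
`n`-simplices of the star of `s`, each once, cyclically consecutive ones being closest
neighbours. -/
def IsDualCellBoundary (s : Finset V) (l : List (Facet K n)) : Prop :=
  l.Nodup ∧ (∀ T, T ∈ l ↔ s ⊆ T.1) ∧ (l ++ l.head?.toList).IsChain Adj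

/-- The product around a cyclically ordered list. -/
def cyclicProd {F M : Type*} [Monoid M] (r : F → F → M) (l : List F) : M :=
  pathProd r (l ++ l.head?.toList)

section Relations

variable {M : Type*} [CommGroup M]

/-- Quantities `ρ_ij^{TT'}` indexed by closest neighbours `T, T'` and edges `ij` of `T ∩ T'`, where
exchanging `T, T'` inverts the quantity and exchanging both `T, T'` and `i, j` preserves it.
(Values for other indices are never used.) -/
def IsRhoData (ρ : V → V → Facet K n → Facet K n → M) : Prop :=
  ∀ (i j : V) (T T' : Facet K n), i ≠ j → Adj T T' → {i, j} ⊆ T.1 ∩ T'.1 →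
    ρ i j T T' * ρ i j T' T = 1 ∧ ρ j i T' T = ρ i j T T'

/-- The trivial relations A. -/
def RelationA (ρ : V → V → Facet K n → Facet K n → M) : Prop :=
  ∀ (i j l : V) (T T' : Facet K n), i ≠ j → j ≠ l → l ≠ i → Adj T T' →
    {i, j, l} ⊆ T.1 ∩ T'.1 → ρ i j T T' * ρ j l T T' * ρ l i T T' = 1

/-- The trivial relations B, for the boundaries of the dual 2-cells. -/
def RelationB (ρ : V → V → Facet K n → Facet K n → M) : Prop :=
  ∀ s ∈ K.faces, s.card + 1 = n → ∀ c : List (Facet K n), IsDualCellBoundary s c →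
    ∀ i ∈ s, ∀ j ∈ s, i ≠ j → cyclicProd (ρ i j) c = 1

end Relations

/-- The connection `b` realizes the quantities `ρ_ij^{TT'}, μ(γ_k) = x k, μ(a_s) = y s`. -/
def Realizes {k : Type*} [Field k] {κ τ : Type*} (γ : κ → FramedLoop K n) (a : τ → FramedLoop K n)
    (b : Connection K n k) (ρ : V → V → Facet K n → Facet K n → kˣ) (x : κ → kˣ) (y : τ → kˣ) :
    Prop :=
  (∀ (i j : V) (T T' : Facet K n), i ≠ j → Adj T T' → {i, j} ⊆ T.1 ∩ T'.1 →
    rho b i j T T' = ρ i j T T') ∧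
  (∀ q, holonomy b (γ q) = x q) ∧ (∀ s, holonomy b (a s) = y s)

/-! ### Orientations -/

/-- With `o` giving each `n`-simplex a sign relative to the increasing order of its vertices: the
boundary of the oriented simplex `T` contains the oriented simplex with vertex list `f`. -/
def Induces (o : Facet K n → ℤ) (T : Facet K n) (f : List V) : Prop :=
  ∃ v, (v :: f).Nodup ∧ (v :: f).toFinset = T.1 ∧ o T = listSign (v :: f)

/-- A global orientation: different `n`-simplices never induce the same orientation on a common
face. -/
def IsOrientation (o : Facet K n → ℤ) : Prop :=
  (∀ T, o T = 1 ∨ o T = -1) ∧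
  ∀ (T T' : Facet K n) (f : List V), T ≠ T' → Induces o T f → ¬ Induces o T' f

/-- For an edge `e` of an oriented surface: the way of writing it as `T ∩ T' = [ij]` with
`∂T = [ij] + ⋯` and `∂T' = [ji] + ⋯`. -/
structure EdgeSides (o : Facet K n → ℤ) (e : Finset V) where
  i : V
  j : V
  T : Facet K n
  T' : Facet K n
  ne : i ≠ j
  eq : e = {i, j}
  inter : T.1 ∩ T'.1 = e
  ind : Induces o T [i, j]
  ind' : Induces o T' [j, i]

/-- For a triangle `d` of an oriented 3-manifold: the way of writing it as `T ∩ T' = [ijl]` with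
`∂T = [ijl] + ⋯` and `∂T' = [jil] + ⋯`. -/
structure TriangleSides (o : Facet K n → ℤ) (d : Finset V) where
  i : V
  j : V
  l : V
  T : Facet K n
  T' : Facet K n
  ne_ij : i ≠ j
  ne_jl : j ≠ l
  ne_li : l ≠ i
  eq : d = {i, j, l}
  inter : T.1 ∩ T'.1 = d
  ind : Induces o T [i, j, l]
  ind' : Induces o T' [j, i, l]

/-- The left-hand side of the relation A of a triangle. -/
def TriangleSides.relA {M : Type*} [CommGroup M] {o : Facet K n → ℤ} {d : Finset V}
    (t : TriangleSides o d) (ρ : V → V → Facet K n → Facet K n → M) : M :=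
  ρ t.i t.j t.T t.T' * ρ t.j t.l t.T t.T' * ρ t.l t.i t.T t.T'

/-- For an edge `e` of an oriented 3-manifold: an orientation `[ij]` of the edge, and the boundary
of its dual 2-cell passed in the direction for which `T_p ∩ T_{p+1} = [ijl]` implies
`∂T_p = [ijl] + ⋯`. -/
structure EdgeCircuit (o : Facet K n → ℤ) (e : Finset V) where
  i : V
  j : V
  circuit : List (Facet K n)
  ne : i ≠ j
  eq : e = {i, j}
  dual : IsDualCellBoundary e circuit
  direction : (circuit ++ circuit.head?.toList).IsChain fun T T' =>
    ∀ l ∈ T.1 ∩ T'.1, l ≠ i → l ≠ j → Induces o T [i, j, l]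

/-- The left-hand side of the relation B of an edge. -/
def EdgeCircuit.relB {M : Type*} [CommGroup M] {o : Facet K n → ℤ} {e : Finset V}
    (c : EdgeCircuit o e) (ρ : V → V → Facet K n → Facet K n → M) : M :=
  cyclicProd (ρ c.i c.j) c.circuit

/-- The simplices with `c` vertices. -/
abbrev Simplices (K : AbstractSimplicialComplex V) (c : ℕ) : Type _ :=
  {s : Finset V // s ∈ K.faces ∧ s.card = c}

end Framed

end DiscreteDG

end

open DiscreteDG

/-!
The whole argument is simplicial cohomology with coefficients in the multiplicative group, written
additively. A connection `b` is, up to the factors `f_T`, the family of 1-cochains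
`Φ_T [i, j] = log (b_{T:i} / b_{T:j}) = log (-μ_ij^T)`, one for every `n`-simplex `T`, and in these
terms `log ρ_ij^{TT'} = Φ_T [i, j] - Φ_{T'} [i, j]` (`IsPotential`, `connCochain`). The sum of the
`Φ_T` along a closed framed path is its holonomy. For any potential `Φ` whose coboundary
`ω = Φ_T ∘ ∂` does not depend on `T`, the framed product of a framed 2-chain `w` telescopes to the
sum of `Φ` over the framed boundary minus `ω w` (`FramedChain.ofMul_prod_eq`). For a connection
`ω = 0`, which gives all the relations.

*Uniqueness.* Links in a homology manifold are connected in codimension at least two, so the star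
of a simplex is strongly connected (`star_connected`). If the `ρ` of two connections agree on
neighbours, the difference of their cochains therefore does not depend on the framing; it is a
1-cocycle, and if the holonomies agree as well it vanishes on all 1-cycles and is a coboundary. This
is a gauge transformation (`gaugeEquiv_of_invariants`).

*Realization.* Given the relations, a potential is found on the star of each edge. The relations B
say that `ρ` has trivial product around every dual 2-cell; by descending induction on the dimension
of a simplex, using that the first cohomology of links vanishes in codimension at least three, `ρ`
is a difference of a function on the star of the simplex (`exists_star_potential`). So there is a
potential `Φ`. By the relations A its coboundary `ω` is independent of the framing, and `ω` vanishes
on boundaries and, by the relations for the `z_q`, on all 2-cycles. It remains to correct `Φ` by a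
1-cochain `H`, independent of the framing, such that `ω + H ∘ ∂ = 0` and the holonomies are the
prescribed ones (`exists_realizes`). These conditions prescribe `H` on generators of the group of
1-cycles, and the relations between these generators are respected because of the condition on the
`u_s`. Such a homomorphism extends to all 1-chains, because the 1-cycles of a graph are a direct
summand of the chains (`exists_retraction_two`), without any divisibility of the coefficients.

*Surfaces.* The relations A and B are void, the 2-cycles are the multiples of the fundamental cycle,
the first homology is torsion free, and `ω` of the fundamental cycle is the product over the edges
(`surface_realizes_iff`).

*Dimension three.* The independent quantities `ρ_ij^{TT'}` are indexed by the pairs of a triangle and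
one of its edges (`Flag`). Each occurs exactly once in the relation A of the triangle and exactly
once in the relation B of the edge, so that a product of powers of these relations has the exponent
`α_Δ + β_e` at the flag `(Δ, e)` (`prod_relA_mul_prod_relB`). These exponents vanish for all flags
if and only if `α = c` and `β = -c`, by connectedness. That the `ζ_q` vanish is seen on the data
derived from a 2-cocycle dual to `z_q` (`exists_isRhoData_of_cycles`), and that the `υ_s` vanish by
varying `y_s`; the value `2`, which has infinite order, detects every exponent.
-/

noncomputable section

namespace DiscreteDG

set_option linter.unusedSectionVars false

open Finsupp

/-! ### The simplicial chain complex -/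

section ChainAlgebra

variable {V : Type*} [LinearOrder V]

/-- The sign with which a face opposite to `v` occurs in the boundary. -/
def posSign (v : V) (s : Finset V) : ℤ := (-1) ^ (s.filter (· < v)).card

lemma posSign_mul_self (v : V) (s : Finset V) : posSign v s * posSign v s = 1 := by
  unfold posSign
  rw [← mul_pow]; simp

lemma posSign_eq_or (v : V) (s : Finset V) : posSign v s = 1 ∨ posSign v s = -1 :=
  neg_one_pow_eq_or ℤ _

lemma posSign_insert (v : V) {w : V} {s : Finset V} (h : w ∉ s) :
    posSign v (insert w s) = (if w < v then -1 else 1) * posSign v s := by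
  unfold posSign
  rw [Finset.filter_insert]
  split_ifs with hw
  · rw [Finset.card_insert_of_notMem (by simp [h]), pow_succ]; ring
  · simp

lemma posSign_erase_self (v : V) (s : Finset V) : posSign v (s.erase v) = posSign v s := by
  unfold posSign
  congr 2
  ext w
  simp only [Finset.mem_filter, Finset.mem_erase]
  exact ⟨fun h => ⟨h.1.2, h.2⟩, fun h => ⟨⟨h.2.ne, h.1⟩, h.2⟩⟩

lemma posSign_comm {v w : V} (hvw : v ≠ w) {t : Finset V} (hv : v ∉ t) (hw : w ∉ t) :
    posSign v (insert w t) * posSign w t = -(posSign w (insert v t) * posSign v t) := by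
  rw [posSign_insert v hw, posSign_insert w hv]
  rcases lt_or_gt_of_ne hvw with h | h
  · rw [if_neg h.not_gt, if_pos h]; ring
  · rw [if_pos h, if_neg h.not_gt]; ring

lemma bdry_single (s : Finset V) (a : ℤ) :
    bdry (single s a) = ∑ v ∈ s, single (s.erase v) (a * posSign v s) := by
  simp [bdry, posSign, Finset.smul_sum]

theorem bdry_bdry (c : Finset V →₀ ℤ) : bdry (bdry c) = 0 := by
  suffices h : (bdry (V := V)) ∘ₗ bdry = 0 from LinearMap.congr_fun h c
  ext1 s
  ext1
  simp only [LinearMap.comp_apply, lsingle_apply, bdry_single, map_sum, LinearMap.zero_apply]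
  rw [Finset.sum_sigma']
  refine Finset.sum_involution (fun p _ => ⟨p.2, p.1⟩) ?_ ?_ ?_ ?_
  · rintro ⟨v, w⟩ h
    simp only [Finset.mem_sigma, Finset.mem_erase] at h
    obtain ⟨hv, hwv, hw⟩ := h
    set t := (s.erase v).erase w with ht
    have ht' : (s.erase w).erase v = t := by rw [ht, Finset.erase_right_comm]
    have hvt : v ∉ t := by simp [ht]
    have hwt : w ∉ t := by simp [ht]
    have e1 : s.erase v = insert w t := by
      rw [ht, Finset.insert_erase]; simp [hw, hwv]
    have e2 : s.erase w = insert v t := by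
      rw [← ht', Finset.insert_erase]; simp [hv, hwv.symm]
    simp only
    rw [ht', ← single_add]
    rw [← posSign_erase_self v s, ← posSign_erase_self w s, e1, e2,
      ← posSign_erase_self w (insert w t), Finset.erase_insert hwt,
      ← posSign_erase_self v (insert v t), Finset.erase_insert hvt]
    have := posSign_comm hwv.symm hvt hwt
    rw [one_mul, one_mul, this]
    simp
  · rintro ⟨v, w⟩ h _ h'
    simp only [Finset.mem_sigma, Finset.mem_erase] at h
    exact h.2.1 (congrArg Sigma.fst h')
  · rintro ⟨v, w⟩ h
    simp only [Finset.mem_sigma, Finset.mem_erase] at h ⊢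
    exact ⟨h.2.2, h.2.1.symm, h.1⟩
  · rintro ⟨v, w⟩ _
    rfl

/-- The cone operator with apex `v`; simplices containing `v` are sent to zero. -/
def cone (v : V) : (Finset V →₀ ℤ) →ₗ[ℤ] (Finset V →₀ ℤ) :=
  linearCombination ℤ fun s : Finset V => if v ∈ s then 0 else single (insert v s) (posSign v s)

lemma cone_single_of_mem {v : V} {s : Finset V} (h : v ∈ s) (a : ℤ) :
    cone v (single s a) = 0 := by
  simp [cone, h]

lemma cone_single_of_notMem {v : V} {s : Finset V} (h : v ∉ s) (a : ℤ) :
    cone v (single s a) = single (insert v s) (a * posSign v s) := by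
  simp [cone, h]

/-- The cone operator is a contracting homotopy of the augmented chain complex. -/
theorem bdry_cone (v : V) (c : Finset V →₀ ℤ) : bdry (cone v c) = c - cone v (bdry c) := by
  rw [eq_sub_iff_add_eq]
  suffices h : bdry ∘ₗ cone v + cone v ∘ₗ bdry = LinearMap.id from LinearMap.congr_fun h c
  ext1 s
  ext1
  simp only [LinearMap.comp_apply, lsingle_apply, bdry_single, map_sum, LinearMap.add_apply,
    LinearMap.id_apply]
  by_cases hv : v ∈ s
  · rw [cone_single_of_mem hv, map_zero, zero_add, Finset.sum_eq_single_of_mem v hv]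
    · rw [cone_single_of_notMem (by simp), Finset.insert_erase hv, posSign_erase_self, one_mul,
        posSign_mul_self]
    · intro w _ hwv
      exact cone_single_of_mem (by simp [hv, hwv.symm]) _
  · rw [cone_single_of_notMem hv, bdry_single, Finset.sum_insert hv, Finset.erase_insert hv,
      ← posSign_erase_self v (insert v s), Finset.erase_insert hv, one_mul, posSign_mul_self,
      add_assoc, ← Finset.sum_add_distrib, Finset.sum_eq_zero, add_zero]
    intro w hw
    have hwv : w ≠ v := fun h => hv (h ▸ hw)
    have hv' : v ∉ s.erase w := by simp [hv]
    have hw' : w ∉ s.erase w := by simp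
    rw [cone_single_of_notMem hv', Finset.erase_insert_of_ne hwv.symm, ← single_add]
    have := posSign_comm hwv.symm hv' hw'
    rw [Finset.insert_erase hw] at this
    rw [← posSign_erase_self w s, ← posSign_erase_self w (insert v s),
      Finset.erase_insert_of_ne hwv.symm]
    rw [← posSign_erase_self w (insert v (s.erase w)), Finset.erase_insert_of_ne hwv.symm,
      Finset.erase_idem] at this
    have h1 := posSign_mul_self w (s.erase w)
    have h2 := posSign_mul_self w (insert v (s.erase w))
    rw [single_eq_zero]
    linear_combination posSign w (s.erase w) * posSign w (insert v (s.erase w)) * this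
      - posSign v s * posSign w (insert v (s.erase w)) * h1
      - posSign v (s.erase w) * posSign w (s.erase w) * h2

/-! ### Oriented simplices -/

lemma listSign_cons {a : V} {l : List V} (h : a ∉ l) (hl : l.Nodup) :
    listSign (a :: l) = posSign a l.toFinset * listSign l := by
  have key : ∀ l : List V, a ∉ l → l.Nodup →
      (l.map fun b => if a < b then (1 : ℤ) else -1).prod = posSign a l.toFinset := by
    intro l
    induction l with
    | nil => intro _ _; simp [posSign]
    | cons b l ih =>
      intro ha hl
      rw [List.nodup_cons] at hl
      simp only [List.mem_cons, not_or] at ha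
      rw [List.map_cons, List.prod_cons, ih ha.2 hl.2, List.toFinset_cons,
        posSign_insert a (by simpa using hl.1)]
      congr 1
      rcases lt_or_gt_of_ne ha.1 with h | h
      · rw [if_pos h, if_neg h.not_gt]
      · rw [if_neg h.not_gt, if_pos h]
  rw [listSign, key l h hl]

lemma listSign_swap {a b : V} (hab : a ≠ b) (l : List V) :
    listSign (b :: a :: l) = -listSign (a :: b :: l) := by
  simp only [listSign, List.map_cons, List.prod_cons]
  rcases lt_or_gt_of_ne hab with h | h
  · rw [if_pos h, if_neg h.not_gt]; ring
  · rw [if_pos h, if_neg h.not_gt]; ring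

lemma listSign_eq_or (l : List V) : listSign l = 1 ∨ listSign l = -1 := by
  induction l with
  | nil => left; rfl
  | cons a l ih =>
    have : ∀ l : List V, (l.map fun b => if a < b then (1 : ℤ) else -1).prod = 1 ∨
        (l.map fun b => if a < b then (1 : ℤ) else -1).prod = -1 := by
      intro l
      induction l with
      | nil => left; rfl
      | cons b l ih =>
        rw [List.map_cons, List.prod_cons]
        split_ifs <;> rcases ih with h | h <;> simp [h]
    rw [listSign]
    rcases this l with h | h <;> rcases ih with h' | h' <;> simp [h, h']

/-- The effect of exchanging two vertices behind the leading one. -/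
lemma listSign_cons_swap {v a b : V} (hab : a ≠ b) (l : List V) :
    listSign (v :: b :: a :: l) = -listSign (v :: a :: b :: l) := by
  rw [listSign, listSign_swap hab, listSign.eq_2 v]
  simp only [List.map_cons, List.prod_cons]
  ring

lemma orientedSimplex_cons {a : V} {l : List V} (h : a ∉ l) (hl : l.Nodup) :
    orientedSimplex (a :: l) = cone a (orientedSimplex l) := by
  rw [orientedSimplex, orientedSimplex, cone_single_of_notMem (by simpa using h),
    listSign_cons h hl, List.toFinset_cons, mul_comm]

lemma orientedSimplex_singleton (a : V) : orientedSimplex [a] = single {a} 1 := by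
  simp [orientedSimplex, listSign]

lemma orientedSimplex_swap {a b : V} (hab : a ≠ b) (l : List V) :
    orientedSimplex (b :: a :: l) = -orientedSimplex (a :: b :: l) := by
  simp only [orientedSimplex, listSign_swap hab, single_neg, List.toFinset_cons,
    Finset.insert_comm b a]

lemma orientedSimplex_pair_of_lt {a b : V} (h : a < b) :
    orientedSimplex [a, b] = single {a, b} 1 := by
  simp [orientedSimplex, listSign, h]

lemma bdry_orientedSimplex_pair {a b : V} (h : a ≠ b) :
    bdry (orientedSimplex [a, b]) = single {b} 1 - single {a} 1 := by
  rw [orientedSimplex_cons (by simpa) (by simp), bdry_cone, orientedSimplex_singleton, bdry_single]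
  simp [cone_single_of_notMem, posSign, Finset.filter_singleton]

lemma bdry_orientedSimplex_triple {a b c : V} (hab : a ≠ b) (hbc : b ≠ c) (hca : c ≠ a) :
    bdry (orientedSimplex [a, b, c]) =
      orientedSimplex [a, b] + orientedSimplex [b, c] + orientedSimplex [c, a] := by
  rw [orientedSimplex_cons (by simp [hab, hca.symm]) (by simp [hbc]), bdry_cone,
    bdry_orientedSimplex_pair hbc, map_sub, ← orientedSimplex_singleton,
    ← orientedSimplex_singleton, ← orientedSimplex_cons (by simpa using hca.symm) (by simp),
    ← orientedSimplex_cons (by simpa using hab) (by simp), orientedSimplex_swap hca]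
  abel

/-! ### Linear maps on chains -/

lemma single_mem_chains {L : Set (Finset V)} {c : ℕ} {s : Finset V} (hs : s ∈ L)
    (hc : s.card = c) (a : ℤ) : single s a ∈ chains L c :=
  single_mem_supported ℤ a ⟨hs, hc⟩

lemma chains_le {L : Set (Finset V)} {c : ℕ} {N : Submodule ℤ (Finset V →₀ ℤ)}
    (h : ∀ s ∈ L, s.card = c → single s 1 ∈ N) : chains L c ≤ N := by
  rw [chains, supported_eq_span_single, Submodule.span_le]
  rintro _ ⟨s, hs, rfl⟩
  exact h s hs.1 hs.2

/-- Linear maps that agree on the simplices agree on the chains. -/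
lemma eqOn_chains {A : Type*} [AddCommGroup A] {f g : (Finset V →₀ ℤ) →ₗ[ℤ] A}
    {L : Set (Finset V)} {c : ℕ}
    (h : ∀ s ∈ L, s.card = c → f (single s 1) = g (single s 1)) {x : Finset V →₀ ℤ}
    (hx : x ∈ chains L c) : f x = g x :=
  chains_le (N := LinearMap.eqLocus f g) h hx

lemma bdry_mem_chains {L L' : Set (Finset V)} {c : ℕ}
    (h : ∀ s ∈ L, s.card = c + 1 → ∀ v ∈ s, s.erase v ∈ L') {x : Finset V →₀ ℤ}
    (hx : x ∈ chains L (c + 1)) : bdry x ∈ chains L' c := by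
  refine chains_le (N := (chains L' c).comap bdry) (fun s hs hc => ?_) hx
  rw [Submodule.mem_comap, bdry_single]
  refine Submodule.sum_mem _ fun v hv => single_mem_chains (h s hs hc v hv) ?_ _
  rw [Finset.card_erase_of_mem hv, hc]; rfl

lemma cone_mem_chains {L L' : Set (Finset V)} {c : ℕ} {v : V}
    (h : ∀ s ∈ L, s.card = c → v ∉ s → insert v s ∈ L') {x : Finset V →₀ ℤ}
    (hx : x ∈ chains L c) : cone v x ∈ chains L' (c + 1) := by
  refine chains_le (N := (chains L' (c + 1)).comap (cone v)) (fun s hs hc => ?_) hx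
  rw [Submodule.mem_comap]
  by_cases hv : v ∈ s
  · rw [cone_single_of_mem hv]; exact Submodule.zero_mem _
  · rw [cone_single_of_notMem hv]
    exact single_mem_chains (h s hs hc hv) (by rw [Finset.card_insert_of_notMem hv, hc]) _

lemma orientedSimplex_mem_chains {L : Set (Finset V)} {l : List V} (h : l.toFinset ∈ L)
    (hl : l.Nodup) : orientedSimplex l ∈ chains L l.length :=
  single_mem_chains h (List.toFinset_card_of_nodup hl) _

/-! ### Splitting off the cycles, and extension of homomorphisms -/

/-- `p` is a partial inverse of the boundary operator on chains with `c` vertices. -/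
def IsSplitting (L : Set (Finset V)) (c : ℕ) (p : (Finset V →₀ ℤ) →ₗ[ℤ] (Finset V →₀ ℤ)) :
    Prop :=
  ∀ x ∈ chains L c, p (bdry x) ∈ chains L c ∧ bdry (p (bdry x)) = bdry x

/-- For graphs a splitting comes from a choice of a base point in each component and a path from
it to every vertex. -/
theorem exists_splitting_two (L : Set (Finset V)) : ∃ p, IsSplitting L 2 p := by
  let S : Setoid V :=
    { r := fun v w => ∃ x ∈ chains L 2, bdry x = single {w} 1 - single {v} 1
      iseqv := ⟨fun v => ⟨0, Submodule.zero_mem _, by simp⟩,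
        fun ⟨x, hx, h⟩ => ⟨-x, Submodule.neg_mem _ hx, by rw [map_neg, h, neg_sub]⟩,
        fun ⟨x, hx, h⟩ ⟨y, hy, h'⟩ => ⟨x + y, Submodule.add_mem _ hx hy, by
          rw [map_add, h, h']; abel⟩⟩ }
  let r : V → V := fun v => (Quotient.mk S v).out
  have hr : ∀ v, S.r (r v) v := fun v => Quotient.exact (Quotient.out_eq (Quotient.mk S v))
  choose q hq hqb using hr
  let p : (Finset V →₀ ℤ) →ₗ[ℤ] (Finset V →₀ ℤ) :=
    linearCombination ℤ fun s : Finset V => if h : s.Nonempty then q (s.min' h) else 0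
  have hp : ∀ v, p (single {v} 1) = q v := fun v => by simp [p]
  refine ⟨p, fun x hx => ?_⟩
  refine chains_le (N := (chains L 2).comap (p ∘ₗ bdry) ⊓
    LinearMap.eqLocus (bdry ∘ₗ p ∘ₗ bdry) bdry) (fun s hs hc => ?_) hx
  obtain ⟨a, b, hab, rfl⟩ := Finset.card_eq_two.1 hc
  wlog h : a < b generalizing a b
  · rw [Finset.pair_comm] at hs hc ⊢
    exact this b a hab.symm hs hc (lt_of_le_of_ne (not_lt.1 h) hab.symm)
  rw [← orientedSimplex_pair_of_lt h]
  have hab' : r a = r b := by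
    have : Quotient.mk S a = Quotient.mk S b := Quotient.sound
      ⟨orientedSimplex [a, b], orientedSimplex_mem_chains (by simpa using hs) (by simpa using hab),
        bdry_orientedSimplex_pair hab⟩
    simp only [r, this]
  constructor
  · simp only [SetLike.mem_coe, Submodule.mem_comap, LinearMap.comp_apply,
      bdry_orientedSimplex_pair hab, map_sub, hp]
    exact Submodule.sub_mem _ (hq b) (hq a)
  · simp only [SetLike.mem_coe, LinearMap.mem_eqLocus, LinearMap.comp_apply,
      bdry_orientedSimplex_pair hab, map_sub, hp, hqb, hab']
    abel

/-- `π` restricts to the identity on cycles, so that these are a direct summand of the chains. -/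
def IsRetraction (L : Set (Finset V)) (c : ℕ) (π : (Finset V →₀ ℤ) →ₗ[ℤ] cycles L c) : Prop :=
  ∀ z : cycles L c, π z = z

lemma exists_retraction_of {L : Set (Finset V)} {c : ℕ} (e : chains L c →ₗ[ℤ] (Finset V →₀ ℤ))
    (h : ∀ x, e x ∈ chains L c ∧ bdry (e x) = bdry x) (h0 : ∀ x, bdry x.1 = 0 → e x = 0) :
    ∃ π, IsRetraction L c π := by
  classical
  let P : (Finset V →₀ ℤ) →ₗ[ℤ] chains L c := restrictDom ℤ ℤ _
  have hP : ∀ x : chains L c, P x = x := fun x =>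
    LinearMap.congr_fun (restrictDom_comp_subtype (M := ℤ) (R := ℤ) _) x
  refine ⟨LinearMap.codRestrict _ ((chains L c).subtype ∘ₗ P - e ∘ₗ P) fun x => ⟨?_, ?_⟩, ?_⟩
  · exact Submodule.sub_mem (chains L c) (P x).2 (h (P x)).1
  · change bdry ((P x : Finset V →₀ ℤ) - e (P x)) = 0
    rw [map_sub, (h _).2, sub_self]
  · intro z
    ext1
    have hz : P z.1 = ⟨z.1, z.2.1⟩ := hP ⟨z.1, z.2.1⟩
    change (P z.1 : Finset V →₀ ℤ) - e (P z.1) = z.1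
    rw [hz, h0 ⟨z.1, z.2.1⟩ z.2.2, sub_zero]

lemma exists_retraction_two (L : Set (Finset V)) : ∃ π, IsRetraction L 2 π := by
  obtain ⟨p, hp⟩ := exists_splitting_two L
  refine exists_retraction_of (p ∘ₗ bdry ∘ₗ (chains L 2).subtype) (fun x => hp x x.2) fun x hx => ?_
  simp [hx]

/-- If there are finitely many vertices, the boundaries form a free group, so that the boundary
operator splits in all degrees. -/
lemma exists_retraction [Finite V] (L : Set (Finset V)) (c : ℕ) : ∃ π, IsRetraction L c π := by
  have := Fintype.ofFinite V
  let f : chains L c →ₗ[ℤ] (chains L c).map bdry := bdry.submoduleMap (chains L c)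
  have hf : Function.Surjective f := LinearMap.submoduleMap_surjective _ _
  have : Module.Finite ℤ ((chains L c).map bdry) := Module.Finite.of_fg (IsNoetherian.noetherian _)
  obtain ⟨g, hg⟩ := Module.projective_lifting_property f LinearMap.id hf
  refine exists_retraction_of ((chains L c).subtype ∘ₗ g ∘ₗ f) (fun x => ⟨(g (f x)).2, ?_⟩) ?_
  · exact congrArg Subtype.val (LinearMap.congr_fun hg (f x))
  · intro x hx
    have : f x = 0 := Subtype.ext hx
    simp [this]

/-- A homomorphism given on generators of the cycles, and compatible with the relations between
these, extends to all chains. -/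
theorem exists_extension {A F : Type*} [AddCommGroup A] [AddCommGroup F] {L : Set (Finset V)}
    {c : ℕ} {π : (Finset V →₀ ℤ) →ₗ[ℤ] cycles L c} (hπ : IsRetraction L c π)
    (f : F →ₗ[ℤ] (Finset V →₀ ℤ)) (Ψ : F →ₗ[ℤ] A) (hf : ∀ x, f x ∈ cycles L c)
    (hsurj : ∀ z ∈ cycles L c, ∃ x, f x = z) (hker : ∀ x, f x = 0 → Ψ x = 0) :
    ∃ H : (Finset V →₀ ℤ) →ₗ[ℤ] A, ∀ x, H (f x) = Ψ x := by
  let f' : F →ₗ[ℤ] cycles L c := f.codRestrict _ hf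
  have hf' : Function.Surjective f' := fun z => by
    obtain ⟨x, hx⟩ := hsurj z z.2
    exact ⟨x, Subtype.ext hx⟩
  let e := f'.quotKerEquivOfSurjective hf'
  let q : (F ⧸ LinearMap.ker f') →ₗ[ℤ] A := (LinearMap.ker f').liftQ Ψ fun x hx =>
    hker x (congrArg Subtype.val (LinearMap.mem_ker.1 hx))
  refine ⟨q ∘ₗ e.symm.toLinearMap ∘ₗ π, fun x => ?_⟩
  have h1 : π (f x) = f' x := hπ (f' x)
  have h2 : e.symm (f' x) = Submodule.Quotient.mk x := by
    rw [LinearEquiv.symm_apply_eq]; rfl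
  simp only [LinearMap.comp_apply, h1, LinearEquiv.coe_coe, h2]
  rfl

/-- A 1-cochain that vanishes on cycles is a coboundary. -/
theorem exists_eq_comp_bdry {A : Type*} [AddCommGroup A] (L : Set (Finset V))
    (H : (Finset V →₀ ℤ) →ₗ[ℤ] A) (hH : ∀ z ∈ cycles L 2, H z = 0) :
    ∃ g : (Finset V →₀ ℤ) →ₗ[ℤ] A, ∀ x ∈ chains L 2, H x = g (bdry x) := by
  obtain ⟨p, hp⟩ := exists_splitting_two L
  refine ⟨H ∘ₗ p, fun x hx => ?_⟩
  have := hH (x - p (bdry x)) ⟨Submodule.sub_mem _ hx (hp x hx).1, by simp [(hp x hx).2]⟩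
  rw [map_sub, sub_eq_zero] at this
  exact this

lemma mem_boundaries_of_subsingleton {L : Set (Finset V)} {c : ℕ} (h : Subsingleton (Homology L c))
    {z : Finset V →₀ ℤ} (hz : z ∈ cycles L c) : z ∈ boundaries L c := by
  have := Subsingleton.elim (Submodule.Quotient.mk ⟨z, hz⟩ : Homology L c) 0
  rwa [Submodule.Quotient.mk_eq_zero] at this

end ChainAlgebra

/-! ### Framed chains and potentials -/

section FramedCochains

variable {V : Type*} [LinearOrder V] {K : AbstractSimplicialComplex V} {n : ℕ}
  {A : Type*} [AddCommGroup A]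

/-- The oriented edge underlying a framed edge, as a chain. -/
def FramedEdge.chain (ε : FramedEdge K n) : Finset V →₀ ℤ := orientedSimplex [ε.src, ε.tgt]

/-- The oriented triangle underlying a framed triangle, as a chain. -/
def FramedTriangle.chain (t : FramedTriangle K n) : Finset V →₀ ℤ :=
  orientedSimplex [t.a, t.b, t.c]

/-- The value on a framed edge of a family of cochains, one for each `n`-simplex. -/
def FramedEdge.eval (Φ : Facet K n → (Finset V →₀ ℤ) →ₗ[ℤ] A) (ε : FramedEdge K n) : A :=
  Φ ε.T ε.chain

lemma FramedTriangle.edge_T (t : FramedTriangle K n) (e : Fin 3) : (t.edge e).T = t.T := by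
  fin_cases e <;> rfl

lemma FramedTriangle.bdry_chain (t : FramedTriangle K n) :
    bdry t.chain = ∑ e, (t.edge e).chain := by
  rw [chain, bdry_orientedSimplex_triple t.ne_ab t.ne_bc t.ne_ca, Fin.sum_univ_three]
  rfl

lemma FramedTriangle.chain_mem (t : FramedTriangle K n) :
    t.chain ∈ chains {s | s ⊆ t.T.1} 3 := by
  refine orientedSimplex_mem_chains ?_ ?_
  · intro x hx
    simp only [List.toFinset_cons, List.toFinset_nil, Finset.mem_insert, Finset.notMem_empty,
      or_false] at hx
    rcases hx with rfl | rfl | rfl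
    exacts [t.a_mem, t.b_mem, t.c_mem]
  · simp [t.ne_ab, t.ne_bc, t.ne_ca.symm]

lemma FramedEdge.chain_mem (ε : FramedEdge K n) : ε.chain ∈ chains {s | s ⊆ ε.T.1} 2 := by
  refine orientedSimplex_mem_chains ?_ (by simp [ε.ne])
  intro x hx
  simp only [List.toFinset_cons, List.toFinset_nil, Finset.mem_insert, Finset.notMem_empty,
    or_false] at hx
  rcases hx with rfl | rfl
  exacts [ε.src_mem, ε.tgt_mem]

lemma Facet.mem_faces_of_subset (T : Facet K n) {s : Finset V} (hs : s ⊆ T.1) (h : s.Nonempty) :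
    s ∈ K.faces :=
  (K.isRelLowerSet_faces T.2.1).2 hs h

lemma Facet.chains_le (T : Facet K n) (c : ℕ) :
    chains {s | s ⊆ T.1} (c + 1) ≤ chains K.faces (c + 1) :=
  DiscreteDG.chains_le fun s hs hc => single_mem_chains
    (T.mem_faces_of_subset hs (Finset.card_pos.1 (by omega))) hc _

section Chain

variable {ι : Type*} {bd : ι → FramedEdge K n}

lemma FramedChain.chain_eq (w : FramedChain K n bd) : w.chain = ∑ q, (w.tri q).chain := rfl

lemma FramedChain.chain_mem (w : FramedChain K n bd) : w.chain ∈ chains K.faces 3 :=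
  Submodule.sum_mem _ fun q _ => (w.tri q).T.chains_le _ (w.tri q).chain_mem

variable [Fintype ι]

/-- A sum over all boundary edges splits into the matched pairs and the framed boundary. -/
lemma FramedChain.sum_edge (w : FramedChain K n bd) (F : FramedEdge K n → A) :
    ∑ q, ∑ e, F ((w.tri q).edge e) = ∑ p, (F (w.fst p) + F (w.snd p)) + ∑ x, F (bd x) := by
  rw [← Fintype.sum_prod_type' (f := fun q e => F ((w.tri q).edge e)), ← w.glue.sum_comp,
    Fintype.sum_sum_type, Fintype.sum_sum_type, Finset.sum_add_distrib]
  simp only [w.boundary]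
  rfl

lemma FramedChain.chain_snd (w : FramedChain K n bd) (p : Fin w.pairs) :
    (w.snd p).chain = -(w.fst p).chain := by
  have h1 : (w.snd p).src = (w.fst p).tgt := (w.opposite p).1
  have h2 : (w.snd p).tgt = (w.fst p).src := (w.opposite p).2
  rw [FramedEdge.chain, FramedEdge.chain, h1, h2, orientedSimplex_swap (w.fst p).ne]

lemma FramedChain.bdry_chain (w : FramedChain K n bd) : bdry w.chain = ∑ x, (bd x).chain := by
  have := w.sum_edge FramedEdge.chain
  simp only [w.chain_snd, add_neg_cancel, Finset.sum_const_zero, zero_add] at this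
  simp only [w.chain_eq, map_sum, FramedTriangle.bdry_chain, this]

/-- The family `Φ` of cochains is a potential of the quantities `ρ_ij^{TT'}` for all pairs of
`n`-simplices related by `R`, which is either `Adj` or the relation that always holds. -/
def IsPotential {M : Type*} [CommGroup M] (R : Facet K n → Facet K n → Prop)
    (Φ : Facet K n → (Finset V →₀ ℤ) →ₗ[ℤ] Additive M) (ρ : V → V → Facet K n → Facet K n → M) :
    Prop :=
  ∀ (i j : V) (T T' : Facet K n), i ≠ j → R T T' → {i, j} ⊆ T.1 ∩ T'.1 →
    Additive.ofMul (ρ i j T T') = Φ T (orientedSimplex [i, j]) - Φ T' (orientedSimplex [i, j])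

/-- The framed product, expressed by a potential. -/
theorem FramedChain.ofMul_prod {M : Type*} [CommGroup M] (w : FramedChain K n bd)
    {Φ : Facet K n → (Finset V →₀ ℤ) →ₗ[ℤ] Additive M} {ρ : V → V → Facet K n → Facet K n → M}
    (h : IsPotential (fun _ _ => True) Φ ρ) :
    Additive.ofMul (w.prod ρ) =
      ∑ x, (bd x).eval Φ - ∑ q, Φ (w.tri q).T (bdry (w.tri q).chain) := by
  have h1 : ∑ q, Φ (w.tri q).T (bdry (w.tri q).chain) =
      ∑ q, ∑ e, ((w.tri q).edge e).eval Φ := by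
    refine Finset.sum_congr rfl fun q _ => ?_
    rw [FramedTriangle.bdry_chain, map_sum]
    refine Finset.sum_congr rfl fun e _ => ?_
    rw [FramedEdge.eval, FramedTriangle.edge_T]
  rw [h1, w.sum_edge, FramedChain.prod, _root_.ofMul_prod, ← sub_sub, sub_right_comm, sub_self,
    zero_sub, ← Finset.sum_neg_distrib]
  refine Finset.sum_congr rfl fun p _ => ?_
  have e1 : (w.snd p).src = (w.fst p).tgt := (w.opposite p).1
  have e2 : (w.snd p).tgt = (w.fst p).src := (w.opposite p).2
  rw [h _ _ _ _ (w.snd p).ne trivial]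
  · have := w.chain_snd p
    simp only [FramedEdge.eval]
    rw [← FramedEdge.chain, this, map_neg, map_neg]
    abel
  · intro x hx
    rw [Finset.mem_inter]
    rw [Finset.mem_insert, Finset.mem_singleton] at hx
    rcases hx with rfl | rfl
    · exact ⟨e1 ▸ (w.fst p).tgt_mem, (w.snd p).src_mem⟩
    · exact ⟨e2 ▸ (w.fst p).src_mem, (w.snd p).tgt_mem⟩

/-- The framed product, expressed by a potential whose coboundary `ω` does not depend on the
framing. -/
theorem FramedChain.ofMul_prod_eq {M : Type*} [CommGroup M] (w : FramedChain K n bd)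
    {Φ : Facet K n → (Finset V →₀ ℤ) →ₗ[ℤ] Additive M} {ρ : V → V → Facet K n → Facet K n → M}
    (h : IsPotential (fun _ _ => True) Φ ρ) {ω : (Finset V →₀ ℤ) →ₗ[ℤ] Additive M}
    (hω : ∀ (T : Facet K n), ∀ x ∈ chains {s | s ⊆ T.1} 3, ω x = Φ T (bdry x)) :
    Additive.ofMul (w.prod ρ) = ∑ x, (bd x).eval Φ - ω w.chain := by
  rw [w.ofMul_prod h, w.chain_eq, map_sum]
  congr 1
  exact Finset.sum_congr rfl fun q _ => (hω _ _ (w.tri q).chain_mem).symm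

end Chain

lemma FramedLoop.bdry_chain (γ : FramedLoop K n) : bdry γ.chain = 0 := by
  have : ∀ q, bdry (orientedSimplex [(γ.edge q).src, (γ.edge q).tgt]) =
      single {(γ.edge (finRotate γ.len q)).src} (1 : ℤ) - single {(γ.edge q).src} 1 := fun q => by
    rw [bdry_orientedSimplex_pair (γ.edge q).ne, γ.closed]
  rw [chain, map_sum]
  simp only [this]
  rw [Finset.sum_sub_distrib, sub_eq_zero]
  exact Equiv.sum_comp (finRotate γ.len) fun q => single {(γ.edge q).src} (1 : ℤ)

lemma FramedLoop.chain_mem (γ : FramedLoop K n) : γ.chain ∈ cycles K.faces 2 :=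
  ⟨Submodule.sum_mem _ fun q _ => (γ.edge q).T.chains_le _ (γ.edge q).chain_mem, γ.bdry_chain⟩

/-- The sum of the values of a family of cochains along a closed framed path. -/
def FramedLoop.eval (Φ : Facet K n → (Finset V →₀ ℤ) →ₗ[ℤ] A) (γ : FramedLoop K n) : A :=
  ∑ q, (γ.edge q).eval Φ

lemma FramedLoop.sum_times_eval (Φ : Facet K n → (Finset V →₀ ℤ) →ₗ[ℤ] A) (a : FramedLoop K n)
    (m : ℕ) : ∑ x, (a.times m x).eval Φ = m • a.eval Φ := by
  rw [Fintype.sum_prod_type]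
  simp [FramedLoop.times, FramedLoop.eval]

lemma FramedLoop.sum_times_chain (a : FramedLoop K n) (m : ℕ) :
    ∑ x, (a.times m x).chain = m • a.chain := by
  rw [Fintype.sum_prod_type]
  simp only [FramedLoop.times, FramedLoop.chain, FramedEdge.chain, Finset.sum_const,
    Finset.card_univ, Fintype.card_fin]

/-- The 0-cochain with given values on the vertices. Its values on other simplices are
irrelevant. -/
def vertexCochain (f : V → A) : (Finset V →₀ ℤ) →ₗ[ℤ] A :=
  linearCombination ℤ fun s : Finset V => if h : s.Nonempty then f (s.min' h) else 0

lemma vertexCochain_single (f : V → A) (v : V) : vertexCochain f (single {v} 1) = f v := by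
  simp [vertexCochain]

/-- A family of cochains that agree wherever two of them are relevant comes from one cochain. -/
lemma exists_common_cochain {F : Type*} {c : ℕ} (Q : F → Set (Finset V))
    (Θ : F → (Finset V →₀ ℤ) →ₗ[ℤ] A)
    (h : ∀ T T' : F, ∀ σ ∈ Q T, σ ∈ Q T' → σ.card = c → Θ T (single σ 1) = Θ T' (single σ 1)) :
    ∃ H : (Finset V →₀ ℤ) →ₗ[ℤ] A, ∀ T, ∀ x ∈ chains (Q T) c, H x = Θ T x := by
  classical
  refine ⟨linearCombination ℤ fun σ => if hσ : ∃ T, σ ∈ Q T then Θ hσ.choose (single σ 1) else 0,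
    fun T x hx => eqOn_chains (fun σ hσ hc => ?_) hx⟩
  have hex : ∃ T, σ ∈ Q T := ⟨T, hσ⟩
  rw [linearCombination_single, one_smul, dif_pos hex]
  exact h _ _ _ hex.choose_spec hσ hc

/-! ### Connections as cochains -/

section Connection

variable {k : Type*} [Field k]

/-- The quantities `-μ_ij^T = b_i / b_j` of a connection as a family of 1-cochains. -/
def connCochain (b : Connection K n k) (T : Facet K n) : (Finset V →₀ ℤ) →ₗ[ℤ] Additive kˣ :=
  -(vertexCochain (fun i => Additive.ofMul (b T i)) ∘ₗ bdry)

lemma connCochain_bdry (b : Connection K n k) (T : Facet K n) (x : Finset V →₀ ℤ) :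
    connCochain b T (bdry x) = 0 := by
  simp [connCochain, bdry_bdry]

lemma connCochain_pair (b : Connection K n k) (T : Facet K n) {i j : V} (h : i ≠ j) :
    connCochain b T (orientedSimplex [i, j]) = Additive.ofMul (-mu b T i j) := by
  simp [connCochain, bdry_orientedSimplex_pair h, vertexCochain_single, mu, h, sub_eq_add_neg,
    div_eq_mul_inv]

lemma mu_mul_mu (b : Connection K n k) (T : Facet K n) (i j : V) :
    mu b T i j * mu b T j i = 1 := by
  by_cases h : i = j
  · simp [mu, h]
  · simp [mu, h, Ne.symm h]

lemma isPotential_connCochain (b : Connection K n k) :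
    IsPotential (fun _ _ => True) (connCochain b) (rho b) := by
  intro i j T T' h _ _
  rw [connCochain_pair b T h, connCochain_pair b T' h, rho, ← ofMul_div]
  congr 1
  rw [neg_div_neg_eq, eq_div_iff_mul_eq', mul_assoc, mu_mul_mu, mul_one]

lemma ofMul_holonomy (b : Connection K n k) (γ : FramedLoop K n) :
    Additive.ofMul (holonomy b γ) = γ.eval (connCochain b) := by
  rw [holonomy, ofMul_prod, FramedLoop.eval]
  exact Finset.sum_congr rfl fun q _ => (connCochain_pair b _ (γ.edge q).ne).symm

/-- Connections whose 1-cochains differ by a coboundary are gauge equivalent. -/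
lemma gaugeEquiv_of_sub_eq {b b' : Connection K n k} (g : (Finset V →₀ ℤ) →ₗ[ℤ] Additive kˣ)
    (h : ∀ (T : Facet K n), ∀ i ∈ T.1, ∀ j ∈ T.1, i ≠ j →
      connCochain b' T (orientedSimplex [i, j]) - connCochain b T (orientedSimplex [i, j]) =
        g (bdry (orientedSimplex [i, j]))) : GaugeEquiv b b' := by
  have hne : ∀ T : Facet K n, ∃ v, v ∈ T.1 := fun T =>
    Finset.card_pos.1 (by rw [T.2.2]; omega)
  choose v hv using hne
  let G : V → kˣ := fun i => (g (single {i} 1)).toMul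
  refine ⟨fun T => b' T (v T) / b T (v T) * G (v T), G, fun T i hi => ?_⟩
  have key : b' T i = G (v T) / G i * (b T i / b T (v T)) * b' T (v T) := by
    by_cases hiv : i = v T
    · rw [hiv, div_self', div_self', one_mul, one_mul]
    · have := h T i hi (v T) (hv T) hiv
      rw [connCochain_pair b T hiv, connCochain_pair b' T hiv, bdry_orientedSimplex_pair hiv,
        map_sub, ← ofMul_div] at this
      have := congrArg Additive.toMul this
      change _ = G (v T) / G i at this
      simp only [toMul_ofMul, mu, if_neg hiv, neg_neg] at this
      rw [← this, div_mul_cancel, div_mul_cancel]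
  have comm : ∀ p q x y z : kˣ, p / q * (x / y) * z = z / y * p * x * q⁻¹ := fun p q x y z => by
    apply Additive.ofMul.injective
    simp only [ofMul_mul, ofMul_div, ofMul_inv]
    abel
  rw [key, comm]

/-- A family of 1-cochains vanishing on the boundaries of the triangles of the respective
`n`-simplices comes from a connection. -/
lemma exists_connCochain_eq (Ψ : Facet K n → (Finset V →₀ ℤ) →ₗ[ℤ] Additive kˣ)
    (h : ∀ T, ∀ x ∈ chains {s | s ⊆ T.1} 3, Ψ T (bdry x) = 0) :
    ∃ b : Connection K n k, ∀ T, ∀ x ∈ chains {s | s ⊆ T.1} 2, connCochain b T x = Ψ T x := by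
  have hne : ∀ T : Facet K n, ∃ v, v ∈ T.1 := fun T =>
    Finset.card_pos.1 (by rw [T.2.2]; omega)
  choose v hv using hne
  -- a cone with apex in `T` contracts `T`, so that `Ψ T` is a coboundary there
  refine ⟨fun T i => ((-(Ψ T ∘ₗ cone (v T))) (single {i} 1)).toMul, fun T x hx => ?_⟩
  have h1 : ∀ y ∈ chains {s | s ⊆ T.1} 1,
      vertexCochain (fun i => (-(Ψ T ∘ₗ cone (v T))) (single {i} 1)) y =
        (-(Ψ T ∘ₗ cone (v T))) y := by
    intro y hy
    refine eqOn_chains (fun s hs hc => ?_) hy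
    obtain ⟨i, rfl⟩ := Finset.card_eq_one.1 hc
    rw [vertexCochain_single]
  have h2 := h T (cone (v T) x) (cone_mem_chains (L := {s | s ⊆ T.1})
    (fun s hs _ _ => Finset.insert_subset (hv T) hs) hx)
  rw [bdry_cone, map_sub, sub_eq_zero] at h2
  simp only [connCochain, ofMul_toMul]
  rw [LinearMap.neg_apply, LinearMap.comp_apply, h1, LinearMap.neg_apply, neg_neg,
    LinearMap.comp_apply, h2]
  exact bdry_mem_chains (fun s hs _ w _ => (Finset.erase_subset _ _).trans hs) hx

end Connection

end FramedCochains

/-! ### Local structure of homology manifolds -/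

section Manifold

variable {V : Type*} [LinearOrder V] {K : AbstractSimplicialComplex V} {n : ℕ}

lemma mem_faces_of_subset {s t : Finset V} (ht : t ∈ K.faces) (hs : s ⊆ t) (h : s.Nonempty) :
    s ∈ K.faces :=
  (K.isRelLowerSet_faces ht).2 hs h

lemma nonempty_of_mem_faces {s : Finset V} (hs : s ∈ K.faces) : s.Nonempty :=
  (K.isRelLowerSet_faces hs).1

lemma bdry_mem_chains_faces {c : ℕ} {x : Finset V →₀ ℤ} (hx : x ∈ chains K.faces (c + 2)) :
    bdry x ∈ chains K.faces (c + 1) :=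
  bdry_mem_chains (fun s hs hsc v hv => mem_faces_of_subset hs (Finset.erase_subset _ _)
    (Finset.card_pos.1 (by rw [Finset.card_erase_of_mem hv, hsc]; omega))) hx

lemma singleton_mem_link {s : Finset V} {v : V} :
    {v} ∈ link K s ↔ v ∉ s ∧ insert v s ∈ K.faces := by
  rw [link, Set.mem_ofPred_eq, Finset.disjoint_singleton_right, Finset.union_comm,
    Finset.singleton_union]

lemma empty_mem_link {s : Finset V} (hs : s ∈ K.faces) : ∅ ∈ link K s := by
  simp [link, hs]

lemma mem_link_of_subset {s t t' : Finset V} (hs : s ∈ K.faces) (ht : t ∈ link K s) (h : t' ⊆ t) :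
    t' ∈ link K s :=
  ⟨ht.1.mono_right h, mem_faces_of_subset ht.2 (Finset.union_subset_union_right h)
    ((nonempty_of_mem_faces hs).mono Finset.subset_union_left)⟩

lemma sdiff_mem_link {s : Finset V} {T : Facet K n} (h : s ⊆ T.1) : T.1 \ s ∈ link K s :=
  ⟨Finset.disjoint_sdiff, by rw [Finset.union_sdiff_of_subset h]; exact T.2.1⟩

section

variable (hK : IsHomologyManifold K n)
include hK

/-- The dimension of the simplices is at most `n`: if an `n`-simplex were a proper face, then in its
link the empty simplex would be a boundary, contrary to the reduced homology of `S^{-1}`. -/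
lemma card_le_of_mem_faces {s : Finset V} (hs : s ∈ K.faces) : s.card ≤ n + 1 := by
  by_contra! hc
  obtain ⟨t, hts, htc⟩ := Finset.exists_subset_card_eq (n := n + 1) (s := s) (by omega)
  have ht : t ∈ K.faces := mem_faces_of_subset hs hts (Finset.card_pos.1 (by omega))
  obtain ⟨v, hv, hvt⟩ := Finset.exists_mem_notMem_of_card_lt_card (s := t) (t := s) (by omega)
  obtain ⟨e⟩ := ((hK t ht) 0).1 (by omega)
  have hvl : {v} ∈ link K t := singleton_mem_link.2
    ⟨hvt, mem_faces_of_subset hs (Finset.insert_subset hv hts) (by simp)⟩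
  have hle : chains (link K t) 0 ≤ boundaries (link K t) 0 := by
    refine chains_le fun s' _ hc' => ?_
    refine ⟨single {v} 1, single_mem_chains hvl (by simp) 1, ?_⟩
    rw [bdry_single, Finset.card_eq_zero.1 hc']
    simp [posSign, Finset.filter_singleton]
  have : e.symm 1 = 0 := by
    obtain ⟨⟨z, hz⟩, hz'⟩ := Submodule.Quotient.mk_surjective _ (e.symm 1)
    rw [← hz', Submodule.Quotient.mk_eq_zero]
    exact hle hz.1
  simp at this

/-- A simplex of dimension less than `n` is not maximal, since the reduced homology of its link
vanishes in dimension `-1`. -/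
lemma exists_insert_mem_faces {s : Finset V} (hs : s ∈ K.faces) (hc : s.card ≤ n) :
    ∃ v, v ∉ s ∧ insert v s ∈ K.faces := by
  by_contra! h
  have hz : single (∅ : Finset V) (1 : ℤ) ∈ cycles (link K s) 0 :=
    ⟨single_mem_chains (empty_mem_link hs) rfl 1, by simp [bdry_single]⟩
  have := mem_boundaries_of_subsingleton (((hK s hs) 0).2 (by omega)) hz
  obtain ⟨x, hx, hxz⟩ := this
  have hx0 : x = 0 := by
    have : chains (link K s) (0 + 1) ≤ ⊥ := chains_le fun t ht htc => by
      obtain ⟨v, rfl⟩ := Finset.card_eq_one.1 htc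
      obtain ⟨h1, h2⟩ := singleton_mem_link.1 ht
      exact absurd h2 (h v h1)
    simpa using this hx
  simp [hx0, eq_comm] at hxz

/-- A homology manifold is pure. -/
lemma exists_facet_subset {s : Finset V} (hs : s ∈ K.faces) : ∃ T : Facet K n, s ⊆ T.1 := by
  have hc := card_le_of_mem_faces hK hs
  induction hd : n + 1 - s.card generalizing s with
  | zero => exact ⟨⟨s, hs, by omega⟩, subset_rfl⟩
  | succ d ih =>
    obtain ⟨v, hv, hvs⟩ := exists_insert_mem_faces hK hs (by omega)
    have := Finset.card_insert_of_notMem hv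
    obtain ⟨T, hT⟩ := ih hvs (by omega) (by omega)
    exact ⟨T, (Finset.subset_insert _ _).trans hT⟩

/-- The link of a simplex of codimension at least two is connected. -/
lemma link_connected {s : Finset V} (hs : s ∈ K.faces) (hc : s.card < n) {v w : V}
    (hv : {v} ∈ link K s) (hw : {w} ∈ link K s) :
    Relation.ReflTransGen (fun x y => x ≠ y ∧ {x, y} ∈ link K s) v w := by
  classical
  set R := fun x y => x ≠ y ∧ ({x, y} : Finset V) ∈ link K s
  have hz : single {w} 1 - single {v} (1 : ℤ) ∈ cycles (link K s) 1 := by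
    refine ⟨Submodule.sub_mem _ (single_mem_chains hw rfl _) (single_mem_chains hv rfl _), ?_⟩
    simp [bdry_single, posSign, Finset.filter_singleton]
  obtain ⟨x, hx, hxz⟩ := mem_boundaries_of_subsingleton (((hK s hs) 1).2 (by omega)) hz
  -- the indicator function of the component of `v`
  let χ : (Finset V →₀ ℤ) →ₗ[ℤ] ℤ := linearCombination ℤ fun t =>
    if ∃ x, t = {x} ∧ Relation.ReflTransGen R v x then 1 else 0
  have hχ : ∀ x, χ (single {x} 1) = if Relation.ReflTransGen R v x then 1 else 0 := by
    intro x
    simp [χ]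
  have h0 : χ (bdry x) = 0 := by
    refine eqOn_chains (f := χ ∘ₗ bdry) (g := 0) (fun t ht htc => ?_) hx
    obtain ⟨a, b, hab, rfl⟩ := Finset.card_eq_two.1 htc
    wlog h : a < b generalizing a b
    · rw [Finset.pair_comm] at ht htc ⊢
      exact this b a hab.symm ht htc (lt_of_le_of_ne (not_lt.1 h) hab.symm)
    have : Relation.ReflTransGen R v a ↔ Relation.ReflTransGen R v b :=
      ⟨fun h => h.tail ⟨hab, ht⟩, fun h => h.tail ⟨hab.symm, by rwa [Finset.pair_comm]⟩⟩
    rw [LinearMap.comp_apply, ← orientedSimplex_pair_of_lt h, bdry_orientedSimplex_pair hab,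
      map_sub, hχ, hχ, if_congr this rfl rfl, sub_self, LinearMap.zero_apply]
  rw [hxz, map_sub, hχ, hχ, if_pos Relation.ReflTransGen.refl] at h0
  by_contra hcon
  rw [if_neg hcon] at h0
  simp at h0

/-- A simplex of codimension one lies in exactly two `n`-simplices. -/
theorem exists_other_facet {t : Finset V} (ht : t.card = n) {T : Facet K n} (hT : t ⊆ T.1)
    (htn : t.Nonempty) :
    ∃ T' : Facet K n, T' ≠ T ∧ t ⊆ T'.1 ∧ ∀ S : Facet K n, t ⊆ S.1 → S = T ∨ S = T' := by
  have htf : t ∈ K.faces := T.mem_faces_of_subset hT htn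
  -- the facets around `t` correspond to the vertices of the link
  have hF : ∀ S : Facet K n, t ⊆ S.1 → ∃ v, {v} ∈ link K t ∧ insert v t = S.1 := by
    intro S hS
    have hc : (S.1 \ t).card = 1 := by rw [Finset.card_sdiff_of_subset hS, S.2.2, ht]; omega
    obtain ⟨v, hv⟩ := Finset.card_eq_one.1 hc
    refine ⟨v, hv ▸ sdiff_mem_link hS, ?_⟩
    rw [← Finset.sdiff_union_of_subset hS, hv, Finset.singleton_union]
  have hG : ∀ v, {v} ∈ link K t → ∃ S : Facet K n, insert v t = S.1 := by
    intro v hv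
    obtain ⟨h1, h2⟩ := singleton_mem_link.1 hv
    exact ⟨⟨insert v t, h2, by rw [Finset.card_insert_of_notMem h1, ht]⟩, rfl⟩
  have hinj : ∀ {v w}, {v} ∈ link K t → insert v t = insert w t → v = w := by
    intro v w hv h
    have : v ∈ insert w t := h ▸ Finset.mem_insert_self v t
    exact (Finset.mem_insert.1 this).resolve_right (singleton_mem_link.1 hv).1
  obtain ⟨a, ha, haT⟩ := hF T hT
  obtain ⟨e⟩ := ((hK t htf) 1).1 (by omega)
  have hb0 : ∀ x ∈ boundaries (link K t) 1, x = 0 := by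
    have : chains (link K t) (1 + 1) ≤ ⊥ := chains_le fun s hs hsc => by
      have := card_le_of_mem_faces hK hs.2
      rw [Finset.card_union_of_disjoint hs.1] at this
      omega
    intro x hx
    rwa [boundaries, le_bot_iff.1 this, Submodule.map_bot, Submodule.mem_bot] at hx
  have hcyc : ∀ {v w}, {v} ∈ link K t → {w} ∈ link K t →
      single {w} 1 - single {v} (1 : ℤ) ∈ cycles (link K t) 1 := by
    intro v w hv hw
    refine ⟨Submodule.sub_mem _ (single_mem_chains hw rfl _) (single_mem_chains hv rfl _), ?_⟩
    simp [bdry_single, posSign, Finset.filter_singleton]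
  -- there is a second vertex
  obtain ⟨b, hb, hba⟩ : ∃ b, {b} ∈ link K t ∧ b ≠ a := by
    by_contra! hcon
    have : e.symm 1 = 0 := by
      obtain ⟨⟨z, hz⟩, hz'⟩ := Submodule.Quotient.mk_surjective _ (e.symm 1)
      rw [← hz', Submodule.Quotient.mk_eq_zero]
      have hz1 : z ∈ Submodule.span ℤ {single {a} (1 : ℤ)} := by
        refine chains_le (fun s hs hsc => ?_) hz.1
        obtain ⟨v, rfl⟩ := Finset.card_eq_one.1 hsc
        rw [hcon v hs]
        exact Submodule.mem_span_singleton_self _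
      obtain ⟨r, rfl⟩ := Submodule.mem_span_singleton.1 hz1
      have hr := LinearMap.mem_ker.1 hz.2
      rw [smul_single, smul_eq_mul, mul_one, bdry_single, Finset.sum_singleton,
        single_eq_zero] at hr
      have hr0 : r = 0 := by simpa [posSign, Finset.filter_singleton] using hr
      simp [hr0]
    simp at this
  -- there is no third one
  have hthird : ∀ c, {c} ∈ link K t → c = a ∨ c = b := by
    intro c hc
    by_contra! hcon
    -- two elements of an infinite cyclic group are dependent, but there are no boundaries
    let P : Homology (link K t) 1 := Submodule.Quotient.mk ⟨_, hcyc ha hb⟩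
    let Q : Homology (link K t) 1 := Submodule.Quotient.mk ⟨_, hcyc ha hc⟩
    have h0 : e Q • P - e P • Q = 0 := by
      apply e.injective
      rw [map_sub, map_smul, map_smul, map_zero, smul_eq_mul, smul_eq_mul, mul_comm, sub_self]
    rw [← Submodule.Quotient.mk_smul, ← Submodule.Quotient.mk_smul, ← Submodule.Quotient.mk_sub,
      Submodule.Quotient.mk_eq_zero] at h0
    have hQ := DFunLike.congr_fun (hb0 _ h0) {b}
    simp [hba.symm, hcon.2] at hQ
    have : Q = 0 := by
      apply e.injective; rw [hQ, map_zero]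
    rw [Submodule.Quotient.mk_eq_zero] at this
    have := DFunLike.congr_fun (hb0 _ this) {c}
    simp [hcon.1.symm] at this
  obtain ⟨T', hT'⟩ := hG b hb
  refine ⟨T', ?_, hT' ▸ Finset.subset_insert _ _, fun S hS => ?_⟩
  · rintro rfl
    exact hba (hinj hb (hT'.trans haT.symm))
  · obtain ⟨c, hc, hcS⟩ := hF S hS
    rcases hthird c hc with rfl | rfl
    · left; exact Subtype.ext (hcS.symm.trans haT)
    · right; exact Subtype.ext (hcS.symm.trans hT')

end

lemma Adj.symm {T T' : Facet K n} (h : Adj T T') : Adj T' T := by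
  rwa [Adj, Finset.inter_comm]

lemma Adj.ne {T T' : Facet K n} (h : Adj T T') : T ≠ T' := by
  rintro rfl
  rw [Adj, Finset.inter_self, T.2.2] at h
  omega

lemma inter_eq_of_ne {T T' : Facet K n} (hne : T ≠ T') {t : Finset V} (ht : t.card = n)
    (h : t ⊆ T.1) (h' : t ⊆ T'.1) : T.1 ∩ T'.1 = t := by
  refine (Finset.eq_of_subset_of_card_le (Finset.subset_inter h h') ?_).symm
  by_contra! hc
  have h1 := Finset.card_le_card (Finset.inter_subset_left (s₁ := T.1) (s₂ := T'.1))
  have e1 : T.1 ∩ T'.1 = T.1 := Finset.eq_of_subset_of_card_le Finset.inter_subset_left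
    (by rw [T.2.2]; omega)
  have e2 : T.1 ∩ T'.1 = T'.1 := Finset.eq_of_subset_of_card_le Finset.inter_subset_right
    (by rw [T'.2.2]; omega)
  exact hne (Subtype.ext (e1.symm.trans e2))

lemma adj_of_ne {T T' : Facet K n} (hne : T ≠ T') {t : Finset V} (ht : t.card = n)
    (h : t ⊆ T.1) (h' : t ⊆ T'.1) : Adj T T' := by
  rw [Adj, inter_eq_of_ne hne ht h h', ht]

/-- Neighbours in the star of the simplex `s`. -/
def StarAdj (s : Finset V) (T T' : Facet K n) : Prop := Adj T T' ∧ s ⊆ T.1 ∧ s ⊆ T'.1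

lemma StarAdj.mono {s t : Finset V} (h : s ⊆ t) {T T' : Facet K n} (hT : StarAdj t T T') :
    StarAdj s T T' :=
  ⟨hT.1, h.trans hT.2.1, h.trans hT.2.2⟩

/-- Stars in a homology manifold are strongly connected. -/
theorem star_connected (hK : IsHomologyManifold K n) {s : Finset V} (hs : s ∈ K.faces)
    {T T' : Facet K n} (hT : s ⊆ T.1) (hT' : s ⊆ T'.1) :
    Relation.ReflTransGen (StarAdj s) T T' := by
  induction hd : n + 1 - s.card generalizing s T T' with
  | zero =>
    have : T = T' := by
      have h1 := T.2.2
      have h2 := T'.2.2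
      apply Subtype.ext
      rw [← Finset.eq_of_subset_of_card_le hT (by omega),
        ← Finset.eq_of_subset_of_card_le hT' (by omega)]
    rw [this]
  | succ d ih =>
    rcases Nat.lt_or_ge s.card n with hc | hc
    · have hex : ∀ {S : Facet K n}, s ⊆ S.1 → ∃ v ∈ S.1, {v} ∈ link K s := by
        intro S hS
        obtain ⟨v, hv, hvs⟩ := Finset.exists_mem_notMem_of_card_lt_card (s := s) (t := S.1)
          (by rw [S.2.2]; omega)
        exact ⟨v, hv, singleton_mem_link.2
          ⟨hvs, S.mem_faces_of_subset (Finset.insert_subset hv hS) (by simp)⟩⟩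
      -- within the star of a larger simplex the induction hypothesis applies
      have key : ∀ {v} {S S' : Facet K n}, {v} ∈ link K s → s ⊆ S.1 → s ⊆ S'.1 → v ∈ S.1 →
          v ∈ S'.1 → Relation.ReflTransGen (StarAdj s) S S' := by
        intro v S S' hv hS hS' hvS hvS'
        obtain ⟨h1, h2⟩ := singleton_mem_link.1 hv
        refine Relation.ReflTransGen.mono (r := StarAdj (insert v s))
          (fun _ _ => StarAdj.mono (Finset.subset_insert v s)) _ _ ?_
        exact ih h2 (Finset.insert_subset hvS hS) (Finset.insert_subset hvS' hS')
            (by rw [Finset.card_insert_of_notMem h1]; omega)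
      obtain ⟨v, hvT, hv⟩ := hex hT
      obtain ⟨w, hwT', hw⟩ := hex hT'
      have hpath : ∀ w, Relation.ReflTransGen (fun x y => x ≠ y ∧ {x, y} ∈ link K s) v w →
          ∀ S : Facet K n, s ⊆ S.1 → w ∈ S.1 → Relation.ReflTransGen (StarAdj s) T S := by
        intro w hp
        induction hp with
        | refl => exact fun S hS hvS => key hv hT hS hvT hvS
        | @tail x y _ hxy ih' =>
          intro S hS hyS
          have hxyl := hxy.2
          have hy : {y} ∈ link K s := mem_link_of_subset hs hxyl (by simp)
          obtain ⟨S', hS'⟩ := exists_facet_subset hK hxyl.2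
          have h1 : s ⊆ S'.1 := Finset.subset_union_left.trans hS'
          have h2 : ({x, y} : Finset V) ⊆ S'.1 := Finset.subset_union_right.trans hS'
          exact (ih' S' h1 (h2 (by simp))).trans (key hy h1 hS (h2 (by simp)) hyS)
      exact hpath w (link_connected hK hs hc hv hw) T' hT' hwT'
    · by_cases h : T = T'
      · rw [h]
      · exact Relation.ReflTransGen.single ⟨adj_of_ne h (by omega) hT hT', hT, hT'⟩

lemma subset_of_isChain_starAdj {s : Finset V} {l : List (Facet K n)} {T : Facet K n}
    (h : (T :: l).IsChain (StarAdj s)) (hT : s ⊆ T.1) : ∀ S ∈ T :: l, s ⊆ S.1 := by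
  induction l generalizing T with
  | nil => simpa using hT
  | cons T' l ih =>
    rw [List.isChain_cons_cons] at h
    intro S hS
    rcases List.mem_cons.1 hS with rfl | hS
    · exact hT
    · exact ih h.2 h.1.2.2 S hS

/-- Any two `n`-simplices of the star of a simplex are joined by a path of neighbours. -/
lemma exists_isStarPath (hK : IsHomologyManifold K n) {s : Finset V} (hs : s ∈ K.faces)
    {T T' : Facet K n} (hT : s ⊆ T.1) (hT' : s ⊆ T'.1) : ∃ l, IsStarPath s T T' l := by
  obtain ⟨l, hl, hlast⟩ :=
    List.exists_isChain_cons_of_relationReflTransGen (star_connected hK hs hT hT')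
  refine ⟨T :: l, rfl, ?_, hl.imp fun _ _ h => h.1, ?_⟩
  · rw [List.getLast?_eq_some_getLast (List.cons_ne_nil _ _), hlast]
  · exact subset_of_isChain_starAdj hl hT

/-- A function that agrees on neighbours in a star is constant on the star. -/
lemma star_const (hK : IsHomologyManifold K n) {s : Finset V} (hs : s ∈ K.faces) {X : Type*}
    {f : Facet K n → X} (h : ∀ T T', StarAdj s T T' → f T = f T') {T T' : Facet K n}
    (hT : s ⊆ T.1) (hT' : s ⊆ T'.1) : f T = f T' := by
  induction star_connected hK hs hT hT' with
  | refl => rfl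
  | tail _ hxy ih => rw [ih hxy.2.1, h _ _ hxy]

end Manifold

/-! ### Products along cyclic lists -/

section Cyclic

variable {F : Type*}

lemma pathProd_eq_prod {M : Type*} [CommMonoid M] (r : F → F → M) (l : List F) :
    pathProd r l = ∏ i : Fin (l.length - 1), r (l[i.1]'(by omega)) (l[i.1 + 1]'(by omega)) := by
  induction l with
  | nil => simp [pathProd]
  | cons a l ih =>
    cases l with
    | nil => simp [pathProd]
    | cons b l =>
      rw [pathProd, ih]
      exact (Fin.prod_univ_succ (n := l.length) fun i =>
        r ((a :: b :: l)[i.1]'(by simp only [List.length_cons]; omega))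
          ((a :: b :: l)[i.1 + 1]'(by simp only [List.length_cons]; omega))).symm

lemma getElem_append_head {l : List F} (i : ℕ) (hi : i < l.length) :
    (l ++ l.head?.toList)[i + 1]'(by
      cases l with
      | nil => simp at hi
      | cons a l => simpa using hi) = l[(i + 1) % l.length]'(Nat.mod_lt _ (by omega)) := by
  rcases Nat.lt_or_ge (i + 1) l.length with h | h
  · rw [List.getElem_append_left h]
    simp only [Nat.mod_eq_of_lt h]
  · have : i + 1 = l.length := by omega
    rw [List.getElem_append_right h]
    cases l with
    | nil => simp at hi
    | cons a l => simp [this]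

variable [DecidableEq F]

/-- The product around a cyclically ordered list, with the successor given by `List.formPerm`. -/
lemma cyclicProd_eq_prod {M : Type*} [CommMonoid M] (r : F → F → M) {l : List F} (hl : l.Nodup) :
    cyclicProd r l = ∏ T ∈ l.toFinset, r T (l.formPerm T) := by
  rw [List.prod_toFinset _ hl, ← Fin.prod_univ_fun_getElem, cyclicProd, pathProd_eq_prod]
  rcases l.eq_nil_or_concat with rfl | ⟨l', a, hl'⟩
  · rfl
  have hlen : (l ++ l.head?.toList).length - 1 = l.length := by
    cases l with
    | nil => simp at hl'
    | cons a l => simp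
  refine Fintype.prod_equiv (finCongr hlen) _ _ fun i => ?_
  have hi : i.1 < l.length := by omega
  have h1 : (l ++ l.head?.toList)[i.1]'(by omega) = l[i.1] := List.getElem_append_left hi
  simp only [finCongr_apply, Fin.val_cast]
  rw [h1, getElem_append_head i.1 hi, List.formPerm_apply_getElem l hl i.1 hi]

lemma isChain_cyclic_iff (R : F → F → Prop) {l : List F} (hl : l.Nodup) :
    (l ++ l.head?.toList).IsChain R ↔ ∀ T ∈ l, R T (l.formPerm T) := by
  have hlen : l ≠ [] → (l ++ l.head?.toList).length = l.length + 1 := fun h => by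
    cases l with
    | nil => exact absurd rfl h
    | cons a l => simp
  have key : ∀ i (hi : i < l.length) (h' : i + 1 < (l ++ l.head?.toList).length),
      (R ((l ++ l.head?.toList)[i]) ((l ++ l.head?.toList)[i + 1]) ↔
        R l[i] (l.formPerm l[i])) := fun i hi h' => by
    have h1 : (l ++ l.head?.toList)[i]'(by omega) = l[i] := List.getElem_append_left hi
    rw [h1, getElem_append_head i hi, List.formPerm_apply_getElem l hl i hi]
  rw [List.isChain_iff_getElem]
  constructor
  · intro h T hT
    obtain ⟨i, hi, rfl⟩ := List.getElem_of_mem hT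
    have := hlen (List.ne_nil_of_mem hT)
    exact (key i hi (by omega)).1 (h i (by omega))
  · intro h i hi
    have hne : l ≠ [] := by rintro rfl; simp at hi
    have := hlen hne
    exact (key i (by omega) hi).2 (h _ (List.getElem_mem _))

end Cyclic

/-! ### Stars of simplices of codimension two -/

section Codim

variable {V : Type*} [LinearOrder V] {K : AbstractSimplicialComplex V} {n : ℕ}

lemma bdry_single_apply_of_not_subset {s t : Finset V} (h : ¬ t ⊆ s) (a : ℤ) :
    bdry (single s a) t = 0 := by
  rw [bdry_single, Finsupp.finsetSum_apply]
  refine Finset.sum_eq_zero fun v _ => ?_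
  rw [single_apply, if_neg]
  rintro rfl
  exact h (Finset.erase_subset _ _)

lemma bdry_single_insert_apply {v : V} {t : Finset V} (h : v ∉ t) (a : ℤ) :
    bdry (single (insert v t) a) t = a * posSign v t := by
  rw [bdry_single, Finsupp.finsetSum_apply, Finset.sum_eq_single_of_mem v (by simp)]
  · rw [Finset.erase_insert h, single_eq_same, ← posSign_erase_self, Finset.erase_insert h]
  · intro w hw hwv
    rw [single_apply, if_neg]
    intro heq
    have : v ∈ (insert v t).erase w := by simp [hwv.symm]
    exact h (heq ▸ this)

/-- The coefficient of a boundary at a face that lies in exactly two simplices. -/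
lemma bdry_apply_of_two {L : Set (Finset V)} {c : ℕ} {t : Finset V} {v w : V} (hv : v ∉ t)
    (hw : w ∉ t) (hvw : v ≠ w)
    (h : ∀ s ∈ L, s.card = c + 1 → t ⊆ s → s = insert v t ∨ s = insert w t)
    {x : Finset V →₀ ℤ} (hx : x ∈ chains L (c + 1)) :
    bdry x t = x (insert v t) * posSign v t + x (insert w t) * posSign w t := by
  let f : (Finset V →₀ ℤ) →ₗ[ℤ] ℤ := lapply t ∘ₗ bdry
  let g : (Finset V →₀ ℤ) →ₗ[ℤ] ℤ :=
    posSign v t • lapply (insert v t) + posSign w t • lapply (insert w t)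
  have hne : insert v t ≠ insert w t := fun heq => by
    have : v ∈ insert w t := heq ▸ Finset.mem_insert_self v t
    exact (Finset.mem_insert.1 this).elim hvw hv
  have : f x = g x := by
    refine eqOn_chains (fun s hs hc => ?_) hx
    by_cases hts : t ⊆ s
    · rcases h s hs hc hts with rfl | rfl
      · simp [f, g, bdry_single_insert_apply hv, hne]
      · simp [f, g, bdry_single_insert_apply hw, hne.symm]
    · have h1 : s ≠ insert v t := fun h => hts (h ▸ Finset.subset_insert _ _)
      have h2 : s ≠ insert w t := fun h => hts (h ▸ Finset.subset_insert _ _)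
      simp [f, g, bdry_single_apply_of_not_subset hts, h1, h2]
  simpa [f, g, mul_comm] using this

variable (hK : IsHomologyManifold K n)
include hK

/-- The star of a simplex of codimension two is finite: a nonzero cycle of its link is nonzero on
every edge of the link. -/
theorem finite_star {s : Finset V} (hs : s ∈ K.faces) (hc : s.card + 1 = n) :
    {T : Facet K n | s ⊆ T.1}.Finite := by
  obtain ⟨e⟩ := ((hK s hs) 2).1 (by omega)
  obtain ⟨z, hz, hz0⟩ : ∃ z ∈ cycles (link K s) 2, z ≠ 0 := by
    obtain ⟨⟨z, hz⟩, hz'⟩ := Submodule.Quotient.mk_surjective _ (e.symm 1)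
    refine ⟨z, hz, ?_⟩
    rintro rfl
    have : (⟨0, hz⟩ : cycles (link K s) 2) = 0 := rfl
    rw [this, Submodule.Quotient.mk_zero] at hz'
    simpa using congrArg e hz'
  have key : ∀ T T' : Facet K n, StarAdj s T T' → (z (T.1 \ s) ≠ 0) = (z (T'.1 \ s) ≠ 0) := by
    intro T T' ⟨hadj, hT, hT'⟩
    have hst : s ⊆ T.1 ∩ T'.1 := Finset.subset_inter hT hT'
    -- the common vertex of the two edges of the link
    obtain ⟨u, hu⟩ := Finset.card_eq_one.1 (show ((T.1 ∩ T'.1) \ s).card = 1 by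
      rw [Finset.card_sdiff_of_subset hst, hadj]; omega)
    have huI : u ∈ (T.1 ∩ T'.1) \ s := hu ▸ Finset.mem_singleton_self u
    have hI : T.1 ∩ T'.1 = insert u s := by
      rw [← Finset.sdiff_union_of_subset hst, hu, Finset.singleton_union]
    have hother : ∀ S : Facet K n, s ⊆ S.1 → u ∈ S.1 → ∃ v, v ≠ u ∧ S.1 \ s = {v, u} := by
      intro S hS huS
      have h2 : ((S.1 \ s).erase u).card = 1 := by
        rw [Finset.card_erase_of_mem (by simp only [Finset.mem_sdiff] at huI ⊢; exact ⟨huS, huI.2⟩),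
          Finset.card_sdiff_of_subset hS, S.2.2]
        omega
      obtain ⟨v, hv⟩ := Finset.card_eq_one.1 h2
      refine ⟨v, ?_, ?_⟩
      · have : v ∈ (S.1 \ s).erase u := hv ▸ Finset.mem_singleton_self v
        exact (Finset.mem_erase.1 this).1
      · rw [← Finset.insert_erase (s := S.1 \ s) (a := u), hv, Finset.pair_comm]
        simp only [Finset.mem_sdiff] at huI ⊢; exact ⟨huS, huI.2⟩
    simp only [Finset.mem_sdiff, Finset.mem_inter] at huI
    obtain ⟨v, hvu, hv⟩ := hother T hT huI.1.1
    obtain ⟨w, hwu, hw⟩ := hother T' hT' huI.1.2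
    have hrec : ∀ {S S' : Facet K n}, s ⊆ S.1 → s ⊆ S'.1 → S.1 \ s = S'.1 \ s → S = S' := by
      intro S S' hS hS' h
      apply Subtype.ext
      rw [← Finset.sdiff_union_of_subset hS, h, Finset.sdiff_union_of_subset hS']
    have hvw : v ≠ w := fun h => hadj.ne (hrec hT hT' (by rw [hv, hw, h]))
    obtain ⟨T'', hne, hT'', honly⟩ := exists_other_facet hK (hI ▸ hadj)
      (hI ▸ Finset.inter_subset_left : insert u s ⊆ T.1) (by simp)
    have hT''T' : T' = T'' :=
      (honly T' (hI ▸ Finset.inter_subset_right)).resolve_left hadj.ne.symm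
    have := bdry_apply_of_two (L := link K s) (c := 1) (t := {u}) (v := v) (w := w)
      (by simpa using hvu) (by simpa using hwu) hvw ?_ hz.1
    · rw [LinearMap.mem_ker.1 hz.2, Finsupp.zero_apply, ← hv, ← hw] at this
      rcases posSign_eq_or v {u} with h1 | h1 <;> rcases posSign_eq_or w {u} with h2 | h2 <;>
        · rw [h1, h2] at this
          rw [eq_iff_iff, not_iff_not]
          constructor <;> intro h <;> omega
    · intro σ hσ hσc huσ
      have hSc : (s ∪ σ).card = n + 1 := by
        rw [Finset.card_union_of_disjoint hσ.1, hσc]; omega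
      have hσ' : (s ∪ σ) \ s = σ := by
        rw [Finset.union_sdiff_left, Finset.sdiff_eq_self_of_disjoint hσ.1.symm]
      rw [← hv, ← hw]
      have hins : insert u s ⊆ s ∪ σ := Finset.insert_subset
        (Finset.mem_union_right _ (huσ (by simp))) Finset.subset_union_left
      rcases honly ⟨s ∪ σ, hσ.2, hSc⟩ hins with h | h
      · left; rw [← h]; exact hσ'.symm
      · right; rw [hT''T', ← h]; exact hσ'.symm
  -- some edge, hence every edge, lies in the support of `z`
  obtain ⟨σ, hσ⟩ := Finsupp.ne_iff.1 hz0
  have hσL : σ ∈ link K s ∧ σ.card = 2 := hz.1 (Finsupp.mem_support_iff.2 hσ)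
  have hσ' : (s ∪ σ) \ s = σ := by
    rw [Finset.union_sdiff_left, Finset.sdiff_eq_self_of_disjoint hσL.1.1.symm]
  let T₀ : Facet K n := ⟨s ∪ σ, hσL.1.2, by
    rw [Finset.card_union_of_disjoint hσL.1.1, hσL.2]; omega⟩
  have hall : ∀ T : Facet K n, s ⊆ T.1 → z (T.1 \ s) ≠ 0 := by
    intro T hT
    have := star_const hK hs (f := fun T : Facet K n => z (T.1 \ s) ≠ 0) key
      (T := T₀) (T' := T) Finset.subset_union_left hT
    rw [← this]
    change z ((s ∪ σ) \ s) ≠ 0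
    rw [hσ']
    exact hσ
  refine Set.Finite.of_finite_image (f := fun T : Facet K n => T.1 \ s)
    (z.support.finite_toSet.subset ?_) ?_
  · rintro _ ⟨T, hT, rfl⟩
    exact Finsupp.mem_support_iff.2 (hall T hT)
  · intro T hT T' hT' h
    apply Subtype.ext
    change T.1 \ s = T'.1 \ s at h
    rw [← Finset.sdiff_union_of_subset hT, h, Finset.sdiff_union_of_subset hT']

/-- In the star of a simplex of codimension two every `n`-simplex has two neighbours. -/
theorem exists_two_neighbours {s : Finset V} (hc : s.card + 1 = n)
    {T : Facet K n} (hT : s ⊆ T.1) :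
    ∃ T₁ T₂ : Facet K n, T₁ ≠ T₂ ∧ ∀ S, StarAdj s T S ↔ S = T₁ ∨ S = T₂ := by
  obtain ⟨v, w, hvw, hvwT⟩ := Finset.card_eq_two.1 (show (T.1 \ s).card = 2 by
    rw [Finset.card_sdiff_of_subset hT, T.2.2]; omega)
  have hv : v ∈ T.1 ∧ v ∉ s := Finset.mem_sdiff.1 (hvwT ▸ by simp)
  have hw : w ∈ T.1 ∧ w ∉ s := Finset.mem_sdiff.1 (hvwT ▸ by simp)
  have cv : (insert v s).card = n := by rw [Finset.card_insert_of_notMem hv.2, hc]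
  have cw : (insert w s).card = n := by rw [Finset.card_insert_of_notMem hw.2, hc]
  have sv := Finset.insert_subset hv.1 hT
  have sw := Finset.insert_subset hw.1 hT
  obtain ⟨T₁, hT₁, h₁, u₁⟩ := exists_other_facet hK cv sv (by simp)
  obtain ⟨T₂, hT₂, h₂, u₂⟩ := exists_other_facet hK cw sw (by simp)
  refine ⟨T₁, T₂, ?_, fun S => ⟨?_, ?_⟩⟩
  · rintro rfl
    apply hT₁
    have : T.1 ⊆ T₁.1 := by
      rw [← Finset.sdiff_union_of_subset hT, hvwT]
      refine Finset.union_subset ?_ ((Finset.subset_insert _ _).trans h₁)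
      intro x hx
      rcases Finset.mem_insert.1 hx with rfl | hx
      · exact h₁ (by simp)
      · rw [Finset.mem_singleton.1 hx]; exact h₂ (by simp)
    exact Subtype.ext (Finset.eq_of_subset_of_card_le this (by rw [T.2.2, T₁.2.2])).symm
  · rintro ⟨hadj, -, hS⟩
    obtain ⟨x, hx, hxs⟩ := Finset.exists_mem_notMem_of_card_lt_card (s := s) (t := T.1 ∩ S.1)
      (by rw [hadj]; omega)
    rw [Finset.mem_inter] at hx
    have : x ∈ T.1 \ s := Finset.mem_sdiff.2 ⟨hx.1, hxs⟩
    rw [hvwT, Finset.mem_insert, Finset.mem_singleton] at this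
    rcases this with rfl | rfl
    · exact .inl ((u₁ S (Finset.insert_subset hx.2 hS)).resolve_left hadj.ne.symm)
    · exact .inr ((u₂ S (Finset.insert_subset hx.2 hS)).resolve_left hadj.ne.symm)
  · rintro (rfl | rfl)
    · exact ⟨adj_of_ne hT₁.symm cv sv h₁, hT, (Finset.subset_insert _ _).trans h₁⟩
    · exact ⟨adj_of_ne hT₂.symm cw sw h₂, hT, (Finset.subset_insert _ _).trans h₂⟩

/-- The dual cell of a simplex of codimension two is a polygon. -/
theorem exists_isDualCellBoundary {s : Finset V} (hs : s ∈ K.faces) (hc : s.card + 1 = n) :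
    ∃ c : List (Facet K n), IsDualCellBoundary s c := by
  let X := {T : Facet K n // s ⊆ T.1}
  have : Finite X := finite_star hK hs hc
  let G : SimpleGraph X :=
    { Adj := fun x y => DiscreteDG.Adj x.1 y.1
      symm := ⟨fun _ _ h => h.symm⟩
      loopless := ⟨fun _ h => h.ne rfl⟩ }
  have hG : ∀ x y : X, StarAdj s x.1 y.1 ↔ G.Adj x y := fun x y =>
    ⟨fun h => h.1, fun h => ⟨h, x.2, y.2⟩⟩
  have hnb : ∀ x : X, ∃ y z : X, y ≠ z ∧ G.neighborSet x = {y, z} := by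
    intro x
    obtain ⟨T₁, T₂, hne, h⟩ := exists_two_neighbours hK hc x.2
    refine ⟨⟨T₁, ((h T₁).2 (.inl rfl)).2.2⟩, ⟨T₂, ((h T₂).2 (.inr rfl)).2.2⟩,
      fun h => hne (congrArg Subtype.val h), ?_⟩
    ext y
    rw [SimpleGraph.mem_neighborSet, ← hG, h, Set.mem_insert_iff, Set.mem_singleton_iff,
      Subtype.ext_iff (a1 := y), Subtype.ext_iff (a1 := y)]
  have hcyc : G.IsCycles := fun x _ => by
    obtain ⟨y, z, hyz, h⟩ := hnb x
    rw [h, Set.ncard_pair hyz]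
  obtain ⟨T₀, hT₀⟩ := exists_facet_subset hK hs
  let x₀ : X := ⟨T₀, hT₀⟩
  obtain ⟨p, hp, hpv⟩ := hcyc.exists_cycle_toSubgraph_verts_eq_connectedComponentSupp
    (c := G.connectedComponentMk x₀) (v := x₀) rfl (by
      obtain ⟨y, z, -, h⟩ := hnb x₀
      exact ⟨y, h ▸ by simp⟩)
  have hreach : ∀ y : X, G.Reachable x₀ y := by
    have : ∀ T : Facet K n, Relation.ReflTransGen (StarAdj s) T₀ T → ∀ hT : s ⊆ T.1,
        G.Reachable x₀ ⟨T, hT⟩ := by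
      intro T h
      induction h with
      | refl => exact fun _ => SimpleGraph.Reachable.refl _
      | tail _ h ih =>
        intro hT
        exact (ih h.2.1).trans (SimpleGraph.Adj.reachable ((hG ⟨_, h.2.1⟩ ⟨_, hT⟩).1 h))
    exact fun y => this y.1 (star_connected hK hs hT₀ y.2) y.2
  have hsupp : ∀ y : X, y ∈ p.support := by
    intro y
    rw [← SimpleGraph.Walk.mem_verts_toSubgraph, hpv, SimpleGraph.ConnectedComponent.mem_supp_iff,
      SimpleGraph.ConnectedComponent.eq]
    exact (hreach y).symm
  have hne : p.support ≠ [] := SimpleGraph.Walk.support_ne_nil p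
  have hdl : p.support.dropLast ++ [x₀] = p.support := by
    conv_rhs => rw [← List.dropLast_append_getLast hne, SimpleGraph.Walk.getLast_support]
  have hhead : p.support.dropLast.head? = some x₀ := by
    cases p with
    | nil => exact absurd rfl hp.ne_nil
    | cons h p =>
      rw [SimpleGraph.Walk.support_cons, List.dropLast_cons_of_ne_nil p.support_ne_nil]
      rfl
  refine ⟨p.support.dropLast.map Subtype.val,
    (List.nodup_map_iff Subtype.val_injective).2 hp.nodup_dropLast_support, fun T => ?_, ?_⟩
  · rw [List.mem_map]
    constructor
    · rintro ⟨y, -, rfl⟩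
      exact y.2
    · intro hT
      refine ⟨⟨T, hT⟩, ?_, rfl⟩
      have := hsupp ⟨T, hT⟩
      rw [← hdl, List.mem_append, List.mem_singleton] at this
      rcases this with h | h
      · exact h
      · rw [h]; exact List.mem_of_head? hhead
  · have h1 : (p.support.dropLast.map Subtype.val).head?.toList = [x₀].map Subtype.val := by
      rw [List.head?_map, hhead]; rfl
    rw [h1, ← List.map_append, hdl, List.isChain_map]
    exact p.isChain_adj_support

end Codim

/-! ### Potentials on stars -/

section Potential

variable {V : Type*} [LinearOrder V] {K : AbstractSimplicialComplex V} {n : ℕ}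

/-- Around a simplex of codimension two, quantities with trivial product along the dual polygon
have a potential. -/
lemma exists_potential_of_cyclicProd {M : Type*} [CommGroup M] (hK : IsHomologyManifold K n)
    {s : Finset V} (hc : s.card + 1 = n) {l : List (Facet K n)}
    (hcell : IsDualCellBoundary s l) (r : Facet K n → Facet K n → M)
    (hr : ∀ T T', StarAdj s T T' → r T T' * r T' T = 1) (hB : cyclicProd r l = 1) :
    ∃ φ : Facet K n → Additive M, ∀ T T', StarAdj s T T' →
      Additive.ofMul (r T T') = φ T - φ T' := by
  classical
  obtain ⟨hnd, hmem, hchain⟩ := hcell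
  rw [isChain_cyclic_iff _ hnd] at hchain
  let g : ℕ → Additive M := fun i => if h : i < l.length then
    Additive.ofMul (r l[i] (l.formPerm l[i])) else 0
  let φ : Facet K n → Additive M := fun T => -∑ i ∈ Finset.range (l.idxOf T), g i
  have hg : ∑ i ∈ Finset.range l.length, g i = 0 := by
    rw [cyclicProd_eq_prod r hnd, List.prod_toFinset _ hnd, ← Fin.prod_univ_fun_getElem] at hB
    have := congrArg Additive.ofMul hB
    rw [ofMul_prod, ofMul_one] at this
    rw [Finset.sum_range, ← this]
    exact Finset.sum_congr rfl fun i _ => by simp [g]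
  have hφ : ∀ i (hi : i < l.length), φ l[i] = -∑ j ∈ Finset.range i, g j := fun i hi => by
    simp only [φ, hnd.idxOf_getElem]
  have hnext : ∀ T ∈ l, Additive.ofMul (r T (l.formPerm T)) = φ T - φ (l.formPerm T) := by
    intro T hT
    obtain ⟨i, hi, rfl⟩ := List.getElem_of_mem hT
    have hgi : g i = Additive.ofMul (r l[i] (l.formPerm l[i])) := by simp [g, hi]
    rw [← hgi, List.formPerm_apply_getElem l hnd i hi, hφ, hφ]
    rcases Nat.lt_or_ge (i + 1) l.length with h | h
    · simp only [Nat.mod_eq_of_lt h, Finset.sum_range_succ]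
      abel
    · have : i + 1 = l.length := by omega
      simp only [this, Nat.mod_self, Finset.range_zero, Finset.sum_empty]
      rw [← this, Finset.sum_range_succ] at hg
      rw [eq_neg_of_add_eq_zero_right hg]
      abel
  refine ⟨φ, fun T S hTS => ?_⟩
  have hT : T ∈ l := (hmem T).2 hTS.2.1
  obtain ⟨T₁, T₂, hne, h⟩ := exists_two_neighbours hK hc hTS.2.1
  have hP : ∀ U ∈ l, StarAdj s U (l.formPerm U) := fun U hU =>
    ⟨hchain U hU, (hmem U).1 hU, (hmem _).1 (List.formPerm_apply_mem_of_mem hU)⟩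
  have hprev : l.formPerm (l.formPerm⁻¹ T) = T := by simp
  have hprevc : l.formPerm⁻¹ T ∈ l := by
    apply List.mem_of_formPerm_apply_mem
    rw [hprev]; exact hT
  have hprevS : StarAdj s T (l.formPerm⁻¹ T) := by
    have := hP _ hprevc
    rw [hprev] at this
    exact ⟨this.1.symm, this.2.2, this.2.1⟩
  -- the dual polygon has at least three vertices, so that its two directions lead to
  -- different neighbours
  have hpn : l.formPerm T ≠ l.formPerm⁻¹ T := by
    intro heq
    have h2 : (l.formPerm ^ 2) T = T := by
      rw [pow_two, Equiv.Perm.mul_apply, heq, hprev]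
    have h3 : 3 ≤ l.length := by
      have hsub : ({T, T₁, T₂} : Finset (Facet K n)) ⊆ l.toFinset := by
        intro U hU
        rw [List.mem_toFinset, hmem]
        simp only [Finset.mem_insert, Finset.mem_singleton] at hU
        rcases hU with rfl | rfl | rfl
        · exact hTS.2.1
        · exact ((h _).2 (.inl rfl)).2.2
        · exact ((h _).2 (.inr rfl)).2.2
      have hcard := Finset.card_le_card hsub
      rw [Finset.card_eq_three.2 ⟨T, T₁, T₂, ((h _).2 (.inl rfl)).1.ne,
        ((h _).2 (.inr rfl)).1.ne, hne, rfl⟩, List.toFinset_card_of_nodup hnd] at hcard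
      exact hcard
    obtain ⟨i, hi, rfl⟩ := List.getElem_of_mem hT
    rw [List.formPerm_pow_apply_getElem l hnd, hnd.getElem_inj_iff] at h2
    rcases Nat.lt_or_ge (i + 2) l.length with hlt | hge
    · rw [Nat.mod_eq_of_lt hlt] at h2; omega
    · rw [Nat.mod_eq_sub_mod hge, Nat.mod_eq_of_lt (by omega)] at h2; omega
  have hS : S = l.formPerm T ∨ S = l.formPerm⁻¹ T := by
    have h1 := (h _).1 (hP T hT)
    have h2 := (h _).1 hprevS
    have h3 := (h _).1 hTS
    rcases h1 with h1 | h1 <;> rcases h2 with h2 | h2 <;> rcases h3 with h3 | h3 <;>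
      first
      | exact .inl (h3.trans h1.symm)
      | exact .inr (h3.trans h2.symm)
      | exact absurd (h1.trans h2.symm) hpn
  rcases hS with rfl | rfl
  · exact hnext T hT
  · have h1 := hnext _ hprevc
    rw [hprev] at h1
    rw [eq_inv_of_mul_eq_one_left (hr _ _ hTS), ofMul_inv, h1, neg_sub]

/-- Quantities on pairs of neighbours in the star of a simplex have a potential, provided their
products around the dual 2-cells are trivial. In codimension at least three potentials `φ v` on the
stars of the larger simplices `insert v s` are normalized so as to agree, which is possible since
the first cohomology of the link vanishes. -/
theorem exists_star_potential {M : Type*} [CommGroup M] (hK : IsHomologyManifold K n)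
    (r : Facet K n → Facet K n → M) {s : Finset V} (hs : s ∈ K.faces) (hc : s.card ≤ n)
    (hr : ∀ T T', StarAdj s T T' → r T T' * r T' T = 1)
    (hB : ∀ t ∈ K.faces, s ⊆ t → t.card + 1 = n → ∀ c, IsDualCellBoundary t c →
      cyclicProd r c = 1) :
    ∃ φ : Facet K n → Additive M, ∀ T T', StarAdj s T T' →
      Additive.ofMul (r T T') = φ T - φ T' := by
  classical
  induction hd : n - s.card generalizing s with
  | zero =>
    obtain ⟨T, hT⟩ := exists_facet_subset hK hs
    obtain ⟨T', hne, hT', hall⟩ := exists_other_facet hK (by omega : s.card = n) hT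
      (nonempty_of_mem_faces hs)
    refine ⟨fun S => if S = T then Additive.ofMul (r T T') else 0, fun S S' h => ?_⟩
    rcases hall S h.2.1 with rfl | rfl <;> rcases hall S' h.2.2 with rfl | rfl
    · exact absurd rfl h.1.ne
    · simp [hne]
    · rw [eq_inv_of_mul_eq_one_left (hr _ _ h)]
      simp [hne]
    · exact absurd rfl h.1.ne
  | succ d ih =>
    rcases Nat.eq_zero_or_pos d with rfl | hd0
    · obtain ⟨c, hcell⟩ := exists_isDualCellBoundary hK hs (by omega)
      exact exists_potential_of_cyclicProd hK (by omega) hcell r hr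
        (hB s hs subset_rfl (by omega) c hcell)
    have hφ : ∀ v, ∃ φ : Facet K n → Additive M, {v} ∈ link K s → ∀ T T',
        StarAdj (insert v s) T T' → Additive.ofMul (r T T') = φ T - φ T' := by
      intro v
      by_cases hv : {v} ∈ link K s
      · obtain ⟨h1, h2⟩ := singleton_mem_link.1 hv
        have hcard := Finset.card_insert_of_notMem h1
        obtain ⟨φ, h⟩ := ih h2 (by omega)
          (fun T T' h => hr T T' (h.mono (Finset.subset_insert _ _)))
          (fun t ht hst => hB t ht ((Finset.subset_insert _ _).trans hst)) (by omega)
        exact ⟨φ, fun _ => h⟩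
      · exact ⟨0, fun h => absurd h hv⟩
    choose φ hφ using hφ
    -- the differences of the potentials form a 1-cocycle `H` of the link
    obtain ⟨H, hH⟩ := exists_common_cochain (c := 2)
      (fun T : {T : Facet K n // s ⊆ T.1} => {σ | σ ⊆ T.1.1 \ s})
      (fun T => vertexCochain (fun v => φ v T.1) ∘ₗ bdry) (by
        intro T T' σ hσ hσ' hc2
        obtain ⟨a, b, hab, rfl⟩ := Finset.card_eq_two.1 hc2
        wlog h : a < b generalizing a b
        · rw [Finset.pair_comm] at hσ hσ' hc2 ⊢
          exact this b a hab.symm hσ hσ' hc2 (lt_of_le_of_ne (not_lt.1 h) hab.symm)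
        rw [← orientedSimplex_pair_of_lt h]
        simp only [LinearMap.comp_apply, bdry_orientedSimplex_pair hab, map_sub,
          vertexCochain_single]
        have hl : {a, b} ∈ link K s := mem_link_of_subset hs (sdiff_mem_link T.2) hσ
        have ha : {a} ∈ link K s := mem_link_of_subset hs hl (by simp)
        have hb : {b} ∈ link K s := mem_link_of_subset hs hl (by simp)
        refine star_const hK hl.2 (f := fun S => φ b S - φ a S) ?_
          (Finset.union_subset T.2 (hσ.trans Finset.sdiff_subset))
          (Finset.union_subset T'.2 (hσ'.trans Finset.sdiff_subset))
        intro S S' hSS'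
        have e1 := hφ a ha S S' (hSS'.mono (by
          rw [Finset.insert_eq, Finset.union_comm]
          exact Finset.union_subset_union_right (by simp)))
        have e2 := hφ b hb S S' (hSS'.mono (by
          rw [Finset.insert_eq, Finset.union_comm]
          exact Finset.union_subset_union_right (by simp)))
        have e3 := e1.symm.trans e2
        rw [sub_eq_sub_iff_add_eq_add] at e3 ⊢
        rw [← e3, add_comm])
    have hfacet : ∀ σ ∈ link K s, ∃ T : {T : Facet K n // s ⊆ T.1}, σ ⊆ T.1.1 \ s := by
      intro σ hσ
      obtain ⟨T, hT⟩ := exists_facet_subset hK hσ.2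
      exact ⟨⟨T, Finset.subset_union_left.trans hT⟩,
        Finset.subset_sdiff.2 ⟨Finset.subset_union_right.trans hT, hσ.1.symm⟩⟩
    have hH0 : ∀ z ∈ cycles (link K s) 2, H z = 0 := by
      intro z hz
      obtain ⟨x, hx, rfl⟩ := mem_boundaries_of_subsingleton (((hK s hs) 2).2 (by omega)) hz
      refine eqOn_chains (f := H ∘ₗ bdry) (g := 0) (fun σ hσ hσc => ?_) hx
      obtain ⟨T, hT⟩ := hfacet σ hσ
      rw [LinearMap.comp_apply, hH T, LinearMap.comp_apply, bdry_bdry, map_zero,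
        LinearMap.zero_apply]
      exact bdry_mem_chains (L := {σ | σ ⊆ T.1.1 \ s})
        (fun ρ hρ _ w _ => (Finset.erase_subset _ _).trans hρ) (single_mem_chains hT hσc _)
    obtain ⟨g, hg⟩ := exists_eq_comp_bdry (link K s) H hH0
    let ψ : V → Facet K n → Additive M := fun v T => φ v T - g (single {v} 1)
    have hψ : ∀ T : Facet K n, s ⊆ T.1 → ∀ v ∈ T.1 \ s, ∀ w ∈ T.1 \ s, ψ v T = ψ w T := by
      intro T hT v hv w hw
      by_cases hvw : v = w
      · rw [hvw]
      have hσ : [v, w].toFinset ⊆ T.1 \ s := by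
        intro x hx
        simp only [List.toFinset_cons, List.toFinset_nil, Finset.mem_insert, Finset.notMem_empty,
          or_false] at hx
        rcases hx with rfl | rfl <;> assumption
      have hnd : [v, w].Nodup := by simpa using hvw
      have h1 := hH ⟨T, hT⟩ _ (orientedSimplex_mem_chains (L := {σ | σ ⊆ T.1 \ s}) hσ hnd)
      rw [hg _ (orientedSimplex_mem_chains (mem_link_of_subset hs (sdiff_mem_link hT) hσ) hnd)]
        at h1
      simp only [LinearMap.comp_apply, bdry_orientedSimplex_pair hvw, map_sub,
          vertexCochain_single] at h1
      simp only [ψ]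
      rw [sub_eq_sub_iff_add_eq_add] at h1 ⊢
      rw [add_comm, h1, add_comm]
    have hex : ∀ T : Facet K n, ∃ v, v ∈ T.1 \ s := by
      intro T
      obtain ⟨v, hv, hvs⟩ := Finset.exists_mem_notMem_of_card_lt_card (s := s) (t := T.1)
        (by rw [T.2.2]; omega)
      exact ⟨v, Finset.mem_sdiff.2 ⟨hv, hvs⟩⟩
    choose v hv using hex
    refine ⟨fun T => ψ (v T) T, fun T T' h => ?_⟩
    obtain ⟨w, hw, hws⟩ := Finset.exists_mem_notMem_of_card_lt_card (s := s) (t := T.1 ∩ T'.1)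
        (by rw [h.1]; omega)
    rw [Finset.mem_inter] at hw
    have hwl : {w} ∈ link K s := mem_link_of_subset hs (sdiff_mem_link h.2.1)
      (by simpa using ⟨hw.1, hws⟩)
    simp only
    rw [hψ T h.2.1 _ (hv T) w (Finset.mem_sdiff.2 ⟨hw.1, hws⟩),
      hψ T' h.2.2 _ (hv T') w (Finset.mem_sdiff.2 ⟨hw.2, hws⟩),
      hφ w hwl T T' ⟨h.1, Finset.insert_subset hw.1 h.2.1, Finset.insert_subset hw.2 h.2.2⟩]
    simp only [ψ]
    abel

end Potential

/-! ### Relations, realization and uniqueness -/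

section Realization

variable {V : Type*} [LinearOrder V] {K : AbstractSimplicialComplex V} {n : ℕ}

lemma pair_subset {i j : V} {s : Finset V} : ({i, j} : Finset V) ⊆ s ↔ i ∈ s ∧ j ∈ s := by
  rw [Finset.insert_subset_iff, Finset.singleton_subset_iff]

lemma triple_subset {i j l : V} {s : Finset V} :
    ({i, j, l} : Finset V) ⊆ s ↔ i ∈ s ∧ j ∈ s ∧ l ∈ s := by
  rw [Finset.insert_subset_iff, pair_subset]

/-- Products along paths telescope. -/
lemma IsStarPath.ofMul_pathProd {M : Type*} [CommGroup M] {s : Finset V} {T T' : Facet K n}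
    {l : List (Facet K n)} (h : IsStarPath s T T' l) {r : Facet K n → Facet K n → M}
    {φ : Facet K n → Additive M}
    (hr : ∀ T T', StarAdj s T T' → Additive.ofMul (r T T') = φ T - φ T') :
    Additive.ofMul (pathProd r l) = φ T - φ T' := by
  obtain ⟨hh, hl, hc, hs⟩ := h
  induction l generalizing T with
  | nil => simp at hh
  | cons a l ih =>
    obtain rfl : a = T := by simpa using hh
    cases l with
    | nil =>
      obtain rfl : a = T' := by simpa using hl
      rw [pathProd, ofMul_one, sub_self]
      simp
    | cons b l =>
      rw [List.isChain_cons_cons] at hc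
      rw [pathProd, ofMul_mul, hr a b ⟨hc.1, hs a (by simp), hs b (by simp)⟩,
        ih rfl (by simpa using hl) hc.2 fun S hS => hs S (List.mem_cons_of_mem _ hS),
        sub_add_sub_cancel]

lemma IsDualCellBoundary.isStarPath {s : Finset V} {T : Facet K n} {l : List (Facet K n)}
    (h : IsDualCellBoundary s (T :: l)) : IsStarPath s T T (T :: l ++ [T]) := by
  refine ⟨rfl, List.getLast?_concat, h.2.2, fun S hS => (h.2.1 S).1 ?_⟩
  simp only [List.cons_append, List.mem_cons, List.mem_append, List.not_mem_nil, or_false] at hS ⊢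
  tauto

lemma IsDualCellBoundary.cyclicProd_eq_one {M : Type*} [CommGroup M] {s : Finset V}
    {c : List (Facet K n)} (h : IsDualCellBoundary s c) {r : Facet K n → Facet K n → M}
    {φ : Facet K n → Additive M}
    (hr : ∀ T T', StarAdj s T T' → Additive.ofMul (r T T') = φ T - φ T') :
    cyclicProd r c = 1 := by
  cases c with
  | nil => rfl
  | cons T l =>
    apply Additive.ofMul.injective
    rw [cyclicProd]
    exact (h.isStarPath.ofMul_pathProd hr).trans (by rw [sub_self]; rfl)

section Potentials

variable {M : Type*} [CommGroup M] {Φ : Facet K n → (Finset V →₀ ℤ) →ₗ[ℤ] Additive M}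
  {ρ : V → V → Facet K n → Facet K n → M}

lemma IsPotential.mono {R R' : Facet K n → Facet K n → Prop} (h : IsPotential R Φ ρ)
    (hR : ∀ T T', R' T T' → R T T') : IsPotential R' Φ ρ :=
  fun i j T T' hij hT => h i j T T' hij (hR _ _ hT)

lemma IsPotential.starAdj (h : IsPotential Adj Φ ρ) {i j : V} (hij : i ≠ j) {T T' : Facet K n}
    (hT : StarAdj {i, j} T T') : Additive.ofMul (ρ i j T T') =
      Φ T (orientedSimplex [i, j]) - Φ T' (orientedSimplex [i, j]) :=
  h i j T T' hij hT.1 (Finset.subset_inter hT.2.1 hT.2.2)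

lemma IsPotential.extend (h : IsPotential Adj Φ ρ)
    {P : V → V → Facet K n → Facet K n → List (Facet K n)} (hP : IsPathSystem P) :
    IsPotential (fun _ _ => True) Φ (extend P ρ) := by
  intro i j T T' hij _ hs
  exact (hP i j T T' hij (hs.trans Finset.inter_subset_left)
    (hs.trans Finset.inter_subset_right)).ofMul_pathProd fun _ _ => h.starAdj hij

lemma IsPotential.isRhoData (h : IsPotential Adj Φ ρ) : IsRhoData ρ := by
  intro i j T T' hij hT hs
  have hs' : {i, j} ⊆ T'.1 ∩ T.1 := by rwa [Finset.inter_comm]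
  constructor
  · apply Additive.ofMul.injective
    rw [ofMul_mul, h i j T T' hij hT hs, h i j T' T hij hT.symm hs', sub_add_sub_cancel, sub_self]
    rfl
  · apply Additive.ofMul.injective
    rw [h i j T T' hij hT hs, h j i T' T hij.symm hT.symm (by rwa [Finset.pair_comm]),
      orientedSimplex_swap hij, map_neg, map_neg]
    abel

lemma IsPotential.relationB (h : IsPotential Adj Φ ρ) : RelationB ρ := by
  intro s _ _ c hc i hi j hj hij
  refine hc.cyclicProd_eq_one (φ := fun T => Φ T (orientedSimplex [i, j])) fun T T' hT => ?_
  exact h.starAdj hij (hT.mono (pair_subset.2 ⟨hi, hj⟩))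

lemma IsPotential.triple {R : Facet K n → Facet K n → Prop} (h : IsPotential R Φ ρ) {i j l : V}
    (hij : i ≠ j) (hjl : j ≠ l) (hli : l ≠ i) {T T' : Facet K n} (hT : R T T')
    (hs : {i, j, l} ⊆ T.1 ∩ T'.1) :
    Additive.ofMul (ρ i j T T' * ρ j l T T' * ρ l i T T') =
      Φ T (bdry (orientedSimplex [i, j, l])) - Φ T' (bdry (orientedSimplex [i, j, l])) := by
  obtain ⟨hi, hj, hl⟩ := triple_subset.1 hs
  rw [ofMul_mul, ofMul_mul, h i j T T' hij hT (pair_subset.2 ⟨hi, hj⟩),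
    h j l T T' hjl hT (pair_subset.2 ⟨hj, hl⟩), h l i T T' hli hT (pair_subset.2 ⟨hl, hi⟩),
    bdry_orientedSimplex_triple hij hjl hli]
  simp only [map_add]
  abel

lemma orientedSimplex_triple_mem {i j l : V} (hij : i ≠ j) (hjl : j ≠ l) (hli : l ≠ i)
    {s : Finset V} (hs : {i, j, l} ⊆ s) : orientedSimplex [i, j, l] ∈ chains {σ | σ ⊆ s} 3 :=
  orientedSimplex_mem_chains (by simpa using hs) (by simp [hij, hjl, hli.symm])

lemma IsPotential.relationA {R : Facet K n → Facet K n → Prop} (h : IsPotential R Φ ρ)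
    {ω : (Finset V →₀ ℤ) →ₗ[ℤ] Additive M}
    (hω : ∀ (T : Facet K n), ∀ x ∈ chains {s | s ⊆ T.1} 3, ω x = Φ T (bdry x)) {i j l : V}
    (hij : i ≠ j) (hjl : j ≠ l) (hli : l ≠ i) {T T' : Facet K n} (hT : R T T')
    (hs : {i, j, l} ⊆ T.1 ∩ T'.1) : ρ i j T T' * ρ j l T T' * ρ l i T T' = 1 := by
  apply Additive.ofMul.injective
  rw [h.triple hij hjl hli hT hs, ← hω T, ← hω T', sub_self]
  · rfl
  · exact orientedSimplex_triple_mem hij hjl hli (hs.trans Finset.inter_subset_right)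
  · exact orientedSimplex_triple_mem hij hjl hli (hs.trans Finset.inter_subset_left)

/-- Quantities satisfying the relations B have a potential. -/
theorem exists_isPotential (hK : IsHomologyManifold K n) (hn : 2 ≤ n)
    {ρ : V → V → Facet K n → Facet K n → M} (hρ : IsRhoData ρ) (hB : RelationB ρ) :
    ∃ Φ, IsPotential Adj Φ ρ := by
  have hφ : ∀ i j : V, ∃ φ : Facet K n → Additive M, i ≠ j → {i, j} ∈ K.faces →
      ∀ T T', StarAdj {i, j} T T' → Additive.ofMul (ρ i j T T') = φ T - φ T' := by
    intro i j
    by_cases hij : i ≠ j ∧ {i, j} ∈ K.faces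
    · obtain ⟨φ, h⟩ := exists_star_potential hK (ρ i j) hij.2
        (by rw [Finset.card_pair hij.1]; exact hn)
        (fun T T' h => (hρ i j T T' hij.1 h.1 (Finset.subset_inter h.2.1 h.2.2)).1)
        (fun t ht hst hc c hcell => hB t ht hc c hcell i (hst (by simp)) j (hst (by simp)) hij.1)
      exact ⟨φ, fun _ _ => h⟩
    · exact ⟨0, fun h h' => absurd ⟨h, h'⟩ hij⟩
  choose φ hφ using hφ
  let Φ : Facet K n → (Finset V →₀ ℤ) →ₗ[ℤ] Additive M := fun T =>
    linearCombination ℤ fun σ => if h : σ.Nonempty then φ (σ.min' h) (σ.max' h) T else 0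
  have hΦ : ∀ T i j, i < j → Φ T (orientedSimplex [i, j]) = φ i j T := by
    intro T i j hij
    rw [orientedSimplex_pair_of_lt hij]
    have h1 : ({i, j} : Finset V).min' (by simp) = i := by
      rw [Finset.min'_insert i {j} (by simp), Finset.min'_singleton, min_eq_left hij.le]
    have h2 : ({i, j} : Finset V).max' (by simp) = j := by
      rw [Finset.max'_insert i {j} (by simp), Finset.max'_singleton, max_eq_right hij.le]
    simp only [Φ, linearCombination_single, one_smul]
    rw [dif_pos (by simp), h1, h2]
  refine ⟨Φ, fun i j T T' hij hT hs => ?_⟩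
  have hf : {i, j} ∈ K.faces := T.mem_faces_of_subset (hs.trans Finset.inter_subset_left) (by simp)
  have hstar : StarAdj {i, j} T T' :=
    ⟨hT, hs.trans Finset.inter_subset_left, hs.trans Finset.inter_subset_right⟩
  rcases lt_or_gt_of_ne hij with h | h
  · rw [hΦ T i j h, hΦ T' i j h, hφ i j hij hf T T' hstar]
  · rw [← (hρ i j T T' hij hT hs).2, orientedSimplex_swap hij.symm, map_neg, map_neg, hΦ T j i h,
      hΦ T' j i h]
    rw [Finset.pair_comm] at hf hstar
    rw [hφ j i hij.symm hf T' T ⟨hstar.1.symm, hstar.2.2, hstar.2.1⟩]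
    abel

/-- By the relations A the coboundary of a potential does not depend on the framing. -/
theorem exists_common_coboundary (hK : IsHomologyManifold K n) (h : IsPotential Adj Φ ρ)
    (hA : RelationA ρ) : ∃ ω : (Finset V →₀ ℤ) →ₗ[ℤ] Additive M,
      ∀ (T : Facet K n), ∀ x ∈ chains {s | s ⊆ T.1} 3, ω x = Φ T (bdry x) := by
  refine exists_common_cochain (c := 3) (fun T : Facet K n => {s | s ⊆ T.1})
    (fun T => Φ T ∘ₗ bdry) fun T T' σ hσ hσ' hc => ?_
  obtain ⟨i, j, l, hij, hil, hjl, rfl⟩ := Finset.card_eq_three.1 hc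
  have hf : {i, j, l} ∈ K.faces := T.mem_faces_of_subset hσ (by simp)
  obtain ⟨ε, hε⟩ : ∃ ε : ℤ, single {i, j, l} 1 = ε • orientedSimplex [i, j, l] := by
    refine ⟨listSign [i, j, l], ?_⟩
    rw [orientedSimplex, smul_single]
    rcases listSign_eq_or [i, j, l] with h | h <;> simp [h]
  refine star_const hK hf (f := fun T => (Φ T ∘ₗ bdry) (single {i, j, l} 1)) ?_ hσ hσ'
  intro S S' hSS'
  have hs := Finset.subset_inter hSS'.2.1 hSS'.2.2
  have := h.triple hij hjl hil.symm hSS'.1 hs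
  rw [hA i j l S S' hij hjl hil.symm hSS'.1 hs, ofMul_one, eq_comm, sub_eq_zero] at this
  simp only [LinearMap.comp_apply, hε, map_smul, this]

end Potentials

variable {k : Type*} [Field k] {κ τ : Type*} {γ : κ → FramedLoop K n} {a : τ → FramedLoop K n}
  {m : τ → ℕ}

lemma FramedLoop.eval_add (Φ : Facet K n → (Finset V →₀ ℤ) →ₗ[ℤ] Additive kˣ)
    (H : (Finset V →₀ ℤ) →ₗ[ℤ] Additive kˣ) (δ : FramedLoop K n) :
    δ.eval (fun T => Φ T + H) = δ.eval Φ + H δ.chain := by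
  simp only [FramedLoop.eval, FramedEdge.eval, FramedLoop.chain, map_sum, LinearMap.add_apply,
    Finset.sum_add_distrib]
  rfl

lemma FramedLoop.eval_congr {A : Type*} [AddCommGroup A]
    {Φ Φ' : Facet K n → (Finset V →₀ ℤ) →ₗ[ℤ] A}
    (h : ∀ T, ∀ x ∈ chains {s | s ⊆ T.1} 2, Φ T x = Φ' T x) (δ : FramedLoop K n) :
    δ.eval Φ = δ.eval Φ' :=
  Finset.sum_congr rfl fun q _ => h _ _ (δ.edge q).chain_mem

lemma linearCombination_of_eq_mul {B : Type*} [AddCommGroup B] {q q' : τ →₀ ℤ}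
    (h : ∀ s, q s = q' s * m s) (v : τ → B) :
    linearCombination ℤ v q = linearCombination ℤ (fun s => m s • v s) q' := by
  rw [linearCombination_apply, linearCombination_apply,
    Finsupp.sum_of_support_subset q (s := q'.support) _ _ (by simp), Finsupp.sum]
  · refine Finset.sum_congr rfl fun s _ => ?_
    rw [h s, mul_smul, natCast_zsmul]
  · intro s hs
    rw [Finsupp.mem_support_iff] at hs ⊢
    intro h0
    exact hs (by rw [h s, h0, zero_mul])

/-- The realization theorem in terms of a potential `Φ` of the quantities `ρ` and of its coboundary
`ω`, which has to vanish on 2-cycles. The required correction of `Φ` by a 1-cochain `H` independent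
of the framing is prescribed on boundaries by `ω` and on the generators of the first homology by
`x` and `y`; the hypothesis `hu` makes these prescriptions compatible. -/
theorem exists_realizes (hbasis : IsH1Basis γ a m)
    {Φ : Facet K n → (Finset V →₀ ℤ) →ₗ[ℤ] Additive kˣ} {ρ : V → V → Facet K n → Facet K n → kˣ}
    (h : IsPotential Adj Φ ρ) {ω : (Finset V →₀ ℤ) →ₗ[ℤ] Additive kˣ}
    (hω : ∀ (T : Facet K n), ∀ x ∈ chains {s | s ⊆ T.1} 3, ω x = Φ T (bdry x))
    (hω0 : ∀ z ∈ cycles K.faces 3, ω z = 0) (x : κ → kˣ) (y : τ → kˣ)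
    (hu : ∀ s, ∃ c ∈ chains K.faces 3, bdry c = m s • (a s).chain ∧
      m s • Additive.ofMul (y s) = m s • (a s).eval Φ - ω c) :
    ∃ b : Connection K n k, Realizes γ a b ρ x y := by
  choose c hc hcb hcy using hu
  let f₁ : (κ →₀ ℤ) →ₗ[ℤ] (Finset V →₀ ℤ) := linearCombination ℤ fun q => (γ q).chain
  let f₂ : (τ →₀ ℤ) →ₗ[ℤ] (Finset V →₀ ℤ) := linearCombination ℤ fun s => (a s).chain
  let f : chains K.faces 3 × (κ →₀ ℤ) × (τ →₀ ℤ) →ₗ[ℤ] (Finset V →₀ ℤ) :=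
    (bdry ∘ₗ (chains K.faces 3).subtype).coprod (f₁.coprod f₂)
  let ψ₁ : (κ →₀ ℤ) →ₗ[ℤ] Additive kˣ :=
    linearCombination ℤ fun q => Additive.ofMul (x q) - (γ q).eval Φ
  let ψ₂ : (τ →₀ ℤ) →ₗ[ℤ] Additive kˣ :=
    linearCombination ℤ fun s => Additive.ofMul (y s) - (a s).eval Φ
  let Ψ : chains K.faces 3 × (κ →₀ ℤ) × (τ →₀ ℤ) →ₗ[ℤ] Additive kˣ :=
    (-(ω ∘ₗ (chains K.faces 3).subtype)).coprod (ψ₁.coprod ψ₂)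
  have hbc : ∀ d ∈ chains K.faces 3, bdry d ∈ cycles K.faces 2 := fun d hd =>
    ⟨bdry_mem_chains_faces hd, bdry_bdry d⟩
  have hlc : ∀ {ι : Type _} (g : ι → FramedLoop K n) (p : ι →₀ ℤ),
      linearCombination ℤ (fun q => (g q).chain) p ∈ cycles K.faces 2 := fun g p =>
    Submodule.sum_mem _ fun q _ => Submodule.smul_mem _ _ (g q).chain_mem
  have hlc' : ∀ p : τ →₀ ℤ, f₂ p ∈ cycles K.faces 2 := fun p =>
    Submodule.sum_mem _ fun q _ => Submodule.smul_mem _ _ (a q).chain_mem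
  obtain ⟨π, hπ⟩ := exists_retraction_two K.faces
  obtain ⟨H, hH⟩ := exists_extension hπ f Ψ
    (fun w => Submodule.add_mem _ (hbc _ w.1.2) (Submodule.add_mem _ (hlc γ _) (hlc' _))) (by
      intro z hz
      obtain ⟨p, q, d, hd, hdz⟩ := hbasis.span z hz
      refine ⟨(⟨d, hd⟩, p, q), ?_⟩
      change bdry d + (f₁ p + f₂ q) = z
      rw [hdz, sub_add_cancel]) (by
      rintro ⟨⟨d, hd⟩, p, q⟩ hw
      change bdry d + (f₁ p + f₂ q) = 0 at hw
      change -(ω d) + (ψ₁ p + ψ₂ q) = 0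
      have hmem : f₁ p + f₂ q ∈ boundaries K.faces 2 :=
        ⟨-d, Submodule.neg_mem _ hd, by rw [map_neg, eq_comm, eq_neg_iff_add_eq_zero, add_comm, hw]⟩
      obtain ⟨rfl, hdvd⟩ := (hbasis.indep p q).1 hmem
      -- the torsion part is an integral combination of the relations `m s • a s = ∂ (c s)`
      let q' : τ →₀ ℤ := onFinset q.support (fun s => q s / m s) fun s hs => by
        rw [Finsupp.mem_support_iff]
        intro h0
        simp [h0] at hs
      have hq' : ∀ s, q s = q' s * m s := fun s => (Int.ediv_mul_cancel (hdvd s)).symm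
      let e := linearCombination ℤ c q'
      have he : e ∈ chains K.faces 3 := Submodule.sum_mem _ fun s _ => Submodule.smul_mem _ _ (hc s)
      have h2 : f₂ q = bdry e := by
        rw [apply_linearCombination]
        refine (linearCombination_of_eq_mul hq' _).trans (congrFun (congrArg _ ?_) q')
        exact congrArg _ (funext fun s => (hcb s).symm)
      have h3 : ψ₂ q = -(ω e) := by
        rw [← LinearMap.neg_apply, apply_linearCombination]
        refine (linearCombination_of_eq_mul hq' _).trans (congrFun (congrArg _ ?_) q')
        refine congrArg _ (funext fun s => ?_)
        rw [nsmul_sub, hcy, Function.comp_apply, LinearMap.neg_apply]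
        abel
      have h4 := hω0 (d + e) ⟨Submodule.add_mem _ hd he, by
        change bdry (d + e) = 0
        rw [map_add, ← h2, ← hw, map_zero, zero_add]⟩
      rw [h3, map_zero, zero_add, ← neg_add, ← map_add, h4, neg_zero])
  obtain ⟨b, hb⟩ := exists_connCochain_eq (fun T => Φ T + H) (by
    intro T d hd
    have := hH (⟨d, T.chains_le _ hd⟩, 0, 0)
    simp only [f, Ψ, LinearMap.coprod_apply, map_zero, add_zero, LinearMap.comp_apply,
      Submodule.subtype_apply, LinearMap.neg_apply] at this
    rw [LinearMap.add_apply, this, ← hω T d hd, add_neg_cancel])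
  refine ⟨b, fun i j T T' hij hT hs => ?_, fun q => ?_, fun s => ?_⟩
  · apply Additive.ofMul.injective
    have hmem : ∀ T : Facet K n, {i, j} ⊆ T.1 →
        orientedSimplex [i, j] ∈ chains {s | s ⊆ T.1} 2 := fun T hT =>
      orientedSimplex_mem_chains (by simpa using hT) (by simpa using hij)
    rw [isPotential_connCochain b i j T T' hij trivial hs,
      hb T _ (hmem T (hs.trans Finset.inter_subset_left)),
      hb T' _ (hmem T' (hs.trans Finset.inter_subset_right)), h i j T T' hij hT hs,
      LinearMap.add_apply, LinearMap.add_apply, add_sub_add_right_eq_sub]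
  · apply Additive.ofMul.injective
    have := hH (0, single q 1, 0)
    simp only [f, Ψ, f₁, ψ₁, LinearMap.coprod_apply, map_zero, add_zero, zero_add,
      linearCombination_single, one_smul] at this
    rw [ofMul_holonomy, FramedLoop.eval_congr hb, FramedLoop.eval_add, this, add_sub_cancel]
  · apply Additive.ofMul.injective
    have := hH (0, 0, single s 1)
    simp only [f, Ψ, f₂, ψ₂, LinearMap.coprod_apply, map_zero, zero_add,
      linearCombination_single, one_smul] at this
    rw [ofMul_holonomy, FramedLoop.eval_congr hb, FramedLoop.eval_add, this, add_sub_cancel]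

/-- The framed product of a framed 2-cycle, in terms of the coboundary of a potential. -/
lemma FramedCycle.ofMul_prod {M : Type*} [CommGroup M] (z : FramedCycle K n)
    {Φ : Facet K n → (Finset V →₀ ℤ) →ₗ[ℤ] Additive M} {ρ : V → V → Facet K n → Facet K n → M}
    (h : IsPotential (fun _ _ => True) Φ ρ) {ω : (Finset V →₀ ℤ) →ₗ[ℤ] Additive M}
    (hω : ∀ (T : Facet K n), ∀ x ∈ chains {s | s ⊆ T.1} 3, ω x = Φ T (bdry x)) :
    Additive.ofMul (z.prod ρ) = -ω z.chain := by
  rw [FramedChain.ofMul_prod_eq z h hω, Finset.univ_eq_empty, Finset.sum_empty, zero_sub]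

/-- The framed product of a framed 2-chain bounded by a multiple of a closed framed path. -/
lemma FramedChain.ofMul_prod_times {M : Type*} [CommGroup M] {δ : FramedLoop K n} {r : ℕ}
    (u : FramedChain K n (δ.times r))
    {Φ : Facet K n → (Finset V →₀ ℤ) →ₗ[ℤ] Additive M} {ρ : V → V → Facet K n → Facet K n → M}
    (h : IsPotential (fun _ _ => True) Φ ρ) {ω : (Finset V →₀ ℤ) →ₗ[ℤ] Additive M}
    (hω : ∀ (T : Facet K n), ∀ x ∈ chains {s | s ⊆ T.1} 3, ω x = Φ T (bdry x)) :
    Additive.ofMul (u.prod ρ) = r • δ.eval Φ - ω u.chain := by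
  rw [u.ofMul_prod_eq h hω, FramedLoop.sum_times_eval]

lemma connCochain_coboundary (b : Connection K n k) (T : Facet K n) :
    ∀ x ∈ chains {s | s ⊆ T.1} 3,
      (0 : (Finset V →₀ ℤ) →ₗ[ℤ] Additive kˣ) x = connCochain b T (bdry x) := by
  simp [connCochain_bdry]

lemma FramedCycle.prod_rho (b : Connection K n k) (z : FramedCycle K n) : z.prod (rho b) = 1 := by
  apply Additive.ofMul.injective
  rw [FramedCycle.ofMul_prod z (isPotential_connCochain b) (connCochain_coboundary b)]
  simp

lemma FramedChain.prod_rho_times (b : Connection K n k) {δ : FramedLoop K n} {r : ℕ}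
    (u : FramedChain K n (δ.times r)) : u.prod (rho b) = holonomy b δ ^ r := by
  apply Additive.ofMul.injective
  rw [u.ofMul_prod_times (isPotential_connCochain b) (connCochain_coboundary b), ofMul_pow,
    ofMul_holonomy, LinearMap.zero_apply, sub_zero]

/-- The coboundary `ω` vanishes on boundaries, since every 3-simplex lies in an `n`-simplex. -/
lemma coboundary_bdry {A : Type*} [AddCommGroup A] (hK : IsHomologyManifold K n)
    {Φ : Facet K n → (Finset V →₀ ℤ) →ₗ[ℤ] A} {ω : (Finset V →₀ ℤ) →ₗ[ℤ] A}
    (hω : ∀ (T : Facet K n), ∀ x ∈ chains {s | s ⊆ T.1} 3, ω x = Φ T (bdry x)) :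
    ∀ z ∈ boundaries K.faces 3, ω z = 0 := by
  rintro _ ⟨x, hx, rfl⟩
  refine eqOn_chains (f := ω ∘ₗ bdry) (g := 0) (fun σ hσ hσc => ?_) hx
  obtain ⟨T, hT⟩ := exists_facet_subset hK hσ
  rw [LinearMap.comp_apply, hω T, bdry_bdry, map_zero, LinearMap.zero_apply]
  exact bdry_mem_chains (L := {s | s ⊆ T.1})
    (fun ρ hρ _ w _ => (Finset.erase_subset _ _).trans hρ) (single_mem_chains hT hσc _)

/-- Realization of quantities satisfying all relations. -/
theorem exists_realizes_of_relations (hK : IsHomologyManifold K n) (hn : 2 ≤ n)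
    (hbasis : IsH1Basis γ a m) {P : V → V → Facet K n → Facet K n → List (Facet K n)}
    (hP : IsPathSystem P) {ι : Type*} {z : ι → FramedCycle K n} (hz : GeneratesH2 z)
    (u : ∀ s, FramedChain K n ((a s).times (m s))) {ρ : V → V → Facet K n → Facet K n → kˣ}
    (x : κ → kˣ) (y : τ → kˣ) (hρ : IsRhoData ρ) (hA : RelationA ρ) (hB : RelationB ρ)
    (hz1 : ∀ q, (z q).prod (extend P ρ) = 1)
    (hu : ∀ s, (u s).prod (extend P ρ) = y s ^ m s) :
    ∃ b : Connection K n k, Realizes γ a b ρ x y := by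
  obtain ⟨Φ, hΦ⟩ := exists_isPotential hK hn hρ hB
  obtain ⟨ω, hω⟩ := exists_common_coboundary hK hΦ hA
  have hΦ' := hΦ.extend hP
  refine exists_realizes hbasis hΦ hω (fun c hc => ?_) x y fun s =>
    ⟨(u s).chain, (u s).chain_mem, ?_, ?_⟩
  · obtain ⟨p, hp⟩ := hz c hc
    have h1 := coboundary_bdry hK hω _ hp
    rw [map_sub, sub_eq_zero, apply_linearCombination] at h1
    rw [h1, linearCombination_apply]
    refine Finset.sum_eq_zero fun q _ => ?_
    have h2 := FramedCycle.ofMul_prod (z q) hΦ' hω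
    rw [hz1 q, ofMul_one, zero_eq_neg] at h2
    simp only [Function.comp_apply, h2, smul_zero]
  · rw [FramedChain.bdry_chain, FramedLoop.sum_times_chain]
  · rw [← ofMul_pow, ← hu s, (u s).ofMul_prod_times hΦ' hω]

/-- A connection is determined up to gauge transformations by its invariants. -/
theorem gaugeEquiv_of_invariants (hK : IsHomologyManifold K n) (hbasis : IsH1Basis γ a m)
    {b b' : Connection K n k}
    (hρ : ∀ (i j : V) (T T' : Facet K n), i ≠ j → Adj T T' → {i, j} ⊆ T.1 ∩ T'.1 →
      rho b i j T T' = rho b' i j T T')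
    (hγ : ∀ q, holonomy b (γ q) = holonomy b' (γ q))
    (ha : ∀ s, holonomy b (a s) = holonomy b' (a s)) : GaugeEquiv b b' := by
  -- the difference `H` of the 1-cochains of the connections does not depend on the framing
  obtain ⟨H, hH⟩ := exists_common_cochain (c := 2) (fun T : Facet K n => {s | s ⊆ T.1})
    (fun T => connCochain b' T - connCochain b T) (by
      intro T T' σ hσ hσ' hc
      obtain ⟨i, j, hij, rfl⟩ := Finset.card_eq_two.1 hc
      wlog h : i < j generalizing i j
      · rw [Finset.pair_comm] at hσ hσ' hc ⊢
        exact this j i hij.symm hσ hσ' hc (lt_of_le_of_ne (not_lt.1 h) hij.symm)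
      rw [← orientedSimplex_pair_of_lt h]
      refine star_const hK (T.mem_faces_of_subset hσ (by simp))
        (f := fun T => (connCochain b' T - connCochain b T) (orientedSimplex [i, j])) ?_ hσ hσ'
      intro S S' hS
      have h1 := ((isPotential_connCochain b).mono (R' := Adj) fun _ _ _ => trivial).starAdj hij hS
      have h2 := ((isPotential_connCochain b').mono (R' := Adj) fun _ _ _ => trivial).starAdj hij hS
      rw [← hρ i j S S' hij hS.1 (Finset.subset_inter hS.2.1 hS.2.2), h1] at h2
      simp only [LinearMap.sub_apply]
      rw [sub_eq_sub_iff_add_eq_add] at h2 ⊢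
      rw [← h2, add_comm])
  have hloop : ∀ δ : FramedLoop K n, holonomy b δ = holonomy b' δ → H δ.chain = 0 := by
    intro δ hδ
    have h1 : H δ.chain = δ.eval (connCochain b') - δ.eval (connCochain b) := by
      simp only [FramedLoop.eval, FramedEdge.eval]
      rw [← Finset.sum_sub_distrib, FramedLoop.chain, map_sum]
      exact Finset.sum_congr rfl fun q _ => hH _ _ (δ.edge q).chain_mem
    rw [h1, ← ofMul_holonomy, ← ofMul_holonomy, hδ, sub_self]
  have hbd : ∀ x ∈ chains K.faces 3, H (bdry x) = 0 := by
    intro x hx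
    refine eqOn_chains (f := H ∘ₗ bdry) (g := 0) (fun σ hσ hσc => ?_) hx
    obtain ⟨T, hT⟩ := exists_facet_subset hK hσ
    rw [LinearMap.comp_apply, hH T, LinearMap.sub_apply, connCochain_bdry, connCochain_bdry,
      sub_zero, LinearMap.zero_apply]
    exact bdry_mem_chains (L := {s | s ⊆ T.1})
      (fun ρ hρ _ w _ => (Finset.erase_subset _ _).trans hρ) (single_mem_chains hT hσc _)
  obtain ⟨g, hg⟩ := exists_eq_comp_bdry K.faces H fun c hc => by
    obtain ⟨p, q, d, hd, hdc⟩ := hbasis.span c hc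
    have h1 := hbd d hd
    rw [hdc, map_sub, sub_eq_zero, map_add, apply_linearCombination, apply_linearCombination] at h1
    rw [h1, linearCombination_apply, linearCombination_apply, Finsupp.sum, Finsupp.sum,
      Finset.sum_eq_zero, Finset.sum_eq_zero, add_zero]
    · exact fun s _ => by simp only [Function.comp_apply, hloop _ (ha s), smul_zero]
    · exact fun s _ => by simp only [Function.comp_apply, hloop _ (hγ s), smul_zero]
  refine gaugeEquiv_of_sub_eq g fun T i hi j hj hij => ?_
  have hs : [i, j].toFinset ⊆ T.1 := by simpa using pair_subset.2 ⟨hi, hj⟩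
  have hnd : [i, j].Nodup := by simpa using hij
  rw [← hg _ (orientedSimplex_mem_chains (T.mem_faces_of_subset hs (by simp)) hnd),
    hH T _ (orientedSimplex_mem_chains (L := {s | s ⊆ T.1}) hs hnd), LinearMap.sub_apply]

lemma mu_of_gauge {b b' : Connection K n k} {f : Facet K n → kˣ} {g : V → kˣ}
    (h : ∀ T : Facet K n, ∀ i ∈ T.1, b' T i = f T * b T i * (g i)⁻¹) {T : Facet K n} {i j : V}
    (hi : i ∈ T.1) (hj : j ∈ T.1) : mu b' T i j = mu b T i j * (g j / g i) := by
  by_cases hij : i = j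
  · simp [mu, hij]
  · have comm : ∀ p q r s t : kˣ, p * q * r⁻¹ / (p * s * t⁻¹) = q / s * (t / r) :=
      fun p q r s t => by
        apply Additive.ofMul.injective
        simp only [ofMul_mul, ofMul_div, ofMul_inv]
        abel
    rw [mu, mu, if_neg hij, if_neg hij, h T i hi, h T j hj, comm, neg_mul]

lemma rho_of_gaugeEquiv {b b' : Connection K n k} (h : GaugeEquiv b b') {i j : V}
    {T T' : Facet K n} (hs : {i, j} ⊆ T.1 ∩ T'.1) : rho b i j T T' = rho b' i j T T' := by
  obtain ⟨f, g, h⟩ := h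
  obtain ⟨hi, hj⟩ := pair_subset.1 hs
  rw [Finset.mem_inter] at hi hj
  rw [rho, rho, mu_of_gauge h hi.1 hj.1, mu_of_gauge h hj.2 hi.2, mul_mul_mul_comm,
    div_mul_div_cancel, div_self', mul_one]

lemma holonomy_of_gaugeEquiv {b b' : Connection K n k} (h : GaugeEquiv b b') (δ : FramedLoop K n) :
    holonomy b δ = holonomy b' δ := by
  obtain ⟨f, g, h⟩ := h
  have h1 : ∏ q, g (δ.edge q).tgt = ∏ q, g (δ.edge q).src := by
    simp only [δ.closed]
    exact Equiv.prod_comp (finRotate δ.len) fun q => g (δ.edge q).src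
  rw [holonomy, holonomy]
  simp only [mu_of_gauge h (δ.edge _).src_mem (δ.edge _).tgt_mem, ← neg_mul]
  rw [Finset.prod_mul_distrib, Finset.prod_div_distrib, h1, div_self', mul_one]

/-- All relations are necessary. -/
theorem Realizes.relations {b : Connection K n k} {ρ : V → V → Facet K n → Facet K n → kˣ}
    {x : κ → kˣ} {y : τ → kˣ} (hb : Realizes γ a b ρ x y)
    {P : V → V → Facet K n → Facet K n → List (Facet K n)} (hP : IsPathSystem P)
    (u : ∀ s, FramedChain K n ((a s).times (m s))) :
    IsRhoData ρ ∧ RelationA ρ ∧ RelationB ρ ∧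
      (∀ z : FramedCycle K n, z.prod (extend P ρ) = 1) ∧
      ∀ s, (u s).prod (extend P ρ) = y s ^ m s := by
  have hΦ : IsPotential Adj (connCochain b) ρ := by
    intro i j T T' hij hT hs
    rw [← hb.1 i j T T' hij hT hs]
    exact isPotential_connCochain b i j T T' hij trivial hs
  have hΦ' := hΦ.extend hP
  have hω := connCochain_coboundary b
  refine ⟨hΦ.isRhoData, fun i j l T T' hij hjl hli hT hs => hΦ.relationA hω hij hjl hli hT hs,
    hΦ.relationB, fun z => ?_, fun s => ?_⟩
  · apply Additive.ofMul.injective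
    rw [FramedCycle.ofMul_prod z hΦ' hω]
    simp
  · apply Additive.ofMul.injective
    rw [(u s).ofMul_prod_times hΦ' hω, ← hb.2.2 s, ofMul_pow, ofMul_holonomy, LinearMap.zero_apply,
      sub_zero]

end Realization

/-! ### Orientations and connectedness -/

section Orientation

variable {V : Type*} [LinearOrder V] {K : AbstractSimplicialComplex V} {n : ℕ}

/-- A connected homology manifold is strongly connected. -/
lemma Facet.adj_connected (hK : IsHomologyManifold K n) (hn : 1 ≤ n) (hconn : IsConnected K)
    (T T' : Facet K n) : Relation.ReflTransGen Adj T T' := by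
  have hv : ∀ S : Facet K n, ∃ v, v ∈ S.1 := fun S => Finset.card_pos.1 (by rw [S.2.2]; omega)
  have key : ∀ {v : V} {S S' : Facet K n}, v ∈ S.1 → v ∈ S'.1 → Relation.ReflTransGen Adj S S' := by
    intro v S S' hS hS'
    exact Relation.ReflTransGen.mono (r := StarAdj {v}) (fun _ _ h => h.1) _ _
      (star_connected hK (K.singleton_mem v) (by simpa using hS) (by simpa using hS'))
  obtain ⟨v, hvT⟩ := hv T
  obtain ⟨w, hw⟩ := hv T'
  have : ∀ w, Relation.ReflTransGen (fun x y => ({x, y} : Finset V) ∈ K.faces) v w →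
      ∀ S : Facet K n, w ∈ S.1 → Relation.ReflTransGen Adj T S := by
    intro w h
    induction h with
    | refl => exact fun S hS => key hvT hS
    | @tail x y _ hxy ih =>
      intro S hS
      obtain ⟨S', hS'⟩ := exists_facet_subset hK hxy
      obtain ⟨hx, hy⟩ := pair_subset.1 hS'
      exact (ih S' hx).trans (key hy hS)
  exact this w (hconn v w) T' hw

lemma finite_simplices (hfin : K.faces.Finite) (c : ℕ) : Finite (Simplices K c) :=
  (hfin.subset fun _ h => h.1 : {s | s ∈ K.faces ∧ s.card = c}.Finite)

/-- A linear map on chains as a sum over the simplices. -/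
lemma map_eq_sum_simplices {A : Type*} [AddCommGroup A] {c : ℕ} [Fintype (Simplices K c)]
    (f : (Finset V →₀ ℤ) →ₗ[ℤ] A) {x : Finset V →₀ ℤ} (hx : x ∈ chains K.faces c) :
    f x = ∑ s : Simplices K c, x s.1 • f (single s.1 1) := by
  classical
  have := eqOn_chains (f := f)
    (g := ∑ s : Simplices K c, (lapply (R := ℤ) s.1).smulRight (f (single s.1 1)))
    (fun s hs hc => by
      rw [LinearMap.sum_apply, Finset.sum_eq_single_of_mem ⟨s, hs, hc⟩ (Finset.mem_univ _)]
      · simp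
      · intro t _ ht
        have : s ≠ t.1 := fun h => ht (Subtype.ext h.symm)
        simp [this]) hx
  rw [this, LinearMap.sum_apply]
  rfl

lemma Induces.bdry_apply {o : Facet K n → ℤ} {T : Facet K n} {f : List V} (h : Induces o T f) :
    o T * bdry (single T.1 1) f.toFinset = listSign f := by
  obtain ⟨v, hnd, hT, ho⟩ := h
  rw [List.nodup_cons] at hnd
  rw [List.toFinset_cons] at hT
  rw [← hT, bdry_single_insert_apply (by simpa using hnd.1), ho, listSign_cons hnd.1 hnd.2, one_mul,
    mul_right_comm, posSign_mul_self, one_mul]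

lemma IsOrientation.mul_self {o : Facet K n → ℤ} (ho : IsOrientation o) (T : Facet K n) :
    o T * o T = 1 := by
  rcases ho.1 T with h | h <;> rw [h] <;> rfl

end Orientation

/-! ### Oriented surfaces -/

section Surface

variable {V : Type*} [LinearOrder V] {K : AbstractSimplicialComplex V}

variable {o : Facet K 2 → ℤ}

lemma EdgeSides.adj {e : Simplices K 2} (S : EdgeSides o e.1) : Adj S.T S.T' := by
  rw [Adj, S.inter, e.2.2]

lemma EdgeSides.toFinset {e : Finset V} (S : EdgeSides o e) : [S.i, S.j].toFinset = e := by
  simp [S.eq]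

lemma EdgeSides.toFinset' {e : Finset V} (S : EdgeSides o e) : [S.j, S.i].toFinset = e := by
  simp [S.eq, Finset.pair_comm]

lemma EdgeSides.eq_or (hK : IsHomologyManifold K 2) {e : Simplices K 2} (S : EdgeSides o e.1)
    {T : Facet K 2} (hT : e.1 ⊆ T.1) : T = S.T ∨ T = S.T' := by
  have h1 : e.1 ⊆ S.T.1 := S.inter.symm.subset.trans Finset.inter_subset_left
  have h2 : e.1 ⊆ S.T'.1 := S.inter.symm.subset.trans Finset.inter_subset_right
  obtain ⟨T', -, -, hall⟩ := exists_other_facet hK e.2.2 h1 (nonempty_of_mem_faces e.2.1)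
  have h3 := (hall S.T' h2).resolve_left S.adj.ne.symm
  rw [h3]
  exact hall T hT

/-- The coefficients of the boundary of a 2-chain on an oriented surface. -/
lemma EdgeSides.bdry_apply (hK : IsHomologyManifold K 2) (ho : IsOrientation o) {e : Simplices K 2}
    (S : EdgeSides o e.1) {u : Finset V →₀ ℤ} (hu : u ∈ chains K.faces 3) :
    bdry u e.1 = listSign [S.i, S.j] * (o S.T * u S.T.1 - o S.T' * u S.T'.1) := by
  classical
  have hne : S.T.1 ≠ S.T'.1 := fun h => S.adj.ne (Subtype.ext h)
  let g : (Finset V →₀ ℤ) →ₗ[ℤ] ℤ :=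
    listSign [S.i, S.j] • (o S.T • lapply S.T.1 - o S.T' • lapply S.T'.1)
  have h1 : bdry (single S.T.1 1) e.1 = o S.T * listSign [S.i, S.j] := by
    rw [← S.ind.bdry_apply, ← mul_assoc, ho.mul_self, one_mul, S.toFinset]
  have h2 : bdry (single S.T'.1 1) e.1 = -(o S.T' * listSign [S.i, S.j]) := by
    rw [← mul_neg, ← listSign_swap S.ne, ← S.ind'.bdry_apply, ← mul_assoc, ho.mul_self, one_mul,
      S.toFinset']
  refine eqOn_chains (f := lapply e.1 ∘ₗ bdry) (g := g) (fun s hs hc => ?_) hu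
  by_cases hes : e.1 ⊆ s
  · rcases S.eq_or hK (T := ⟨s, hs, hc⟩) hes with h | h
    · obtain rfl : s = S.T.1 := congrArg Subtype.val h
      simp [g, h1, hne, mul_comm]
    · obtain rfl : s = S.T'.1 := congrArg Subtype.val h
      simp [g, h2, hne.symm, mul_comm]
  · have h3 : s ≠ S.T.1 := by
      rintro rfl; exact hes (S.inter.symm.subset.trans Finset.inter_subset_left)
    have h4 : s ≠ S.T'.1 := by
      rintro rfl; exact hes (S.inter.symm.subset.trans Finset.inter_subset_right)
    simp [g, h3, h4, bdry_single_apply_of_not_subset hes]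

/-- A 2-chain whose boundary is divisible by `d` has congruent coefficients modulo `d` on all
coherently oriented triangles. -/
lemma dvd_sub_of_dvd_bdry (hK : IsHomologyManifold K 2) (hconn : IsConnected K)
    (ho : IsOrientation o) (E : ∀ e : Simplices K 2, EdgeSides o e.1) {d : ℤ}
    {u : Finset V →₀ ℤ} (hu : u ∈ chains K.faces 3) (hd : ∀ e : Simplices K 2, d ∣ bdry u e.1)
    (T T' : Facet K 2) : d ∣ o T * u T.1 - o T' * u T'.1 := by
  have key : ∀ S S' : Facet K 2, Adj S S' → d ∣ o S * u S.1 - o S' * u S'.1 := by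
    intro S S' hS
    let e : Simplices K 2 := ⟨S.1 ∩ S'.1,
      S.mem_faces_of_subset Finset.inter_subset_left (Finset.card_pos.1 (by rw [hS]; omega)), hS⟩
    have h := hd e
    rw [(E e).bdry_apply hK ho hu] at h
    have h' : d ∣ o (E e).T * u (E e).T.1 - o (E e).T' * u (E e).T'.1 := by
      rcases listSign_eq_or [(E e).i, (E e).j] with h1 | h1 <;> rw [h1] at h
      · rwa [one_mul] at h
      · rwa [neg_one_mul, dvd_neg] at h
    rcases (E e).eq_or hK (T := S) Finset.inter_subset_left with h1 | h1 <;>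
      rcases (E e).eq_or hK (T := S') Finset.inter_subset_right with h2 | h2
    · exact absurd (h1.trans h2.symm) hS.ne
    · rw [h1, h2]; exact h'
    · rw [h1, h2, ← neg_sub, dvd_neg]; exact h'
    · exact absurd (h1.trans h2.symm) hS.ne
  induction Facet.adj_connected hK (by omega) hconn T T' with
  | refl => simp
  | tail _ h ih =>
    have := dvd_add ih (key _ _ h)
    rwa [sub_add_sub_cancel] at this

/-- The fundamental cycle of an oriented surface. -/
def fundamentalCycle (o : Facet K 2 → ℤ) [Fintype (Facet K 2)] : Finset V →₀ ℤ :=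
  ∑ T : Facet K 2, single T.1 (o T)

variable {k : Type*} [Field k] {κ τ : Type*} {γ : κ → FramedLoop K 2} {a : τ → FramedLoop K 2}
  {m : τ → ℕ}

section

variable [Fintype (Facet K 2)]

lemma fundamentalCycle_apply (T : Facet K 2) : fundamentalCycle o T.1 = o T := by
  classical
  rw [fundamentalCycle, Finsupp.finsetSum_apply, Finset.sum_eq_single_of_mem T (Finset.mem_univ _)]
  · simp
  · intro T' _ h
    rw [single_apply, if_neg fun h' => h (Subtype.ext h')]

lemma fundamentalCycle_mem : fundamentalCycle o ∈ chains K.faces 3 :=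
  Submodule.sum_mem _ fun T _ => single_mem_chains T.2.1 T.2.2 _

lemma chains_ext {u v : Finset V →₀ ℤ} (hu : u ∈ chains K.faces 3) (hv : v ∈ chains K.faces 3)
    (h : ∀ T : Facet K 2, u T.1 = v T.1) : u = v := by
  ext s
  by_cases hs : s ∈ K.faces ∧ s.card = 3
  · exact h ⟨s, hs⟩
  · have : ∀ w ∈ chains K.faces 3, w s = 0 := fun w hw => by
      by_contra hne
      exact hs (hw (Finsupp.mem_support_iff.2 hne))
    rw [this u hu, this v hv]

lemma bdry_fundamentalCycle (hK : IsHomologyManifold K 2) (ho : IsOrientation o)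
    (E : ∀ e : Simplices K 2, EdgeSides o e.1) : bdry (fundamentalCycle o) = 0 := by
  ext e
  by_cases he : e ∈ K.faces ∧ e.card = 2
  · rw [(E ⟨e, he⟩).bdry_apply hK ho fundamentalCycle_mem, fundamentalCycle_apply,
      fundamentalCycle_apply, ho.mul_self, ho.mul_self, sub_self, mul_zero, Finsupp.zero_apply]
  · by_contra hne
    exact he (bdry_mem_chains_faces (c := 1) fundamentalCycle_mem (Finsupp.mem_support_iff.2 hne))

/-- On a connected oriented surface a 2-chain whose boundary is divisible by `d` is, modulo `d`, a
multiple of the fundamental cycle. -/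
lemma exists_eq_fundamentalCycle_add (hK : IsHomologyManifold K 2) (hconn : IsConnected K)
    (ho : IsOrientation o) (E : ∀ e : Simplices K 2, EdgeSides o e.1) {d : ℤ}
    {u : Finset V →₀ ℤ} (hu : u ∈ chains K.faces 3) (hd : ∀ e : Simplices K 2, d ∣ bdry u e.1) :
    ∃ c : ℤ, ∃ u' ∈ chains K.faces 3, u = c • fundamentalCycle o + d • u' := by
  rcases isEmpty_or_nonempty (Facet K 2) with h | ⟨⟨T₀⟩⟩
  · refine ⟨0, 0, Submodule.zero_mem _, chains_ext hu ?_ fun T => h.elim T⟩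
    simp
  · have h : ∀ T : Facet K 2, d ∣ u T.1 - o T₀ * u T₀.1 * o T := by
      intro T
      have := (dvd_sub_of_dvd_bdry hK hconn ho E hu hd T T₀).mul_left (o T)
      rwa [mul_sub, ← mul_assoc, ho.mul_self, one_mul, mul_comm (o T)] at this
    choose q hq using h
    refine ⟨o T₀ * u T₀.1, ∑ T : Facet K 2, single T.1 (q T),
      Submodule.sum_mem _ fun T _ => single_mem_chains T.2.1 T.2.2 _, chains_ext hu
        (Submodule.add_mem _ (Submodule.smul_mem _ _ fundamentalCycle_mem)
          (Submodule.smul_mem _ _ (Submodule.sum_mem _ fun T _ =>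
            single_mem_chains T.2.1 T.2.2 _))) fun T => ?_⟩
    have := fundamentalCycle_apply (o := q) T
    rw [fundamentalCycle] at this
    rw [Finsupp.add_apply, Finsupp.smul_apply, Finsupp.smul_apply, this, fundamentalCycle_apply,
      smul_eq_mul, smul_eq_mul, ← hq T]
    ring

/-- The first homology of an oriented surface is torsion free. -/
lemma isEmpty_torsion (hK : IsHomologyManifold K 2) (hconn : IsConnected K)
    (ho : IsOrientation o) (E : ∀ e : Simplices K 2, EdgeSides o e.1) (hbasis : IsH1Basis γ a m) :
    IsEmpty τ := by
  refine ⟨fun s => ?_⟩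
  obtain ⟨u, hu, hua⟩ := (hbasis.indep 0 (single s (m s : ℤ))).2 ⟨rfl, fun t => by
    classical
    rw [single_apply]
    split_ifs with h
    · rw [h]
    · exact dvd_zero _⟩
  rw [map_zero, zero_add, linearCombination_single] at hua
  obtain ⟨c, u', hu', huc⟩ := exists_eq_fundamentalCycle_add hK hconn ho E (d := m s) hu
    fun e => by rw [hua]; exact ⟨(a s).chain e.1, rfl⟩
  -- modulo a multiple of the fundamental cycle the chain bounded by `m s • a s` is divisible by
  -- `m s`, so that `a s` itself is a boundary
  have h1 : (m s : ℤ) • bdry u' = (m s : ℤ) • (a s).chain := by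
    rw [← hua, huc, map_add, map_smul, map_smul, bdry_fundamentalCycle hK ho E, smul_zero, zero_add]
  have hm := hbasis.two_le s
  have h2 : bdry u' = (a s).chain := smul_right_injective _ (by omega : (m s : ℤ) ≠ 0) h1
  have h3 := ((hbasis.indep 0 (single s 1)).1 ⟨u', hu', by
    rw [map_zero, zero_add, linearCombination_single, one_smul, h2]⟩).2 s
  rw [single_eq_same] at h3
  have := Int.eq_one_of_dvd_one (by omega) h3
  omega

/-- The product of the quantities over all edges, as a sum over the coherently oriented triangles of
the coboundary of a potential. -/
lemma sum_edgeSides_eq (hK : IsHomologyManifold K 2) [Fintype (Simplices K 2)]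
    (E : ∀ e : Simplices K 2, EdgeSides o e.1) {M : Type*} [CommGroup M]
    {Φ : Facet K 2 → (Finset V →₀ ℤ) →ₗ[ℤ] Additive M} {ρ : V → V → Facet K 2 → Facet K 2 → M}
    (h : IsPotential Adj Φ ρ) :
    Additive.ofMul (∏ e, ρ (E e).i (E e).j (E e).T (E e).T') =
      ∑ T : Facet K 2, o T • Φ T (bdry (single T.1 1)) := by
  classical
  have h1 : ∀ T : Facet K 2, o T • Φ T (bdry (single T.1 1)) =
      ∑ e : Simplices K 2, (o T * bdry (single T.1 1) e.1) • Φ T (single e.1 1) := by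
    intro T
    rw [map_eq_sum_simplices (Φ T) (bdry_mem_chains_faces (c := 1)
      (single_mem_chains T.2.1 T.2.2 1)), Finset.smul_sum]
    simp only [mul_smul]
  simp only [h1]
  rw [Finset.sum_comm, ofMul_prod]
  refine Finset.sum_congr rfl fun e _ => ?_
  set S := E e
  have hos : ∀ (l : List V), l.toFinset = e.1 → ∀ T : Facet K 2,
      listSign l • Φ T (single e.1 1) = Φ T (orientedSimplex l) := by
    intro l hl T
    rw [orientedSimplex, hl, ← map_smul, smul_single, smul_eq_mul, mul_one]
  have hT : (o S.T * bdry (single S.T.1 1) e.1) = listSign [S.i, S.j] := by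
    rw [← S.ind.bdry_apply, S.toFinset]
  have hT' : (o S.T' * bdry (single S.T'.1 1) e.1) = listSign [S.j, S.i] := by
    rw [← S.ind'.bdry_apply, S.toFinset']
  rw [← Finset.sum_subset (Finset.subset_univ {S.T, S.T'}), Finset.sum_pair S.adj.ne, hT, hT',
    hos _ S.toFinset, hos _ S.toFinset', h _ _ _ _ S.ne S.adj (by rw [S.inter, ← S.eq]),
    orientedSimplex_swap S.ne, map_neg, sub_eq_add_neg]
  intro T _ hTS
  rw [bdry_single_apply_of_not_subset, mul_zero, zero_smul]
  intro hsub
  simp only [Finset.mem_insert, Finset.mem_singleton] at hTS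
  exact hTS (S.eq_or hK hsub)

end

/-- On a connected oriented surface there is only one relation. -/
theorem surface_realizes_iff (hK : IsHomologyManifold K 2) (hfin : K.faces.Finite)
    (hconn : IsConnected K) (ho : IsOrientation o) (E : ∀ e : Simplices K 2, EdgeSides o e.1)
    (hbasis : IsH1Basis γ a m) {ρ : V → V → Facet K 2 → Facet K 2 → kˣ} (x : κ → kˣ) (y : τ → kˣ)
    (hρ : IsRhoData ρ) :
    ∏ᶠ e, ρ (E e).i (E e).j (E e).T (E e).T' = 1 ↔
      ∃ b : Connection K 2 k, Realizes γ a b ρ x y := by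
  have := finite_simplices hfin 2
  have := Fintype.ofFinite (Simplices K 2)
  have := finite_simplices hfin 3
  have : Fintype (Facet K 2) := Fintype.ofFinite (Simplices K 3)
  rw [finprod_eq_prod_of_fintype]
  constructor
  · intro hprod
    have hB : RelationB ρ := by
      intro s _ hs _ _ i hi j hj hij
      exact absurd (Finset.card_le_one.1 (by omega) i hi j hj) hij
    have hA : RelationA ρ := by
      intro i j l T T' hij hjl hli hT hs
      have := Finset.card_le_card hs
      rw [hT, Finset.card_eq_three.2 ⟨i, j, l, hij, hli.symm, hjl, rfl⟩] at this
      omega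
    obtain ⟨Φ, hΦ⟩ := exists_isPotential hK le_rfl hρ hB
    obtain ⟨ω, hω⟩ := exists_common_coboundary hK hΦ hA
    have hωK : ω (fundamentalCycle o) = 0 := by
      have h1 := sum_edgeSides_eq hK E hΦ
      rw [hprod, ofMul_one] at h1
      rw [fundamentalCycle, map_sum, h1]
      refine Finset.sum_congr rfl fun T _ => ?_
      rw [← hω T _ (single_mem_chains (L := {s | s ⊆ T.1}) (Finset.Subset.refl _) T.2.2 1),
        ← map_smul, smul_single, smul_eq_mul, mul_one]
    refine exists_realizes hbasis hΦ hω (fun z hz => ?_) x y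
      fun s => (isEmpty_torsion hK hconn ho E hbasis).elim s
    obtain ⟨c, u', -, h⟩ := exists_eq_fundamentalCycle_add hK hconn ho E (d := 0) hz.1 fun e => by
      rw [LinearMap.mem_ker.1 hz.2]; exact dvd_zero _
    rw [h, zero_smul, add_zero, map_smul, hωK, smul_zero]
  · rintro ⟨b, hb⟩
    have hΦ : IsPotential Adj (connCochain b) ρ := by
      intro i j T T' hij hT hs
      rw [← hb.1 i j T T' hij hT hs]
      exact isPotential_connCochain b i j T T' hij trivial hs
    apply Additive.ofMul.injective
    rw [sum_edgeSides_eq hK E hΦ]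
    simp [connCochain_bdry]

end Surface

/-! ### The two sides of a triangle -/

section Sides

variable {V : Type*} [LinearOrder V] {K : AbstractSimplicialComplex V} {n : ℕ} {o : Facet K n → ℤ}

lemma listSign_cycle {a b c : V} (hab : a ≠ b) (hca : c ≠ a) :
    listSign [b, c, a] = listSign [a, b, c] := by
  rw [listSign_cons_swap hca.symm, ← listSign_swap hab.symm]

lemma listSign_cons_cycle {v a b c : V} (h : [v, a, b, c].Nodup) :
    listSign [v, b, c, a] = listSign [v, a, b, c] := by
  obtain ⟨hv, hnd⟩ := List.nodup_cons.1 h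
  have hab : a ≠ b := by rintro rfl; simp at hnd
  have hca : c ≠ a := by rintro rfl; simp at hnd
  have hbc : b ≠ c := by rintro rfl; simp at hnd
  have hv' : v ∉ [b, c, a] := by simp only [List.mem_cons] at hv ⊢; tauto
  have hset : [b, c, a].toFinset = [a, b, c].toFinset := by
    ext x; simp only [List.mem_toFinset, List.mem_cons]; tauto
  rw [listSign_cons hv hnd, listSign_cons hv' (by simp [hab.symm, hca, hbc]), hset,
    listSign_cycle hab hca]

lemma Induces.cycle {T : Facet K n} {i j l : V} (h : Induces o T [i, j, l]) :
    Induces o T [j, l, i] := by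
  obtain ⟨v, hnd, hT, ho⟩ := h
  refine ⟨v, ?_, ?_, by rw [listSign_cons_cycle hnd, ho]⟩
  · simp only [List.nodup_cons, List.mem_cons, List.not_mem_nil, or_false, not_or,
      not_false_eq_true, List.nodup_nil, and_true] at hnd ⊢
    obtain ⟨⟨h1, h2, h3⟩, ⟨h4, h5⟩, h6⟩ := hnd
    exact ⟨⟨h2, h3, h1⟩, ⟨h6, Ne.symm h4⟩, Ne.symm h5⟩
  · rw [← hT]
    ext x; simp only [List.mem_toFinset, List.mem_cons]; tauto

lemma Induces.unique (ho : IsOrientation o) {T T' : Facet K n} {f : List V} (h : Induces o T f)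
    (h' : Induces o T' f) : T = T' := by
  by_contra hne
  exact ho.2 T T' f hne h h'

/-- `T` and `T'` are the two sides of the triangle `i j l`, and `T` is the one whose boundary
contains `[i, j, l]`. -/
structure IsSides (o : Facet K n → ℤ) (i j l : V) (T T' : Facet K n) : Prop where
  ne_ij : i ≠ j
  ne_jl : j ≠ l
  ne_li : l ≠ i
  inter : T.1 ∩ T'.1 = {i, j, l}
  ind : Induces o T [i, j, l]
  ind' : Induces o T' [j, i, l]

lemma card_triple {i j l : V} (hij : i ≠ j) (hjl : j ≠ l) (hli : l ≠ i) :
    ({i, j, l} : Finset V).card = 3 :=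
  Finset.card_eq_three.2 ⟨i, j, l, hij, hli.symm, hjl, rfl⟩

lemma IsSides.symm {i j l : V} {T T' : Facet K n} (h : IsSides o i j l T T') :
    IsSides o j i l T' T :=
  ⟨h.ne_ij.symm, h.ne_li.symm, h.ne_jl.symm, by
    rw [Finset.inter_comm, h.inter, Finset.insert_comm], h.ind', h.ind⟩

lemma IsSides.rotate {i j l : V} {T T' : Facet K n} (h : IsSides o i j l T T') :
    IsSides o j l i T T' :=
  ⟨h.ne_jl, h.ne_li, h.ne_ij, by
    rw [h.inter]; ext x; simp only [Finset.mem_insert, Finset.mem_singleton]; tauto,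
    h.ind.cycle, h.ind'.cycle.cycle⟩

lemma IsSides.unique (ho : IsOrientation o) {i j l : V} {T T' S S' : Facet K n}
    (h : IsSides o i j l T T') (h' : IsSides o i j l S S') : T = S ∧ T' = S' :=
  ⟨h.ind.unique ho h'.ind, h.ind'.unique ho h'.ind'⟩

lemma TriangleSides.isSides {d : Finset V} (t : TriangleSides o d) :
    IsSides o t.i t.j t.l t.T t.T' :=
  ⟨t.ne_ij, t.ne_jl, t.ne_li, t.inter.trans t.eq, t.ind, t.ind'⟩

end Sides

/-! ### Flags of an oriented 3-manifold -/

section ThreeManifold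

variable {V : Type*} [LinearOrder V] {K : AbstractSimplicialComplex V} {o : Facet K 3 → ℤ}

lemma IsSides.adj {i j l : V} {T T' : Facet K 3} (h : IsSides o i j l T T') : Adj T T' := by
  rw [Adj, h.inter, card_triple h.ne_ij h.ne_jl h.ne_li]

/-- An oriented tetrahedron induces one of the two orientations of each of its faces. -/
lemma induces_or (ho : IsOrientation o) {i j l : V} (hij : i ≠ j) (hjl : j ≠ l) (hli : l ≠ i)
    {T : Facet K 3} (hT : {i, j, l} ⊆ T.1) : Induces o T [i, j, l] ∨ Induces o T [j, i, l] := by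
  obtain ⟨v, hv⟩ := Finset.card_eq_one.1 (show (T.1 \ {i, j, l}).card = 1 by
    rw [Finset.card_sdiff_of_subset hT, T.2.2, card_triple hij hjl hli])
  have hv' : v ∈ T.1 \ {i, j, l} := hv ▸ Finset.mem_singleton_self v
  have hvn := (Finset.mem_sdiff.1 hv').2
  simp only [Finset.mem_insert, Finset.mem_singleton, not_or] at hvn
  obtain ⟨h1, h2, h3⟩ := hvn
  have hT' : insert v {i, j, l} = T.1 := by
    rw [← Finset.sdiff_union_of_subset hT, hv, Finset.singleton_union]
  have e1 : [v, i, j, l].Nodup := by simp [h1, h2, h3, hij, hjl, hli.symm]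
  have e2 : [v, j, i, l].Nodup := by simp [h1, h2, h3, hij.symm, hjl, hli.symm]
  have hs : listSign [v, j, i, l] = -listSign [v, i, j, l] := listSign_cons_swap hij _
  by_cases h : o T = listSign [v, i, j, l]
  · exact .inl ⟨v, e1, by rw [← hT']; simp, h⟩
  · refine .inr ⟨v, e2, by rw [← hT']; simp [Finset.insert_comm j i], ?_⟩
    rw [hs]
    rcases ho.1 T with h' | h' <;> rcases listSign_eq_or [v, i, j, l] with h'' | h'' <;>
      rw [h', h''] at h ⊢ <;> simp at h ⊢

lemma isSides_or (ho : IsOrientation o) {i j l : V} (hij : i ≠ j) (hjl : j ≠ l) (hli : l ≠ i)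
    {T T' : Facet K 3} (hT : T.1 ∩ T'.1 = {i, j, l}) :
    IsSides o i j l T T' ∨ IsSides o i j l T' T := by
  have hT' : T'.1 ∩ T.1 = {i, j, l} := by rw [Finset.inter_comm, hT]
  have hadj : Adj T T' := by rw [Adj, hT, card_triple hij hjl hli]
  rcases induces_or ho hij hjl hli (T := T) (hT.symm.subset.trans Finset.inter_subset_left) with
    h | h <;>
  rcases induces_or ho hij hjl hli (T := T') (hT.symm.subset.trans Finset.inter_subset_right) with
    h' | h'
  · exact absurd (h.unique ho h') hadj.ne
  · exact .inl ⟨hij, hjl, hli, hT, h, h'⟩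
  · exact .inr ⟨hij, hjl, hli, hT', h', h⟩
  · exact absurd (h.unique ho h') hadj.ne

lemma isSides_of_induces (ho : IsOrientation o) {i j l : V} (hij : i ≠ j) (hjl : j ≠ l)
    (hli : l ≠ i) {T T' : Facet K 3} (hT : T.1 ∩ T'.1 = {i, j, l}) (h : Induces o T [i, j, l]) :
    IsSides o i j l T T' := by
  rcases isSides_or ho hij hjl hli hT with h' | h'
  · exact h'
  · exact absurd (h'.ind.unique ho h) h'.adj.ne

lemma exists_isSides (hK : IsHomologyManifold K 3) (ho : IsOrientation o) {i j l : V}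
    (hij : i ≠ j) (hjl : j ≠ l) (hli : l ≠ i) (hd : {i, j, l} ∈ K.faces) :
    ∃ T T', IsSides o i j l T T' := by
  obtain ⟨T, hT⟩ := exists_facet_subset hK hd
  have hc := card_triple hij hjl hli
  obtain ⟨T', hne, hT', -⟩ := exists_other_facet hK hc hT (by simp)
  rcases isSides_or ho hij hjl hli (inter_eq_of_ne hne.symm hc hT hT') with h | h
  · exact ⟨_, _, h⟩
  · exact ⟨_, _, h⟩

/-- The pairs of a triangle and one of its vertices, or equivalently of a triangle and one of its
edges. The independent quantities `ρ_ij^{TT'}` are indexed by them. -/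
abbrev Flag (K : AbstractSimplicialComplex V) : Type _ := Σ d : Simplices K 3, {v // v ∈ d.1}

/-- The edge of a flag: the one opposite to its vertex. -/
def Flag.edge (p : Flag K) : Simplices K 2 :=
  ⟨p.1.1.erase p.2.1, mem_faces_of_subset p.1.2.1 (Finset.erase_subset _ _)
    (Finset.card_pos.1 (by rw [Finset.card_erase_of_mem p.2.2, p.1.2.2]; omega)),
    by rw [Finset.card_erase_of_mem p.2.2, p.1.2.2]⟩

/-- The values of the quantities `ρ_ij^{TT'}` are `f p` for the flags `p`, with `i, j, T, T'` in the
order in which `T ∩ T' = [ijl]` and `∂T = [ijl] + ⋯`, where `l` is the vertex of `p`. The other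
orders are determined by the symmetries of the quantities. -/
def HasFlagValues {M : Type*} (o : Facet K 3 → ℤ) (ρ : V → V → Facet K 3 → Facet K 3 → M)
    (f : Flag K → M) : Prop :=
  ∀ (p : Flag K) (i j : V) (T T' : Facet K 3), p.1.1 = {i, j, p.2.1} →
    IsSides o i j p.2.1 T T' → ρ i j T T' = f p

lemma Flag.exists_pair (p : Flag K) :
    ∃ i j, i ≠ j ∧ j ≠ p.2.1 ∧ p.2.1 ≠ i ∧ p.1.1 = {i, j, p.2.1} := by
  obtain ⟨i, j, hij, h⟩ := Finset.card_eq_two.1 p.edge.2.2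
  change p.1.1.erase p.2.1 = {i, j} at h
  have hi : i ∈ p.1.1.erase p.2.1 := h ▸ by simp
  have hj : j ∈ p.1.1.erase p.2.1 := h ▸ by simp
  refine ⟨i, j, hij, (Finset.mem_erase.1 hj).1, (Finset.mem_erase.1 hi).1.symm, ?_⟩
  refine (Finset.insert_erase p.2.2).symm.trans ?_
  rw [h]
  ext x; simp only [Finset.mem_insert, Finset.mem_singleton]; tauto

variable {M : Type*} [CommGroup M]

lemma exists_hasFlagValues (hK : IsHomologyManifold K 3) (ho : IsOrientation o)
    {ρ : V → V → Facet K 3 → Facet K 3 → M} (hρ : IsRhoData ρ) : ∃ f, HasFlagValues o ρ f := by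
  have h : ∀ p : Flag K, ∃ i j T T', p.1.1 = {i, j, p.2.1} ∧ IsSides o i j p.2.1 T T' := by
    intro p
    obtain ⟨i, j, hij, hjl, hli, hp⟩ := p.exists_pair
    obtain ⟨T, T', hT⟩ := exists_isSides hK ho hij hjl hli (hp ▸ p.1.2.1)
    exact ⟨i, j, T, T', hp, hT⟩
  choose i j T T' hp hT using h
  refine ⟨fun p => ρ (i p) (j p) (T p) (T' p), fun p i' j' S S' hp' hS => ?_⟩
  have hi' : i' ∈ ({i p, j p, p.2.1} : Finset V) := by rw [← hp p, hp']; simp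
  have hj' : j' ∈ ({i p, j p, p.2.1} : Finset V) := by rw [← hp p, hp']; simp
  simp only [Finset.mem_insert, Finset.mem_singleton, hS.ne_li.symm, hS.ne_jl, or_false] at hi' hj'
  have hne := hS.ne_ij
  have hTp := hT p
  rcases hi' with hi' | hi' <;> rcases hj' with hj' | hj'
  · exact absurd (hi'.trans hj'.symm) hne
  · change ρ i' j' S S' = ρ (i p) (j p) (T p) (T' p)
    rw [← hi', ← hj'] at hTp ⊢
    obtain ⟨rfl, rfl⟩ := hTp.unique ho hS
    rfl
  · change ρ i' j' S S' = ρ (i p) (j p) (T p) (T' p)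
    rw [← hi', ← hj'] at hTp ⊢
    obtain ⟨h1, h2⟩ := hTp.symm.unique ho hS
    rw [h1, h2]
    exact (hρ i' j' S S' hne hS.adj (by rw [hS.inter]; exact pair_subset.2 (by simp))).2.symm
  · exact absurd (hi'.trans hj'.symm) hne

/-- Every choice of values on the flags is possible. -/
lemma exists_isRhoData (ho : IsOrientation o) (f : Flag K → M) :
    ∃ ρ : V → V → Facet K 3 → Facet K 3 → M, IsRhoData ρ ∧ HasFlagValues o ρ f := by
  classical
  let C : V → V → Facet K 3 → Facet K 3 → Flag K → Prop := fun i j T T' p =>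
    p.1.1 = {i, j, p.2.1} ∧ IsSides o i j p.2.1 T T'
  let ρ : V → V → Facet K 3 → Facet K 3 → M := fun i j T T' =>
    if h : ∃ p, C i j T T' p then f h.choose else
      if h : ∃ p, C i j T' T p then (f h.choose)⁻¹ else 1
  have hC : ∀ {i j T T' p q}, C i j T T' p → C i j T T' q → p = q := by
    rintro i j T T' ⟨⟨d, hd⟩, ⟨v, hv⟩⟩ ⟨⟨d', hd'⟩, ⟨v', hv'⟩⟩ ⟨h1, h2⟩ ⟨h3, h4⟩
    simp only at h1 h2 h3 h4
    have : v = v' := by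
      have hmem : v ∈ ({i, j, v'} : Finset V) := by rw [← h4.inter, h2.inter]; simp
      simpa [h2.ne_li, h2.ne_jl.symm] using hmem
    subst this
    obtain rfl : d = d' := h1.trans h3.symm
    rfl
  have hCn : ∀ {i j T T' p q}, C i j T T' p → ¬ C i j T' T q := by
    intro i j T T' p q h1 h2
    have : p.2.1 = q.2.1 := by
      have hmem : p.2.1 ∈ ({i, j, q.2.1} : Finset V) := by
        rw [← h2.2.inter, Finset.inter_comm, h1.2.inter]; simp
      simpa [h1.2.ne_li, h1.2.ne_jl.symm] using hmem
    exact h1.2.adj.ne (h1.2.ind.unique ho (this ▸ h2.2.ind))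
  have hsymm : ∀ {i j T T' p}, C i j T T' p → C j i T' T p := fun h =>
    ⟨h.1.trans (Finset.insert_comm _ _ _), h.2.symm⟩
  have hρ1 : ∀ {i j T T' p}, C i j T T' p → ρ i j T T' = f p := by
    intro i j T T' p h
    have hex : ∃ p, C i j T T' p := ⟨p, h⟩
    simp only [ρ, dif_pos hex, hC hex.choose_spec h]
  have hρ2 : ∀ {i j T T' p}, C i j T T' p → ρ i j T' T = (f p)⁻¹ := by
    intro i j T T' p h
    have hex : ∃ p, C i j T T' p := ⟨p, h⟩
    have hnex : ¬ ∃ p, C i j T' T p := fun ⟨q, hq⟩ => hCn h hq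
    simp only [ρ, dif_neg hnex, dif_pos hex, hC hex.choose_spec h]
  refine ⟨ρ, fun i j T T' hij hadj hs => ?_, fun p i j T T' hp hT => hρ1 ⟨hp, hT⟩⟩
  obtain ⟨l, hl, hln⟩ := Finset.exists_mem_notMem_of_card_lt_card (s := {i, j}) (t := T.1 ∩ T'.1)
    (by rw [hadj, Finset.card_pair hij]; omega)
  simp only [Finset.mem_insert, Finset.mem_singleton, not_or] at hln
  have hd : T.1 ∩ T'.1 = {i, j, l} := by
    refine (Finset.eq_of_subset_of_card_le (triple_subset.2 ⟨(pair_subset.1 hs).1,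
      (pair_subset.1 hs).2, hl⟩) ?_).symm
    rw [hadj, card_triple hij (Ne.symm hln.2) hln.1]
  have hf : {i, j, l} ∈ K.faces :=
    T.mem_faces_of_subset (hd.symm.subset.trans Finset.inter_subset_left) (by simp)
  let p : Flag K := ⟨⟨{i, j, l}, hf, card_triple hij (Ne.symm hln.2) hln.1⟩, ⟨l, by simp⟩⟩
  rcases isSides_or ho hij (Ne.symm hln.2) hln.1 hd with h | h
  · have hp : C i j T T' p := ⟨rfl, h⟩
    rw [hρ1 hp, hρ2 hp, hρ1 (hsymm hp)]
    exact ⟨mul_inv_cancel _, rfl⟩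
  · have hp : C i j T' T p := ⟨rfl, h⟩
    rw [hρ1 hp, hρ2 hp, hρ2 (hsymm hp)]
    exact ⟨inv_mul_cancel _, rfl⟩

/-- The relation A of a triangle is the product over its flags. -/
lemma TriangleSides.relA_eq {ρ : V → V → Facet K 3 → Facet K 3 → M} {f : Flag K → M}
    (hf : HasFlagValues o ρ f) {d : Simplices K 3} (t : TriangleSides o d.1) :
    t.relA ρ = ∏ v : {v // v ∈ d.1}, f ⟨d, v⟩ := by
  classical
  have h := t.isSides
  have hi : t.i ∈ d.1 := t.eq.symm.subset (by simp)
  have hj : t.j ∈ d.1 := t.eq.symm.subset (by simp)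
  have hl : t.l ∈ d.1 := t.eq.symm.subset (by simp)
  have huniv : (Finset.univ : Finset {v // v ∈ d.1}) = {⟨t.l, hl⟩, ⟨t.i, hi⟩, ⟨t.j, hj⟩} := by
    ext ⟨x, hx⟩
    have : x = t.i ∨ x = t.j ∨ x = t.l := by simpa using t.eq.subset hx
    simp only [Finset.mem_univ, Finset.mem_insert, Finset.mem_singleton, Subtype.mk.injEq, true_iff]
    tauto
  rw [huniv, Finset.prod_insert (by simp [t.ne_li, t.ne_jl.symm]), Finset.prod_pair (by
    simpa using t.ne_ij), TriangleSides.relA, mul_assoc]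
  congr 1
  · exact hf ⟨d, ⟨t.l, hl⟩⟩ _ _ _ _ t.eq h
  congr 1
  · refine hf ⟨d, ⟨t.i, hi⟩⟩ _ _ _ _ (t.eq.trans ?_) h.rotate
    ext x; simp only [Finset.mem_insert, Finset.mem_singleton]; tauto
  · refine hf ⟨d, ⟨t.j, hj⟩⟩ _ _ _ _ (t.eq.trans ?_) h.rotate.rotate
    ext x; simp only [Finset.mem_insert, Finset.mem_singleton]; tauto

/-- A tetrahedron cannot induce both `[i, j, l]` and `[i, j, l']` for different `l`, `l'`. -/
lemma Induces.last_unique {T : Facet K 3} {i j l l' : V} (h : Induces o T [i, j, l])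
    (h' : Induces o T [i, j, l']) : l = l' := by
  by_contra hne
  obtain ⟨v, hnd, hT, hv⟩ := h
  obtain ⟨w, hnd', hT', hw⟩ := h'
  have hvl : v = l' := by
    have : l' ∈ [v, i, j, l].toFinset := by rw [hT, ← hT']; simp
    simp only [List.mem_toFinset, List.mem_cons, List.not_mem_nil, or_false] at this
    simp only [List.nodup_cons, List.mem_cons, List.not_mem_nil, or_false, not_or] at hnd'
    rcases this with h | h | h | h
    · exact h.symm
    · exact absurd h.symm hnd'.2.1.2
    · exact absurd h.symm hnd'.2.2.1
    · exact absurd h.symm hne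
  have hwl : w = l := by
    have : l ∈ [w, i, j, l'].toFinset := by rw [hT', ← hT]; simp
    simp only [List.mem_toFinset, List.mem_cons, List.not_mem_nil, or_false] at this
    simp only [List.nodup_cons, List.mem_cons, List.not_mem_nil, or_false, not_or] at hnd
    rcases this with h | h | h | h
    · exact h.symm
    · exact absurd h.symm hnd.2.1.2
    · exact absurd h.symm hnd.2.2.1
    · exact absurd h hne
  subst hvl hwl
  -- the two vertex lists differ by a transposition
  have rot : ∀ {a b : V}, [a, i, j, b].Nodup → listSign [a, b, i, j] = listSign [a, i, j, b] := by
    intro a b h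
    refine (listSign_cons_cycle ?_).symm
    simp only [List.nodup_cons, List.mem_cons, List.not_mem_nil, or_false, not_or,
      not_false_eq_true, List.nodup_nil, and_true] at h ⊢
    obtain ⟨⟨h1, h2, h3⟩, ⟨h4, h5⟩, h6⟩ := h
    exact ⟨⟨h3, h1, h2⟩, ⟨Ne.symm h5, Ne.symm h6⟩, h4⟩
  have e3 := listSign_swap (Ne.symm hne) [i, j]
  rw [rot hnd, rot hnd'] at e3
  have e4 := hv.symm.trans hw
  rcases listSign_eq_or [v, i, j, w] with h | h <;> omega

lemma edge_eq_iff {p : Flag K} {i j : V} :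
    p.edge.1 = {i, j} ↔ p.1.1 = {i, j, p.2.1} ∧ p.2.1 ≠ i ∧ j ≠ p.2.1 := by
  change p.1.1.erase p.2.1 = {i, j} ↔ _
  constructor
  · intro h
    have hi : i ∈ p.1.1.erase p.2.1 := h ▸ by simp
    have hj : j ∈ p.1.1.erase p.2.1 := h ▸ by simp
    refine ⟨?_, (Finset.mem_erase.1 hi).1.symm, (Finset.mem_erase.1 hj).1⟩
    refine (Finset.insert_erase p.2.2).symm.trans ?_
    rw [h]
    ext x; simp only [Finset.mem_insert, Finset.mem_singleton]; tauto
  · rintro ⟨h, h1, h2⟩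
    refine (congrArg (fun s => s.erase p.2.1) h).trans ?_
    ext x
    simp only [Finset.mem_insert, Finset.mem_singleton, Finset.mem_erase]
    constructor
    · tauto
    · rintro (rfl | rfl)
      · exact ⟨h1.symm, by simp⟩
      · exact ⟨h2, by simp⟩

/-- The relation B of an edge is the product over its flags. -/
lemma EdgeCircuit.relB_eq (hK : IsHomologyManifold K 3) (ho : IsOrientation o) [Fintype (Flag K)]
    [DecidableEq (Simplices K 2)] {ρ : V → V → Facet K 3 → Facet K 3 → M} {f : Flag K → M}
    (hf : HasFlagValues o ρ f) {e : Simplices K 2} (c : EdgeCircuit o e.1) :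
    c.relB ρ = ∏ p : Flag K with p.edge = e, f p := by
  classical
  obtain ⟨hnd, hmem, hchain⟩ := c.dual
  rw [isChain_cyclic_iff _ hnd] at hchain
  have hdir := c.direction
  rw [isChain_cyclic_iff _ hnd] at hdir
  rw [EdgeCircuit.relB, cyclicProd_eq_prod _ hnd]
  have hg : ∀ T ∈ c.circuit.toFinset, ∃ p : Flag K, p.edge = e ∧
      IsSides o c.i c.j p.2.1 T (c.circuit.formPerm T) := by
    intro T hT
    rw [List.mem_toFinset] at hT
    have hadj := hchain T hT
    have h1 : e.1 ⊆ T.1 := (hmem T).1 hT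
    have h2 : e.1 ⊆ (c.circuit.formPerm T).1 :=
      (hmem _).1 (List.formPerm_apply_mem_of_mem hT)
    replace h1 := c.eq.symm.subset.trans h1
    replace h2 := c.eq.symm.subset.trans h2
    have hs := Finset.subset_inter h1 h2
    obtain ⟨l, hl, hln⟩ := Finset.exists_mem_notMem_of_card_lt_card (s := {c.i, c.j})
      (t := T.1 ∩ (c.circuit.formPerm T).1) (by rw [hadj, Finset.card_pair c.ne]; omega)
    simp only [Finset.mem_insert, Finset.mem_singleton, not_or] at hln
    have hd : T.1 ∩ (c.circuit.formPerm T).1 = {c.i, c.j, l} := by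
      refine (Finset.eq_of_subset_of_card_le (triple_subset.2 ⟨(pair_subset.1 hs).1,
        (pair_subset.1 hs).2, hl⟩) ?_).symm
      rw [hadj, card_triple c.ne (Ne.symm hln.2) hln.1]
    have hF : {c.i, c.j, l} ∈ K.faces :=
      T.mem_faces_of_subset (hd.symm.subset.trans Finset.inter_subset_left) (by simp)
    refine ⟨⟨⟨{c.i, c.j, l}, hF, card_triple c.ne (Ne.symm hln.2) hln.1⟩, ⟨l, by simp⟩⟩,
      Subtype.ext ?_, isSides_of_induces ho c.ne (Ne.symm hln.2) hln.1 hd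
        (hdir T hT l hl hln.1 hln.2)⟩
    exact (edge_eq_iff.2 ⟨rfl, hln.1, Ne.symm hln.2⟩).trans c.eq.symm
  choose g hge hgs using hg
  refine Finset.prod_bij g (fun T hT => by simp [hge T hT]) ?_ ?_ ?_
  · intro T hT T' hT' h
    refine (hgs T hT).ind.unique ho ?_
    rw [h]
    exact (hgs T' hT').ind
  · intro p hp
    have hpe : p.edge = e := by simpa using hp
    have hpe' : p.edge.1 = {c.i, c.j} := (congrArg Subtype.val hpe).trans c.eq
    obtain ⟨h1, h2, h3⟩ := edge_eq_iff.1 hpe'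
    obtain ⟨T, T', hT⟩ := exists_isSides hK ho c.ne h3 h2 (h1 ▸ p.1.2.1)
    have hTc : T ∈ c.circuit.toFinset := by
      rw [List.mem_toFinset, hmem, ← hpe]
      refine (Finset.erase_subset _ _).trans ?_
      exact (h1.trans hT.inter.symm).subset.trans Finset.inter_subset_left
    refine ⟨T, hTc, ?_⟩
    have hl : (g T hTc).2.1 = p.2.1 := (hgs T hTc).ind.last_unique hT.ind
    have hgp : (g T hTc).1.1 = p.1.1 := by
      refine (edge_eq_iff.1 ((congrArg Subtype.val (hge T hTc)).trans c.eq)).1.trans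
        (Eq.trans ?_ h1.symm)
      rw [hl]
    generalize g T hTc = q at hl hgp
    obtain ⟨⟨d, hd⟩, ⟨v, hv⟩⟩ := q
    obtain ⟨⟨d', hd'⟩, ⟨v', hv'⟩⟩ := p
    simp only at hl hgp
    subst hl hgp
    rfl
  · intro T hT
    refine hf (g T hT) _ _ _ _ ?_ (hgs T hT)
    exact (edge_eq_iff.1 ((congrArg Subtype.val (hge T hT)).trans c.eq)).1

/-- The product of powers of the relations A and B as a product over the flags. -/
lemma prod_relA_mul_prod_relB (hK : IsHomologyManifold K 3) (ho : IsOrientation o)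
    [Fintype (Flag K)] (D : ∀ d : Simplices K 3, TriangleSides o d.1)
    (E : ∀ e : Simplices K 2, EdgeCircuit o e.1) {ρ : V → V → Facet K 3 → Facet K 3 → M}
    {f : Flag K → M} (hf : HasFlagValues o ρ f) [Finite (Simplices K 2)] [Finite (Simplices K 3)]
    (α : Simplices K 3 →₀ ℤ) (β : Simplices K 2 →₀ ℤ) :
    (α.prod fun d e => (D d).relA ρ ^ e) * (β.prod fun d e => (E d).relB ρ ^ e) =
      ∏ p : Flag K, f p ^ (α p.1 + β p.edge) := by
  classical
  have := Fintype.ofFinite (Simplices K 2)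
  have := Fintype.ofFinite (Simplices K 3)
  rw [Finsupp.prod_fintype _ _ (by simp), Finsupp.prod_fintype _ _ (by simp)]
  have h1 : ∏ d, (D d).relA ρ ^ α d = ∏ p : Flag K, f p ^ α p.1 := by
    have he : ∏ p : Flag K, f p ^ α p.1 = ∏ p ∈ Finset.univ.sigma fun d : Simplices K 3 =>
        (Finset.univ : Finset {v // v ∈ d.1}), f p ^ α p.1 :=
      Finset.prod_congr (by ext; simp) fun _ _ => rfl
    rw [he, Finset.prod_sigma]
    refine Finset.prod_congr rfl fun d _ => ?_
    rw [(D d).relA_eq hf, ← Finset.prod_zpow]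
  have h2 : ∏ e, (E e).relB ρ ^ β e = ∏ p : Flag K, f p ^ β p.edge := by
    rw [← Finset.prod_fiberwise (s := Finset.univ) (g := Flag.edge (K := K))]
    refine Finset.prod_congr rfl fun e _ => ?_
    rw [(E e).relB_eq hK ho hf, ← Finset.prod_zpow]
    refine Finset.prod_congr rfl fun p hp => ?_
    rw [(Finset.mem_filter.1 hp).2]
  rw [h1, h2, ← Finset.prod_mul_distrib]
  simp only [zpow_add]

end ThreeManifold

/-! ### The dependence among the relations in dimension three -/

section Dependence

variable {V : Type*} [LinearOrder V] {K : AbstractSimplicialComplex V} {n : ℕ}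

lemma finite_vertices (hfin : K.faces.Finite) : Finite V := by
  have := hfin.to_subtype
  refine Finite.of_injective (fun v => (⟨{v}, K.singleton_mem v⟩ : K.faces)) fun v w h => ?_
  exact Finset.singleton_injective (congrArg Subtype.val h)

/-- There is a 2-cocycle with prescribed values on a basis of the second homology. -/
lemma exists_cocycle {A ι : Type*} [AddCommGroup A] [Finite V] {z : ι → FramedCycle K n}
    (hz : GeneratesH2 z) (hzi : IndependentInH2 z) (v : ι → A) :
    ∃ ω : (Finset V →₀ ℤ) →ₗ[ℤ] A, (∀ x ∈ chains K.faces 4, ω (bdry x) = 0) ∧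
      ∀ q, ω (z q).chain = v q := by
  obtain ⟨π, hπ⟩ := exists_retraction K.faces 3
  let g : (ι →₀ ℤ) →ₗ[ℤ] (Finset V →₀ ℤ) := linearCombination ℤ fun q => (z q).chain
  let f : chains K.faces 4 × (ι →₀ ℤ) →ₗ[ℤ] (Finset V →₀ ℤ) :=
    (bdry ∘ₗ (chains K.faces 4).subtype).coprod g
  let Ψ : chains K.faces 4 × (ι →₀ ℤ) →ₗ[ℤ] A :=
    LinearMap.coprod 0 (linearCombination ℤ v)
  have hg : ∀ x, g x ∈ cycles K.faces 3 := fun x => by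
    refine Submodule.sum_mem _ fun q _ => Submodule.smul_mem _ _ ⟨(z q).chain_mem, ?_⟩
    change bdry (z q).chain = 0
    rw [(z q).bdry_chain, Finset.univ_eq_empty, Finset.sum_empty]
  obtain ⟨ω, hω⟩ := exists_extension hπ f Ψ
    (fun w => Submodule.add_mem _ ⟨bdry_mem_chains_faces w.1.2, bdry_bdry _⟩ (hg _)) (by
      intro c hc
      obtain ⟨x, d, hd, hdc⟩ := hz c hc
      refine ⟨(⟨d, hd⟩, x), ?_⟩
      change bdry d + g x = c
      rw [hdc, sub_add_cancel]) (by
      rintro ⟨⟨d, hd⟩, x⟩ hw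
      change bdry d + g x = 0 at hw
      have hx : x = 0 := hzi x ⟨-d, Submodule.neg_mem _ hd, by
        rw [map_neg, eq_comm, eq_neg_iff_add_eq_zero, add_comm]; exact hw⟩
      simp [Ψ, hx])
  refine ⟨ω, fun x hx => ?_, fun q => ?_⟩
  · have := hω (⟨x, hx⟩, 0)
    simpa [f, Ψ] using this
  · have := hω (0, single q 1)
    simpa [f, g, Ψ] using this

/-- A cocycle has a potential inside every simplex. -/
lemma exists_local_potential {A : Type*} [AddCommGroup A] {ω : (Finset V →₀ ℤ) →ₗ[ℤ] A}
    (hω : ∀ x ∈ chains K.faces 4, ω (bdry x) = 0) :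
    ∃ Φ : Facet K n → (Finset V →₀ ℤ) →ₗ[ℤ] A, ∀ (T : Facet K n), ∀ x ∈ chains {s | s ⊆ T.1} 3,
      ω x = Φ T (bdry x) := by
  have hne : ∀ T : Facet K n, ∃ v, v ∈ T.1 := fun T =>
    Finset.card_pos.1 (by rw [T.2.2]; omega)
  choose v hv using hne
  refine ⟨fun T => ω ∘ₗ cone (v T), fun T x hx => ?_⟩
  have h := hω (cone (v T) x) (T.chains_le 3 (cone_mem_chains (L := {s | s ⊆ T.1})
    (fun s hs _ _ => Finset.insert_subset (hv T) hs) hx))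
  rw [bdry_cone, map_sub, sub_eq_zero] at h
  rw [h, LinearMap.comp_apply]

/-- The framed products of 2-cycles representing a basis of the second homology are independent of
each other and of the relations A and B. -/
lemma exists_isRhoData_of_cycles {M ι : Type*} [CommGroup M] [Finite V] {z : ι → FramedCycle K n}
    (hz : GeneratesH2 z) (hzi : IndependentInH2 z)
    {P : V → V → Facet K n → Facet K n → List (Facet K n)} (hP : IsPathSystem P) (v : ι → M) :
    ∃ ρ : V → V → Facet K n → Facet K n → M, IsRhoData ρ ∧ RelationA ρ ∧ RelationB ρ ∧
      ∀ q, (z q).prod (extend P ρ) = v q := by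
  obtain ⟨ω, hω, hωz⟩ := exists_cocycle hz hzi fun q => -Additive.ofMul (v q)
  obtain ⟨Φ, hΦ⟩ := exists_local_potential (n := n) hω
  let ρ : V → V → Facet K n → Facet K n → M := fun i j T T' =>
    (Φ T (orientedSimplex [i, j]) - Φ T' (orientedSimplex [i, j])).toMul
  have hρ : IsPotential Adj Φ ρ := fun i j T T' _ _ _ => rfl
  refine ⟨ρ, hρ.isRhoData, fun i j l T T' hij hjl hli hT hs => hρ.relationA hΦ hij hjl hli hT hs,
    hρ.relationB, fun q => ?_⟩
  apply Additive.ofMul.injective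
  rw [FramedCycle.ofMul_prod (z q) (hρ.extend hP) hΦ, hωz, neg_neg]

lemma pathProd_one {F M : Type*} [Monoid M] (l : List F) :
    pathProd (fun _ _ => (1 : M)) l = 1 := by
  induction l with
  | nil => rfl
  | cons T l ih =>
    cases l with
    | nil => rfl
    | cons T' l => rw [pathProd, ih, one_mul]

lemma prod_zpow_eq_single {σ M : Type*} [CommGroup M] (υ : σ →₀ ℤ) {g : σ → M} (s₀ : σ)
    (hg : ∀ s, s ≠ s₀ → g s = 1) : (υ.prod fun s e => g s ^ e) = g s₀ ^ υ s₀ :=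
  Finsupp.prod_eq_single s₀ (fun s _ hs => by rw [hg s hs, one_zpow]) fun _ => zpow_zero _

/-- A function on triangles that is the negative of a function on edges wherever the two are
incident is constant. -/
lemma exists_const_of_incident (hK : IsHomologyManifold K 3) (hconn : IsConnected K)
    {α : Simplices K 3 → ℤ} {β : Simplices K 2 → ℤ}
    (h : ∀ (d : Simplices K 3) (e : Simplices K 2), e.1 ⊆ d.1 → α d + β e = 0) :
    ∃ c : ℤ, (∀ d, α d = c) ∧ ∀ e, β e = -c := by
  have hed : ∀ e : Simplices K 2, ∃ d : Simplices K 3, e.1 ⊆ d.1 := by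
    intro e
    obtain ⟨T, hT⟩ := exists_facet_subset hK e.2.1
    obtain ⟨d, hed, hdT, hd⟩ := Finset.exists_subsuperset_card_eq hT (n := 3)
      (by rw [e.2.2]; omega) (by rw [T.2.2]; omega)
    exact ⟨⟨d, T.mem_faces_of_subset hdT (Finset.card_pos.1 (by omega)), hd⟩, hed⟩
  have hT : ∀ (T : Facet K 3) (d d' : Simplices K 3), d.1 ⊆ T.1 → d'.1 ⊆ T.1 → α d = α d' := by
    intro T d d' hd hd'
    have hc : 2 ≤ (d.1 ∩ d'.1).card := by
      have h1 := Finset.card_union_add_card_inter d.1 d'.1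
      have h2 := Finset.card_le_card (Finset.union_subset hd hd')
      rw [T.2.2] at h2
      rw [d.2.2, d'.2.2] at h1
      omega
    obtain ⟨e, he, hec⟩ := Finset.exists_subset_card_eq hc
    have hed := he.trans Finset.inter_subset_left
    let e' : Simplices K 2 :=
      ⟨e, mem_faces_of_subset d.2.1 hed (Finset.card_pos.1 (by omega)), hec⟩
    have h1 := h d e' hed
    have h2 := h d' e' (he.trans Finset.inter_subset_right)
    omega
  have hTT : ∀ T T' : Facet K 3, Relation.ReflTransGen Adj T T' →
      ∀ d d' : Simplices K 3, d.1 ⊆ T.1 → d'.1 ⊆ T'.1 → α d = α d' := by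
    intro T T' hpath
    induction hpath with
    | refl => exact hT T
    | @tail S S' _ hS ih =>
      intro d d' hd hd'
      have hS' : (S.1 ∩ S'.1).card = 3 := hS
      let d'' : Simplices K 3 := ⟨S.1 ∩ S'.1, S.mem_faces_of_subset Finset.inter_subset_left
        (Finset.card_pos.1 (by omega)), hS'⟩
      exact (ih d d'' hd Finset.inter_subset_left).trans
        (hT S' d'' d' Finset.inter_subset_right hd')
  rcases isEmpty_or_nonempty (Simplices K 3) with hempty | ⟨⟨d₀⟩⟩
  · exact ⟨0, fun d => hempty.elim d, fun e => hempty.elim (hed e).choose⟩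
  · have hα : ∀ d, α d = α d₀ := by
      intro d
      obtain ⟨T, hdT⟩ := exists_facet_subset hK d.2.1
      obtain ⟨T₀, hdT₀⟩ := exists_facet_subset hK d₀.2.1
      exact hTT T T₀ (Facet.adj_connected hK (by omega) hconn T T₀) d d₀ hdT hdT₀
    refine ⟨α d₀, hα, fun e => ?_⟩
    obtain ⟨d, hd⟩ := hed e
    have h1 := h d e hd
    have h2 := hα d
    omega

variable {k : Type*} [RCLike k]

/-- The unit `2` has infinite order. -/
lemma eq_zero_of_two_zpow {e : ℤ} (h : (Units.mk0 (2 : k) two_ne_zero) ^ e = 1) : e = 0 := by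
  have h1 : ‖(((Units.mk0 (2 : k) two_ne_zero) ^ e : kˣ) : k)‖ = 1 := by rw [h]; simp
  rw [Units.val_zpow_eq_zpow_val, Units.val_mk0, norm_zpow, RCLike.norm_two] at h1
  exact (zpow_eq_one_iff_right₀ (by norm_num) (by norm_num)).1 h1

/-- On a closed connected oriented 3-manifold there is one dependence among the relations: every
quantity `ρ_ij^{TT'}` occurs in exactly one relation A and in exactly one relation B. -/
theorem threeManifold_dependence_iff (hK : IsHomologyManifold K 3) {τ ι : Type*}
    {a : τ → FramedLoop K 3} {m : τ → ℕ} (hm : ∀ s, 2 ≤ m s)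
    (hfin : K.faces.Finite) (hconn : IsConnected K) {o : Facet K 3 → ℤ} (ho : IsOrientation o)
    (D : ∀ d : Simplices K 3, TriangleSides o d.1) (E : ∀ e : Simplices K 2, EdgeCircuit o e.1)
    {P : V → V → Facet K 3 → Facet K 3 → List (Facet K 3)} (hP : IsPathSystem P)
    {z : ι → FramedCycle K 3} (hz : GeneratesH2 z) (hzi : IndependentInH2 z)
    (u : ∀ s, FramedChain K 3 ((a s).times (m s)))
    (α : Simplices K 3 →₀ ℤ) (β : Simplices K 2 →₀ ℤ) (ζ : ι →₀ ℤ) (υ : τ →₀ ℤ) :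
    (∀ (ρ : V → V → Facet K 3 → Facet K 3 → kˣ) (y : τ → kˣ), IsRhoData ρ →
      (α.prod fun d e => (D d).relA ρ ^ e) * (β.prod fun d e => (E d).relB ρ ^ e) *
        (ζ.prod fun q e => (z q).prod (extend P ρ) ^ e) *
        (υ.prod fun s e => ((u s).prod (extend P ρ) * (y s ^ m s)⁻¹) ^ e) = 1) ↔
    ∃ c : ℤ, (∀ d, α d = c) ∧ (∀ e, β e = -c) ∧ ζ = 0 ∧ υ = 0 := by
  classical
  have := finite_vertices hfin
  have := finite_simplices hfin 2
  have := finite_simplices hfin 3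
  have := Fintype.ofFinite (Flag K)
  constructor
  · intro h
    let two : kˣ := Units.mk0 2 two_ne_zero
    have hυ : υ = 0 := by
      ext s₀
      have h1 := h (fun _ _ _ _ => 1) (fun s => if s = s₀ then two else 1)
        fun _ _ _ _ _ _ _ => ⟨one_mul 1, rfl⟩
      have hext : extend P (fun _ _ _ _ => (1 : kˣ)) = fun _ _ _ _ => 1 := by
        funext i j T T'
        exact pathProd_one _
      have hA : ∀ d, (D d).relA (fun _ _ _ _ => (1 : kˣ)) = 1 := fun d => by
        simp [TriangleSides.relA]
      have hB : ∀ e, (E e).relB (fun _ _ _ _ => (1 : kˣ)) = 1 := fun e => pathProd_one _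
      simp only [hext, hA, hB, FramedChain.prod, Finset.prod_const_one, one_zpow,
        Finsupp.prod_fun_one, one_mul] at h1
      rw [prod_zpow_eq_single υ s₀ fun s hs => by rw [if_neg hs, one_pow, inv_one], if_pos rfl,
        ← zpow_natCast, ← zpow_neg, ← zpow_mul] at h1
      have h2 := eq_zero_of_two_zpow h1
      have := hm s₀
      rcases mul_eq_zero.1 h2 with h3 | h3
      · omega
      · exact h3
    subst hυ
    have hζ : ζ = 0 := by
      ext q₀
      obtain ⟨ρ, hρ, hA, hB, hv⟩ := exists_isRhoData_of_cycles hz hzi hP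
        fun q => if q = q₀ then two else 1
      have h1 := h ρ 1 hρ
      have hA' : ∀ d, (D d).relA ρ = 1 := fun d =>
        hA _ _ _ _ _ (D d).ne_ij (D d).ne_jl (D d).ne_li (D d).isSides.adj
          (D d).isSides.inter.symm.subset
      have hB' : ∀ e, (E e).relB ρ = 1 := fun e =>
        hB e.1 e.2.1 (by rw [e.2.2]) _ (E e).dual _ ((E e).eq.symm.subset (by simp)) _
          ((E e).eq.symm.subset (by simp)) (E e).ne
      simp only [hA', hB', hv, one_zpow, Finsupp.prod_fun_one, Finsupp.prod_zero_index, one_mul,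
        mul_one] at h1
      rw [prod_zpow_eq_single ζ q₀ fun q hq => if_neg hq, if_pos rfl] at h1
      exact eq_zero_of_two_zpow h1
    subst hζ
    obtain ⟨c, h1, h2⟩ := exists_const_of_incident hK hconn (α := α) (β := β) fun d e hed => by
      obtain ⟨v, hv⟩ := Finset.card_eq_one.1 (show (d.1 \ e.1).card = 1 by
        rw [Finset.card_sdiff_of_subset hed, d.2.2, e.2.2])
      have hvd : v ∈ d.1 := (Finset.mem_sdiff.1 (hv ▸ Finset.mem_singleton_self v)).1
      let p₀ : Flag K := ⟨d, ⟨v, hvd⟩⟩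
      have hp₀ : p₀.edge = e := by
        refine Subtype.ext ?_
        change d.1.erase v = e.1
        rw [← Finset.sdiff_singleton_eq_erase, ← hv, Finset.sdiff_sdiff_eq_self hed]
      obtain ⟨ρ, hρ, hf⟩ := exists_isRhoData ho fun p => if p = p₀ then two else 1
      have h1 := h ρ 1 hρ
      rw [Finsupp.prod_zero_index, Finsupp.prod_zero_index, mul_one, mul_one,
        prod_relA_mul_prod_relB hK ho D E hf, Finset.prod_eq_single p₀, if_pos rfl, hp₀] at h1
      · exact eq_zero_of_two_zpow h1
      · intro p _ hp
        rw [if_neg hp, one_zpow]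
      · exact fun hp => absurd (Finset.mem_univ _) hp
    exact ⟨c, h1, h2, rfl, rfl⟩
  · rintro ⟨c, h1, h2, rfl, rfl⟩ ρ y hρ
    obtain ⟨f, hf⟩ := exists_hasFlagValues hK ho hρ
    rw [Finsupp.prod_zero_index, Finsupp.prod_zero_index, mul_one, mul_one,
      prod_relA_mul_prod_relB hK ho D E hf]
    refine Finset.prod_eq_one fun p _ => ?_
    rw [h1, h2, add_neg_cancel, zpow_zero]

end Dependence

end DiscreteDG

end

theorem theorem1 {V : Type*} [LinearOrder V] {k : Type*} [RCLike k]
    (K : AbstractSimplicialComplex V) (n : ℕ) (hn : 2 ≤ n) (hK : IsHomologyManifold K n)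
    {κ τ ι : Type*} (γ : κ → FramedLoop K n) (a : τ → FramedLoop K n) (m : τ → ℕ)
    (hbasis : IsH1Basis γ a m) :
    -- the quantities for closest neighbours determine all the others
    (∀ (i j : V) (T T' : Facet K n), i ≠ j → {i, j} ⊆ T.1 → {i, j} ⊆ T'.1 →
      (∃ l, IsStarPath {i, j} T T' l) ∧
      ∀ (l : List (Facet K n)) (b : Connection K n k), IsStarPath {i, j} T T' l →
        pathProd (rho b i j) l = rho b i j T T') ∧
    -- gauge invariance
    (∀ b b' : Connection K n k, GaugeEquiv b b' →
      (∀ (i j : V) (T T' : Facet K n), {i, j} ⊆ T.1 ∩ T'.1 → rho b i j T T' = rho b' i j T T') ∧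
      ∀ δ : FramedLoop K n, holonomy b δ = holonomy b' δ) ∧
    -- completeness of the invariants
    (∀ b b' : Connection K n k,
      (∀ (i j : V) (T T' : Facet K n), i ≠ j → Adj T T' → {i, j} ⊆ T.1 ∩ T'.1 →
        rho b i j T T' = rho b' i j T T') →
      (∀ q, holonomy b (γ q) = holonomy b' (γ q)) →
      (∀ s, holonomy b (a s) = holonomy b' (a s)) → GaugeEquiv b b') ∧
    -- the relations hold for every connection
    (∀ b : Connection K n k,
      (∀ (i j l : V) (T T' : Facet K n), i ≠ j → j ≠ l → l ≠ i → {i, j, l} ⊆ T.1 ∩ T'.1 →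
        rho b i j T T' * rho b j l T T' * rho b l i T T' = 1) ∧
      (∀ (i j : V) (T : Facet K n) (l : List (Facet K n)), i ≠ j → IsStarPath {i, j} T T l →
        pathProd (rho b i j) l = 1) ∧
      (∀ z : FramedCycle K n, z.prod (rho b) = 1) ∧
      (∀ (δ : FramedLoop K n) (r : ℕ) (u : FramedChain K n (δ.times r)),
        u.prod (rho b) = holonomy b δ ^ r)) ∧
    -- the complete set of relations, realization and uniqueness
    (∀ (P : V → V → Facet K n → Facet K n → List (Facet K n)), IsPathSystem P →
      ∀ (z : ι → FramedCycle K n), GeneratesH2 z →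
      ∀ (u : ∀ s, FramedChain K n ((a s).times (m s)))
        (ρ : V → V → Facet K n → Facet K n → kˣ) (x : κ → kˣ) (y : τ → kˣ),
      ((IsRhoData ρ ∧ RelationA ρ ∧ RelationB ρ ∧
          (∀ q, (z q).prod (extend P ρ) = 1) ∧
          (∀ s, (u s).prod (extend P ρ) = y s ^ m s)) ↔
        ∃ b : Connection K n k, Realizes γ a b ρ x y) ∧
      ∀ b b' : Connection K n k, Realizes γ a b ρ x y → Realizes γ a b' ρ x y →
        GaugeEquiv b b') ∧
    -- oriented surfaces: one global relation
    (n = 2 → K.faces.Finite → IsConnected K →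
      ∀ o : Facet K n → ℤ, IsOrientation o →
      ∀ E : ∀ e : Simplices K 2, EdgeSides o e.1,
      ∀ (ρ : V → V → Facet K n → Facet K n → kˣ) (x : κ → kˣ) (y : τ → kˣ), IsRhoData ρ →
        ((∏ᶠ e, ρ (E e).i (E e).j (E e).T (E e).T') = 1 ↔
          ∃ b : Connection K n k, Realizes γ a b ρ x y)) ∧
    -- oriented 3-manifolds: exactly one dependence among the relations
    (n = 3 → K.faces.Finite → IsConnected K →
      ∀ o : Facet K n → ℤ, IsOrientation o →
      ∀ (D : ∀ d : Simplices K 3, TriangleSides o d.1) (E : ∀ e : Simplices K 2, EdgeCircuit o e.1)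
        (P : V → V → Facet K n → Facet K n → List (Facet K n)), IsPathSystem P →
      ∀ (z : ι → FramedCycle K n), GeneratesH2 z → IndependentInH2 z →
      ∀ (u : ∀ s, FramedChain K n ((a s).times (m s)))
        (α : Simplices K 3 →₀ ℤ) (β : Simplices K 2 →₀ ℤ) (ζ : ι →₀ ℤ) (υ : τ →₀ ℤ),
      ((∀ (ρ : V → V → Facet K n → Facet K n → kˣ) (y : τ → kˣ), IsRhoData ρ →
          (α.prod fun d e => (D d).relA ρ ^ e) * (β.prod fun d e => (E d).relB ρ ^ e) *
            (ζ.prod fun q e => (z q).prod (extend P ρ) ^ e) *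
            (υ.prod fun s e => ((u s).prod (extend P ρ) * (y s ^ m s)⁻¹) ^ e) = 1) ↔
        ∃ c : ℤ, (∀ d, α d = c) ∧ (∀ e, β e = -c) ∧ ζ = 0 ∧ υ = 0)) := by
  have pot {b : Connection K n k} : IsPotential Adj (connCochain b) (rho b) :=
    (isPotential_connCochain b).mono fun _ _ _ => trivial
  have path {b : Connection K n k} {i j : V} {T T' : Facet K n} {l : List (Facet K n)}
      (hij : i ≠ j) (hl : IsStarPath {i, j} T T' l) :
      Additive.ofMul (pathProd (rho b i j) l) =
        connCochain b T (orientedSimplex [i, j]) - connCochain b T' (orientedSimplex [i, j]) :=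
    hl.ofMul_pathProd fun _ _ => pot.starAdj hij
  refine ⟨fun i j T T' hij hT hT' =>
      ⟨exists_isStarPath hK (T.mem_faces_of_subset hT (by simp)) hT hT', fun l b hl => ?_⟩,
    fun b b' h => ⟨fun i j T T' hs => rho_of_gaugeEquiv h hs, holonomy_of_gaugeEquiv h⟩,
    fun b b' => gaugeEquiv_of_invariants hK hbasis,
    fun b => ⟨fun i j l T T' hij hjl hli hs => ?_, fun i j T l hij hl => ?_,
      FramedCycle.prod_rho b, fun δ r u => FramedChain.prod_rho_times b u⟩,
    fun P hP z hz u ρ x y => ⟨⟨?_, ?_⟩, fun b b' hb hb' => ?_⟩, ?_, ?_⟩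
  · apply Additive.ofMul.injective
    rw [path hij hl, isPotential_connCochain b i j T T' hij trivial (Finset.subset_inter hT hT')]
  · exact (isPotential_connCochain b).relationA (connCochain_coboundary b) hij hjl hli trivial hs
  · apply Additive.ofMul.injective
    rw [path hij hl, sub_self, ofMul_one]
  · rintro ⟨hρ, hA, hB, hz1, hu⟩
    exact exists_realizes_of_relations hK hn hbasis hP hz u x y hρ hA hB hz1 hu
  · rintro ⟨b, hb⟩
    obtain ⟨hρ, hA, hB, hz1, hu⟩ := hb.relations hP u
    exact ⟨hρ, hA, hB, fun q => hz1 (z q), hu⟩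
  · refine gaugeEquiv_of_invariants hK hbasis (fun i j T T' hij hT hs => ?_) (fun q => ?_)
      fun s => ?_
    · rw [hb.1 i j T T' hij hT hs, hb'.1 i j T T' hij hT hs]
    · rw [hb.2.1, hb'.2.1]
    · rw [hb.2.2, hb'.2.2]
  · rintro rfl hfin hconn o ho E ρ x y hρ
    exact surface_realizes_iff hK hfin hconn ho E hbasis x y hρ
  · rintro rfl hfin hconn o ho D E P hP z hz hzi u α β ζ υ
    exact threeManifold_dependence_iff hK hbasis.two_le hfin hconn ho D E hP hz hzi u α β ζ υ
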